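/- Let $X$ be a compact connected Kähler manifold, $\omega$ a Kähler form on $X$, $T$ a current on $X$ which is a difference of two positive closed $(1,1)$-currents, $\Omega$ a smooth closed real $(1,1)$-form on $X$, and $n\in\mathbb{N}$. A function $u:X\to[-\infty,\infty)$ is called $n\omega$-psh if it is upper semicontinuous, not identically $-\infty$, and $n\omega+dd^cu\ge 0$, that is, locally $g+u$ is plurisubharmonic whenever $g$ is a smooth function with $dd^cg=n\omega$. Let $\mathcal{R}_{\omega,n}(T,\Omega)$ be the set of all pairs $(u^+,u^-)$ of $n\omega$-psh functions such that $T=\Omega+dd^cu^+-dd^cu^-$ as currents, and assume that $\mathcal{R}_{\omega,n}(T,\Omega)\neq\emptyset$. For functions $u,v:X\to[-\infty,\infty)$, say that $u$ is at most as singular as $v$ if $v\le u+C$ on $X$ for some constant $C\in\mathbb{R}$; a pair $(u^+,u^-)$ is at most as singular as $(v^+,v^-)$ if $u^+$ is at most as singular as $v^+$ and $u^-$ is at most as singular as $v^-$. (1) There is a pair $(u^+_{\omega,n},u^-_{\omega,n})\in\mathcal{R}_{\omega,n}(T,\Omega)$ which is at most as singular as every pair $(w^+,w^-)\in\mathcal{R}_{\omega,n}(T,\Omega)$.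 (2) Such a pair can be built as follows. Let $(v^+,v^-)\in\mathcal{R}_{\omega,n}(T,\Omega)$ be arbitrary, let $I=\{v^+=-\infty\}\cup\{v^-=-\infty\}$, and let $\phi=v^+-v^-$ on $X\setminus I$. Let $\mathcal{A}$ be the set of all $n\omega$-psh functions $u\le 0$ such that $u+\phi$ is the restriction to $X\setminus I$ of an $n\omega$-psh function on $X$. Let $u^-$ be the upper semicontinuous regularisation of $\sup_{u\in\mathcal{A}}u$. Then there is an $n\omega$-psh function $u^+$ with $u^+=u^-+\phi$ on $X\setminus I$ such that $(u^+,u^-)\in\mathcal{R}_{\omega,n}(T,\Omega)$ and $(u^+,u^-)$ is at most as singular as every pair in $\mathcal{R}_{\omega,n}(T,\Omega)$. -/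

import Mathlib

open scoped Manifold ContDiff Topology
open MeasureTheory

noncomputable section

namespace QuasiPsh

/-- The model space `ℂᵏ`, also used as the real vector space `ℝ²ᵏ`. -/
abbrev Cn (k : ℕ) : Type := Fin k → ℂ

/-! ### Differential calculus in `ℂᵏ` -/

/-- Multiplication by a complex number, as a real-linear endomorphism of `ℂᵏ`. -/
def mulC (k : ℕ) (c : ℂ) : Cn k →L[ℝ] Cn k :=
  (c • ContinuousLinearMap.id ℂ (Cn k)).restrictScalars ℝ

/-- The operator `dᶜ = i (∂̄ - ∂)` on forms on `ℂᵏ`, written as `(J⁻¹)^* ∘ d ∘ J^*` where `J` is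
multiplication by `i`. On functions, `dᶜ u (v) = - du (J v)`, so that `ddᶜ = 2 i ∂ ∂̄`. -/
def dcForm {k m : ℕ} (α : Cn k → Cn k [⋀^Fin m]→L[ℝ] ℝ) (y : Cn k) :
    Cn k [⋀^Fin (m + 1)]→L[ℝ] ℝ :=
  (extDeriv (fun z => (α z).compContinuousLinearMap (mulC k Complex.I)) y).compContinuousLinearMap
    (mulC k (-Complex.I))

/-- The operator `ddᶜ` on forms on `ℂᵏ`. -/
def ddcForm {k m : ℕ} (α : Cn k → Cn k [⋀^Fin m]→L[ℝ] ℝ) :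
    Cn k → Cn k [⋀^Fin (m + 2)]→L[ℝ] ℝ :=
  extDeriv (dcForm α)

/-- The operator `ddᶜ` on real functions on `ℂᵏ`, seen as forms of degree zero. -/
def ddcFun {k : ℕ} (g : Cn k → ℝ) : Cn k → Cn k [⋀^Fin 2]→L[ℝ] ℝ :=
  ddcForm (m := 0) (fun y => ContinuousAlternatingMap.constOfIsEmpty ℝ (Cn k) (Fin 0) (g y))

/-- The value `(α ∧ β)(v)` of the wedge product of a `2`-form and an `m`-form at a point
(normalised so that `dx₁ ∧ ... ∧ dxᵣ` takes the value `1` on the dual basis). -/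
def wedgeTwo {k m : ℕ} (α : Cn k [⋀^Fin 2]→L[ℝ] ℝ) (β : Cn k [⋀^Fin m]→L[ℝ] ℝ)
    (v : Fin (m + 2) → Cn k) : ℝ :=
  (1 / (2 * (m.factorial : ℝ))) * ∑ σ : Equiv.Perm (Fin (m + 2)),
    (((Equiv.Perm.sign σ : ℤ) : ℝ)) * α ![v (σ 0), v (σ 1)] * β (fun i => v (σ i.succ.succ))

/-- The list `w₀, i w₀, w₁, i w₁, ...` attached to vectors `w₀, w₁, ...`. -/
def complexPairs {V : Type*} [SMul ℂ V] {p : ℕ} (w : Fin p → V) : Fin (2 * p) → V :=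
  fun j => (if (j : ℕ) % 2 = 0 then (1 : ℂ) else Complex.I) • w ⟨(j : ℕ) / 2, by omega⟩

/-- The standard oriented real basis `e₀, i e₀, e₁, i e₁, ...` of `ℂᵏ`. A form of top degree is
`f` times the standard volume form, where `f` is its value on this basis. -/
def stdBasis (k : ℕ) : Fin (2 * k) → Cn k :=
  complexPairs (fun j : Fin k => (Pi.single j (1 : ℂ) : Cn k))

/-! ### Plurisubharmonic functions on open subsets of `ℂᵏ` -/

/-- The Lebesgue integral over `(0, 1]` of a function with values in `[-∞, ∞)` that is bounded
above: the integral of the positive part minus that of the negative part. -/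
def erealIntegral (f : ℝ → EReal) : EReal :=
  ((∫⁻ t in Set.Ioc (0 : ℝ) 1, (f t).toENNReal : ENNReal) : EReal) -
    ((∫⁻ t in Set.Ioc (0 : ℝ) 1, (-(f t)).toENNReal : ENNReal) : EReal)

/-- The mean value of `f` over the circle `{a + ζ b : |ζ| = 1}`. -/
def circleMean {k : ℕ} (f : Cn k → EReal) (a b : Cn k) : EReal :=
  erealIntegral (fun t => f (a + Complex.exp (2 * Real.pi * t * Complex.I) • b))

/-- `f` is plurisubharmonic on `V` (the function that is `-∞` everywhere is included here). -/
structure PshOn {k : ℕ} (f : Cn k → EReal) (V : Set (Cn k)) : Prop where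
  usc : UpperSemicontinuousOn f V
  ne_top : ∀ y ∈ V, f y ≠ ⊤
  submean : ∀ a b : Cn k, (∀ ζ : ℂ, ‖ζ‖ ≤ 1 → a + ζ • b ∈ V) → f a ≤ circleMean f a b

/-! ### Forms on a complex manifold -/

section Manifold

variable (k : ℕ) (X : Type*) [TopologicalSpace X] [ChartedSpace (Cn k) X]

/-- A real differential form of degree `m` on the complex manifold `X`, with no regularity. -/
abbrev RawForm (m : ℕ) : Type _ :=
  (x : X) → (TangentSpace 𝓘(ℂ, Cn k) x) [⋀^Fin m]→L[ℝ] ℝ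

variable {k X}

/-- The expression of a form in a chart `e`, i.e. its pullback under `e⁻¹`. -/
def rawInChart {m : ℕ} (α : RawForm k X m) (e : OpenPartialHomeomorph X (Cn k)) (y : Cn k) :
    Cn k [⋀^Fin m]→L[ℝ] ℝ :=
  (α (e.symm y)).compContinuousLinearMap
    ((mfderiv 𝓘(ℂ, Cn k) 𝓘(ℂ, Cn k) e.symm y).restrictScalars ℝ)

variable (k X) in
/-- The real vector space of smooth real differential forms of degree `m` on `X`. -/
def SmoothForm (m : ℕ) : Submodule ℝ (RawForm k X m) where
  carrier := {α | ∀ e ∈ atlas (Cn k) X, ContDiffOn ℝ ∞ (rawInChart α e) e.target}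
  add_mem' := fun ha hb e he => (ha e he).add (hb e he)
  zero_mem' := fun _ _ => contDiffOn_const (c := (0 : Cn k [⋀^Fin m]→L[ℝ] ℝ))
  smul_mem' := fun c _ ha e he => (ha e he).const_smul c

/-- The expression of a smooth form in a chart. -/
abbrev inChart {m : ℕ} (α : SmoothForm k X m) (e : OpenPartialHomeomorph X (Cn k)) :
    Cn k → Cn k [⋀^Fin m]→L[ℝ] ℝ :=
  rawInChart α.1 e

/-- Pointwise rotation `(R_c α)(v₁, ..., vₘ) = α (c v₁, ..., c vₘ)`; on forms of type `(p, q)` and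
for `|c| = 1` it is multiplication by `c ^ (p - q)`. -/
def IsRotation {m : ℕ} (c : ℂ) (α β : SmoothForm k X m) : Prop :=
  ∀ (x : X) (v : Fin m → TangentSpace 𝓘(ℂ, Cn k) x), β.1 x v = α.1 x (fun i => c • v i)

/-- A real form is of type `(p, p)` (with `m = 2 p`) iff it is invariant under all rotations. -/
def IsPP {m : ℕ} (α : SmoothForm k X m) : Prop :=
  ∀ c : ℂ, ‖c‖ = 1 → IsRotation c α α

/-- `β = dα`. -/
def IsExtDeriv {m n : ℕ} (h : n = m + 1) (α : SmoothForm k X m) (β : SmoothForm k X n) : Prop :=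
  ∀ e ∈ atlas (Cn k) X, ∀ y ∈ e.target, ∀ v : Fin (m + 1) → Cn k,
    inChart β e y (fun i => v (Fin.cast h i)) = extDeriv (inChart α e) y v

/-- Closed forms: `dα = 0`. -/
def IsClosedForm {m : ℕ} (α : SmoothForm k X m) : Prop :=
  ∀ e ∈ atlas (Cn k) X, ∀ y ∈ e.target, extDeriv (inChart α e) y = 0

/-- Kähler forms: closed real `(1,1)`-forms that are (strictly) positive. -/
structure IsKahler (κ : SmoothForm k X 2) : Prop where
  type11 : IsPP κ
  closed : IsClosedForm κ
  pos : ∀ (x : X) (v : TangentSpace 𝓘(ℂ, Cn k) x), v ≠ 0 → 0 < κ.1 x ![v, Complex.I • v]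

/-- Positive smooth forms of bidegree `(p, p)`: the restriction to each complex `p`-dimensional
subspace of a tangent space is non-negative. (The only case used below is `p = dim X - 1`, where
weak and strong positivity agree.) -/
structure IsPositiveForm {p : ℕ} (ψ : SmoothForm k X (2 * p)) : Prop where
  typePP : IsPP ψ
  nonneg : ∀ (x : X) (w : Fin p → TangentSpace 𝓘(ℂ, Cn k) x), 0 ≤ ψ.1 x (complexPairs w)

/-- The form `ψ` vanishes outside the part of the chart domain that corresponds to `K`. -/
def SupportedIn {m : ℕ} (ψ : SmoothForm k X m) (e : OpenPartialHomeomorph X (Cn k))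
    (K : Set (Cn k)) : Prop :=
  ∀ x : X, x ∉ e.symm '' K → ψ.1 x = 0

/-! ### Quasi-plurisubharmonic functions -/

/-- `u : X → [-∞, ∞)` is `θ`-plurisubharmonic for a smooth closed `(1,1)`-form `θ`, that is, `u` is
upper semicontinuous, not identically `-∞`, and `θ + ddᶜ u ≥ 0`: locally, `g + u` is
plurisubharmonic for a smooth function `g` with `ddᶜ g = θ`. -/
structure IsThetaPsh (θ : SmoothForm k X 2) (u : X → EReal) : Prop where
  usc : UpperSemicontinuous u
  ne_top : ∀ x, u x ≠ ⊤
  ne_bot : ∃ x, u x ≠ ⊥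
  psh : ∀ e ∈ atlas (Cn k) X, ∀ y ∈ e.target, ∃ (V : Set (Cn k)) (g : Cn k → ℝ),
    IsOpen V ∧ y ∈ V ∧ V ⊆ e.target ∧ ContDiffOn ℝ ∞ g V ∧
    (∀ z ∈ V, ddcFun g z = inChart θ e z) ∧ PshOn (fun z => (g z : EReal) + u (e.symm z)) V

end Manifold

/-! ### Currents of bidegree `(1,1)` on a compact complex manifold of dimension `d + 1` -/

section Currents

variable (d : ℕ) (X : Type*) [TopologicalSpace X] [ChartedSpace (Cn (d + 1)) X]

/-- A real current of bidegree `(1,1)` on a compact complex manifold of dimension `d + 1`: a linear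
functional on the smooth forms of degree `2 d`, continuous for the `C^∞` topology, which depends
only on the component of type `(d, d)`, i.e. is invariant under rotations. -/
structure Current11 where
  toLin : SmoothForm (d + 1) X (2 * d) →ₗ[ℝ] ℝ
  continuous' : ∀ e ∈ atlas (Cn (d + 1)) X, ∀ K ⊆ e.target, IsCompact K →
    ∃ (C : ℝ) (N : ℕ), ∀ ψ : SmoothForm (d + 1) X (2 * d), SupportedIn ψ e K → ∀ M : ℝ, 0 ≤ M →
      (∀ j ≤ N, ∀ y ∈ K, ‖iteratedFDeriv ℝ j (inChart ψ e) y‖ ≤ M) → |toLin ψ| ≤ C * M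
  type11 : ∀ c : ℂ, ‖c‖ = 1 → ∀ ψ χ : SmoothForm (d + 1) X (2 * d),
    IsRotation c ψ χ → toLin χ = toLin ψ

variable {d X}

/-- `dT = 0`. -/
def Current11.IsClosed (T : Current11 d X) : Prop :=
  ∀ (m : ℕ) (h : 2 * d = m + 1) (η : SmoothForm (d + 1) X m) (ζ : SmoothForm (d + 1) X (2 * d)),
    IsExtDeriv h η ζ → T.toLin ζ = 0

/-- `T ≥ 0`. -/
def Current11.IsPositive (T : Current11 d X) : Prop :=
  ∀ ψ : SmoothForm (d + 1) X (2 * d), IsPositiveForm ψ → 0 ≤ T.toLin ψ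

/-- `T` is a difference of two positive closed `(1,1)`-currents. -/
def Current11.IsDiffPosClosed (T : Current11 d X) : Prop :=
  ∃ T₁ T₂ : Current11 d X, T₁.IsPositive ∧ T₁.IsClosed ∧ T₂.IsPositive ∧ T₂.IsClosed ∧
    T.toLin = T₁.toLin - T₂.toLin

/-- The equality of currents `T = Ω + ddᶜ (u⁺ - u⁻)`: for each test form `ψ` with compact support in
a chart domain, `⟨T, ψ⟩ = ∫ Ω ∧ ψ + ∫ (u⁺ - u⁻) ddᶜ ψ`, computed in the chart. -/
def EqAddDdc (T : Current11 d X) (Ω : SmoothForm (d + 1) X 2) (up um : X → EReal) : Prop :=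
  ∀ e ∈ atlas (Cn (d + 1)) X, ∀ K ⊆ e.target, IsCompact K →
    ∀ ψ : SmoothForm (d + 1) X (2 * d), SupportedIn ψ e K →
      T.toLin ψ = ∫ y in e.target,
        (wedgeTwo (inChart Ω e y) (inChart ψ e y) (stdBasis (d + 1)) +
          ((up (e.symm y)).toReal - (um (e.symm y)).toReal) *
            ddcForm (inChart ψ e) y (stdBasis (d + 1)))

/-- The set `R_{κ,n}(T, Ω)` of the pairs `(u⁺, u⁻)` of `nκ`-plurisubharmonic functions such that
`T = Ω + ddᶜ u⁺ - ddᶜ u⁻`. -/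
def Representations (κ : SmoothForm (d + 1) X 2) (n : ℕ) (T : Current11 d X) (Ω : SmoothForm (d + 1) X 2) :
    Set ((X → EReal) × (X → EReal)) :=
  {u | IsThetaPsh ((n : ℝ) • κ) u.1 ∧ IsThetaPsh ((n : ℝ) • κ) u.2 ∧ EqAddDdc T Ω u.1 u.2}

/-- For a pair `v = (v⁺, v⁻)` and `φ = v⁺ - v⁻`, defined where both are finite, the set of all
`u ≤ 0` such that `u` and `u + φ` are `nκ`-plurisubharmonic; for `u + φ` this means that it is the
restriction of an `nκ`-plurisubharmonic function `w` to the set where `φ` is defined. -/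
def Admissible (κ : SmoothForm (d + 1) X 2) (n : ℕ) (v : (X → EReal) × (X → EReal)) :
    Set (X → EReal) :=
  {u | IsThetaPsh ((n : ℝ) • κ) u ∧ (∀ x, u x ≤ 0) ∧
    ∃ w : X → EReal, IsThetaPsh ((n : ℝ) • κ) w ∧
      ∀ x, v.1 x ≠ ⊥ → v.2 x ≠ ⊥ → w x = u x + (v.1 x - v.2 x)}

end Currents

/-- The upper semicontinuous regularisation of the pointwise supremum of a family of functions. -/
def regSup {X : Type*} [TopologicalSpace X] (S : Set (X → EReal)) (x : X) : EReal :=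
  Filter.limsup (fun y => ⨆ u ∈ S, u y) (𝓝 x)

/-- `u` is at most as singular as `v`: `v ≤ u + O(1)`. -/
def LessSingular {X : Type*} (u v : X → EReal) : Prop :=
  ∃ C : ℝ, ∀ x, v x ≤ u x + (C : EReal)

/-- The pair `u` is at most as singular as the pair `v`, in both components. -/
def PairLessSingular {X : Type*} (u v : (X → EReal) × (X → EReal)) : Prop :=
  LessSingular u.1 v.1 ∧ LessSingular u.2 v.2

end QuasiPsh

end

open QuasiPsh

/-!
The difference `φ = v⁺ - v⁻` attached to a representation `v` determines the current, and conversely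
the current determines `φ` up to a constant. Granting this, the envelope `u⁻` of the admissible
functions `u` and the envelope `u⁺` of the extensions of `u + φ` solve the problem. Both are
`nω`-plurisubharmonic (`isThetaPsh_regSup`), `u⁺ = u⁻ + φ` where `φ` is defined
(`regSup_extensions_add_eq`), so that they represent the same current, and if `(w⁺, w⁻)` is another
representation, then `w⁻ - C` is admissible, with extension `w⁺ - C'`, for suitable constants
(`exists_sub_const_mem`), whence `w⁻ ≤ u⁻ + C` and `w⁺ ≤ u⁺ + C'`.

Three points carry the proof.

* Envelopes. The sub-mean value inequality is local (`pshOn_of_local`, by comparison with real parts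
  of entire functions), so the local potential of `nω` can be chosen once for a whole family
  (`IsThetaPsh.pshOn`), and the inequality passes to the regularised supremum by Fatou's lemma.

* Comparison. Averages with respect to radial kernels `ρ_t` turn inequalities `u + p ≤ a + b` that
  hold almost everywhere, for all members `u` of a family, into inequalities for the envelope that
  hold everywhere (`add_le_of_kernAvg_le`, `regSup_add_le_of_ae`): quasi-plurisubharmonic functions
  are almost bounded by their averages on small balls, the averages depend continuously on the centre,
  and the right hand side is upper semicontinuous. It follows that `u⁺ + v⁻ = u⁻ + v⁺` everywhere,
  also where these functions are `-∞`.

* Uniqueness up to constants (`exists_const_add_eq`). Testing the equation of currents against the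
  forms `σ ∑ⱼ βⱼ` in a chart, where `βⱼ` is the volume form of the `j`-th coordinate hyperplane, shows
  that the difference `h` of two solutions `φ` is weakly harmonic in each chart
  (`EqAddDdc.setIntegral_mul_lap`). As `∂ρ_t / ∂t` is the Laplacian of a compactly supported function
  (`kernDeriv_eq_lap`), the averages of `h` do not depend on `t`, hence `h` agrees almost everywhere
  with a continuous function with a mean value property (Weyl's lemma), and this function is constant
  by the maximum principle (`exists_eq_const_of_kernAvg_eq`).

Integrals of functions with values in `[-∞, ∞)` bounded above by `M` are computed through the defect
`gap M`, which has values in `[0, ∞]`.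
-/

namespace QuasiPsh

open Set Filter

/-! ### Integrals of functions with values in `[-∞, ∞)` -/

/-- The defect `M - x`, as an extended non-negative number. For functions bounded above by `M`, it
turns integrals of functions with values in `[-∞, ∞)` into Lebesgue integrals. -/
noncomputable def gap (M : ℝ) (x : EReal) : ENNReal := ((M : EReal) - x).toENNReal

lemma gap_antitone (M : ℝ) : Antitone (gap M) := fun _ _ h =>
  EReal.toENNReal_le_toENNReal (EReal.sub_le_sub le_rfl h)

lemma measurable_gap (M : ℝ) : Measurable (gap M) := (gap_antitone M).measurable

lemma continuous_gap (M : ℝ) : Continuous (gap M) := by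
  have : Continuous fun x : EReal => (M : EReal) - x := by
    refine continuous_iff_continuousAt.2 fun x => ?_
    simp only [sub_eq_add_neg]
    exact ContinuousAt.comp (f := fun x : EReal => ((M : EReal), -x))
      (EReal.continuousAt_add (by simp) (by simp)) (by fun_prop)
  exact EReal.continuous_toENNReal.comp this

lemma gap_coe (M x : ℝ) : gap M (x : EReal) = ENNReal.ofReal (M - x) := by
  rw [gap, ← EReal.coe_sub, EReal.toENNReal_of_ne_top (EReal.coe_ne_top _), EReal.toReal_coe]

lemma gap_bot (M : ℝ) : gap M ⊥ = ⊤ := by simp [gap]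

lemma gap_ne_top_iff {M : ℝ} {x : EReal} : gap M x ≠ ⊤ ↔ x ≠ ⊥ := by
  induction x with
  | bot => simp [gap_bot]
  | coe x => simp [gap_coe]
  | top => simp [gap]

lemma gap_add_toENNReal {M : ℝ} (hM : 0 ≤ M) {x : EReal} (hx : x ≤ M) :
    gap M x + x.toENNReal = ENNReal.ofReal M + (-x).toENNReal := by
  induction x with
  | bot => simp [gap_bot]
  | top => simp at hx
  | coe x =>
    have hx' : x ≤ M := by exact_mod_cast hx
    rw [gap_coe, ← EReal.coe_neg, EReal.toENNReal_of_ne_top (EReal.coe_ne_top _),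
      EReal.toENNReal_of_ne_top (EReal.coe_ne_top _), EReal.toReal_coe, EReal.toReal_coe]
    rcases le_total 0 x with h | h
    · rw [ENNReal.ofReal_of_nonpos (p := -x) (by linarith), add_zero,
        ← ENNReal.ofReal_add (by linarith) h]
      congr 1; ring
    · rw [ENNReal.ofReal_of_nonpos h, add_zero, ← ENNReal.ofReal_add hM (by linarith)]
      congr 1

/-- The integral of a function bounded above by `M` is `M` minus the integral of the defect. -/
lemma erealIntegral_eq {f : ℝ → EReal} {M : ℝ} (hM : 0 ≤ M)
    (hf : AEMeasurable f (volume.restrict (Ioc (0 : ℝ) 1))) (hfM : ∀ t ∈ Ioc (0 : ℝ) 1, f t ≤ M) :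
    erealIntegral f = (M : EReal) - ((∫⁻ t in Ioc (0 : ℝ) 1, gap M (f t) : ENNReal) : EReal) := by
  have h1 : (∫⁻ t in Ioc (0 : ℝ) 1, gap M (f t)) + ∫⁻ t in Ioc (0 : ℝ) 1, (f t).toENNReal
      = ENNReal.ofReal M + ∫⁻ t in Ioc (0 : ℝ) 1, (-(f t)).toENNReal := by
    have hg : AEMeasurable (fun t => gap M (f t)) (volume.restrict (Ioc (0 : ℝ) 1)) :=
      (measurable_gap M).comp_aemeasurable hf
    rw [← lintegral_add_left' hg]
    rw [setLIntegral_congr_fun measurableSet_Ioc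
      (g := fun t => ENNReal.ofReal M + (-(f t)).toENNReal)
      (fun t ht => gap_add_toENNReal hM (hfM t ht))]
    rw [lintegral_add_left measurable_const]
    simp
  have h2 : ∫⁻ t in Ioc (0 : ℝ) 1, (f t).toENNReal ≤ ENNReal.ofReal M := by
    calc ∫⁻ t in Ioc (0 : ℝ) 1, (f t).toENNReal ≤ ∫⁻ t in Ioc (0 : ℝ) 1, ENNReal.ofReal M := by
          refine setLIntegral_mono measurable_const fun t ht => ?_
          rw [← EReal.toReal_coe M, ← EReal.toENNReal_of_ne_top (EReal.coe_ne_top _)]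
          exact EReal.toENNReal_le_toENNReal (hfM t ht)
      _ = ENNReal.ofReal M := by simp
  unfold erealIntegral
  set P := ∫⁻ t in Ioc (0 : ℝ) 1, (f t).toENNReal
  set N := ∫⁻ t in Ioc (0 : ℝ) 1, (-(f t)).toENNReal
  set G := ∫⁻ t in Ioc (0 : ℝ) 1, gap M (f t)
  have hP : P ≠ ⊤ := ne_top_of_le_ne_top ENNReal.ofReal_ne_top h2
  by_cases hN : N = ⊤
  · have hG : G = ⊤ := by
      rw [hN, add_top] at h1
      exact (ENNReal.add_eq_top.mp h1).resolve_right hP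
    rw [hN, hG]; simp
  · have hG : G ≠ ⊤ := by
      intro hG
      rw [hG, top_add] at h1
      exact (ENNReal.add_ne_top.2 ⟨ENNReal.ofReal_ne_top, hN⟩) h1.symm
    have h3 := congrArg ENNReal.toReal h1
    rw [ENNReal.toReal_add hG hP, ENNReal.toReal_add ENNReal.ofReal_ne_top hN,
      ENNReal.toReal_ofReal hM] at h3
    rw [← ENNReal.ofReal_toReal hP, ← ENNReal.ofReal_toReal hN, ← ENNReal.ofReal_toReal hG]
    simp only [EReal.coe_ennreal_ofReal, max_eq_left ENNReal.toReal_nonneg]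
    norm_cast
    linarith

lemma le_erealIntegral_iff {f : ℝ → EReal} {M : ℝ} (hM : 0 ≤ M)
    (hf : AEMeasurable f (volume.restrict (Ioc (0 : ℝ) 1))) (hfM : ∀ t ∈ Ioc (0 : ℝ) 1, f t ≤ M)
    {c : EReal} (hc : c ≤ M) :
    c ≤ erealIntegral f ↔ ∫⁻ t in Ioc (0 : ℝ) 1, gap M (f t) ≤ gap M c := by
  rw [erealIntegral_eq hM hf hfM, gap]
  set G := ∫⁻ t in Ioc (0 : ℝ) 1, gap M (f t)
  have h0 : (0 : EReal) ≤ M - c := by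
    rw [EReal.sub_nonneg] <;> simp [hc]
  rw [← EReal.coe_ennreal_le_coe_ennreal_iff, EReal.coe_toENNReal h0,
    EReal.le_sub_iff_add_le (by simp) (by simp), EReal.le_sub_iff_add_le, add_comm]
  · right; simp
  · left; intro h; simp [h] at hc

lemma erealIntegral_mono {f g : ℝ → EReal} (h : ∀ t ∈ Ioc (0 : ℝ) 1, f t ≤ g t) :
    erealIntegral f ≤ erealIntegral g := by
  unfold erealIntegral
  refine EReal.sub_le_sub ?_ ?_
  · rw [EReal.coe_ennreal_le_coe_ennreal_iff]
    exact setLIntegral_mono' measurableSet_Ioc fun t ht =>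
      EReal.toENNReal_le_toENNReal (h t ht)
  · rw [EReal.coe_ennreal_le_coe_ennreal_iff]
    exact setLIntegral_mono' measurableSet_Ioc fun t ht =>
      EReal.toENNReal_le_toENNReal (EReal.neg_le_neg_iff.2 (h t ht))

lemma erealIntegral_coe {f : ℝ → ℝ} (hf : Continuous f) :
    erealIntegral (fun t => (f t : EReal)) = ((∫ t in Ioc (0 : ℝ) 1, f t : ℝ) : EReal) := by
  have hi : IntegrableOn f (Ioc 0 1) :=
    (hf.integrableOn_Icc (a := 0) (b := 1)).mono_set Ioc_subset_Icc_self
  have hP : ∫⁻ t in Ioc (0 : ℝ) 1, ENNReal.ofReal (f t) ≠ ⊤ :=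
    (hi.lintegral_lt_top).ne
  have hN : ∫⁻ t in Ioc (0 : ℝ) 1, ENNReal.ofReal (-f t) ≠ ⊤ :=
    (hi.neg.lintegral_lt_top).ne
  have hc : ∀ x : ℝ, (x : EReal).toENNReal = ENNReal.ofReal x := fun x => by
    rw [EReal.toENNReal_of_ne_top (EReal.coe_ne_top _), EReal.toReal_coe]
  rw [integral_eq_lintegral_pos_part_sub_lintegral_neg_part hi]
  simp only [erealIntegral, ← EReal.coe_neg, hc]
  set P := ∫⁻ t in Ioc (0 : ℝ) 1, ENNReal.ofReal (f t)
  set N := ∫⁻ t in Ioc (0 : ℝ) 1, ENNReal.ofReal (-f t)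
  rw [← ENNReal.ofReal_toReal hP, ← ENNReal.ofReal_toReal hN]
  simp only [EReal.coe_ennreal_ofReal, max_eq_left ENNReal.toReal_nonneg,
    ENNReal.toReal_ofReal ENNReal.toReal_nonneg, EReal.coe_sub]

/-! ### Upper semicontinuous functions with values in `[-∞, ∞)` -/

/-- A function without the value `+∞` that is upper semicontinuous on a compact set is bounded
above there by a non-negative real number. -/
lemma exists_forall_le_of_usc {α : Type*} [TopologicalSpace α] {f : α → EReal} {s : Set α}
    (hs : IsCompact s) (hf : UpperSemicontinuousOn f s) (hne : ∀ x ∈ s, f x ≠ ⊤) :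
    ∃ M : ℝ, 0 ≤ M ∧ ∀ x ∈ s, f x ≤ M := by
  rcases s.eq_empty_or_nonempty with rfl | hs'
  · exact ⟨0, le_rfl, by simp⟩
  obtain ⟨a, ha, hmax⟩ := hf.exists_isMaxOn hs' hs
  refine ⟨max 0 (f a).toReal, le_max_left _ _, fun x hx => (hmax hx).trans ?_⟩
  refine (EReal.le_coe_toReal (hne a ha)).trans ?_
  exact_mod_cast le_max_right _ _

/-- Adding a continuous real function preserves upper semicontinuity. -/
lemma usc_coe_add {α : Type*} [TopologicalSpace α] {f : α → EReal} {g : α → ℝ} {s : Set α}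
    (hg : ContinuousOn g s) (hf : UpperSemicontinuousOn f s) :
    UpperSemicontinuousOn (fun x => (g x : EReal) + f x) s := by
  refine UpperSemicontinuousOn.add' ?_ hf fun x _ =>
    EReal.continuousAt_add (by simp) (by simp)
  intro x hx
  exact (continuous_coe_real_ereal.continuousAt.comp_continuousWithinAt
    (hg x hx)).upperSemicontinuousWithinAt

lemma measurable_piecewise_of_usc {α : Type*} [TopologicalSpace α] [MeasurableSpace α]
    [OpensMeasurableSpace α] {f : α → EReal} {V : Set α} (hV : IsOpen V)
    (hf : UpperSemicontinuousOn f V) (c : EReal) [∀ x, Decidable (x ∈ V)] :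
    Measurable (V.piecewise f (fun _ => c)) := by
  refine measurable_of_Iio fun y => ?_
  rw [piecewise_preimage]
  have h : IsOpen (V ∩ f ⁻¹' Iio y) := by
    rw [isOpen_iff_mem_nhds]
    rintro x ⟨hx, hxy⟩
    have := hf x hx y hxy
    rw [hV.nhdsWithin_eq hx] at this
    exact inter_mem (hV.mem_nhds hx) this
  have h2 : MeasurableSet (V.ite (f ⁻¹' Iio y) ((fun _ : α => c) ⁻¹' Iio y)) := by
    rw [Set.ite, inter_comm]
    refine h.measurableSet.union (MeasurableSet.diff ?_ hV.measurableSet)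
    exact measurable_const measurableSet_Iio
  exact h2

/-! ### Subharmonic functions on the unit disc: from small circles to the unit circle -/

/-- The point `exp (2 π i t)` of the unit circle. -/
noncomputable abbrev circlePt (t : ℝ) : ℂ := Complex.exp (2 * Real.pi * t * Complex.I)

lemma norm_circlePt (t : ℝ) : ‖circlePt t‖ = 1 := by
  have : (2 * Real.pi * t * Complex.I : ℂ) = ((2 * Real.pi * t : ℝ) : ℂ) * Complex.I := by
    push_cast; ring
  rw [circlePt, this, Complex.norm_exp_ofReal_mul_I]

lemma continuous_circlePt : Continuous circlePt := by unfold circlePt; fun_prop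

lemma circleAverage_eq_setIntegral (f : ℂ → ℝ) (c : ℂ) (r : ℝ) :
    Real.circleAverage f c r = ∫ t in Ioc (0 : ℝ) 1, f (c + r * circlePt t) := by
  have h := intervalIntegral.integral_comp_mul_left (a := 0) (b := 1)
    (fun θ => f (circleMap c r θ)) (c := 2 * Real.pi) (by positivity)
  rw [Real.circleAverage_def, ← intervalIntegral.integral_of_le zero_le_one]
  rw [mul_zero, mul_one] at h
  rw [← h]
  refine intervalIntegral.integral_congr fun t _ => ?_
  simp only [circleMap, circlePt]
  push_cast
  rfl

lemma setIntegral_re_circle {q : ℂ → ℂ} (hq : Differentiable ℂ q) (c : ℂ) (r : ℝ) :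
    ∫ t in Ioc (0 : ℝ) 1, (q (c + r * circlePt t)).re = (q c).re := by
  have h := circleAverage_eq_setIntegral (fun z => (q z).re) c r
  rw [← h]
  have h2 := Complex.reCLM.circleAverage_comp_comm (f := q) (c := c) (R := r)
    (hq.continuous.continuousOn.circleIntegrable')
  have h3 : Real.circleAverage q c r = q c :=
    (hq.diffContOnCl (s := Metric.ball c |r|)).circleAverage
  rw [h3] at h2
  exact h2

/-- The maximum principle, comparing a function that satisfies the sub-mean value inequality on
small circles with the real part of a holomorphic function. -/
lemma le_re_of_le_re_on_circle {F : ℂ → EReal} {q : ℂ → ℂ}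
    (husc : UpperSemicontinuousOn F (Metric.closedBall 0 1))
    (hne : ∀ ζ ∈ Metric.closedBall (0 : ℂ) 1, F ζ ≠ ⊤)
    (hloc : ∀ ζ ∈ Metric.ball (0 : ℂ) 1, ∃ r : ℝ, 0 < r ∧
      Metric.closedBall ζ r ⊆ Metric.closedBall 0 1 ∧
      F ζ ≤ erealIntegral (fun t => F (ζ + r * circlePt t)))
    (hq : Differentiable ℂ q)
    (hle : ∀ t : ℝ, F (circlePt t) ≤ ((q (circlePt t)).re : EReal)) :
    F 0 ≤ ((q 0).re : EReal) := by
  by_contra! hlt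
  obtain ⟨a, ha1, ha2⟩ := EReal.lt_iff_exists_real_btwn.mp hlt
  have ha1' : (q 0).re < a := by exact_mod_cast ha1
  -- the term `ε |ζ|²` makes the sub-mean value inequality strict
  set ε : ℝ := (a - (q 0).re) / 2 with hε
  have hε0 : 0 < ε := by rw [hε]; linarith
  set g : ℂ → ℝ := fun ζ => -(q ζ).re + ε * ‖ζ‖ ^ 2 with hg
  have hgc : Continuous g := by
    have := hq.continuous
    fun_prop
  have hG := usc_coe_add hgc.continuousOn husc
  obtain ⟨z, hz, hmax⟩ := hG.exists_isMaxOn ⟨0, by simp⟩ (isCompact_closedBall 0 1)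
  have h0 : (ε : EReal) < (g 0 : EReal) + F 0 := by
    have h1 : (ε : EReal) < ((g 0 + a : ℝ) : EReal) := by
      norm_cast
      simp only [hg]
      simp only [norm_zero]
      linarith
    refine h1.trans_le ?_
    rw [EReal.coe_add]
    gcongr
  have hz0 : (ε : EReal) < (g z : EReal) + F z :=
    h0.trans_le (hmax (show (0 : ℂ) ∈ Metric.closedBall 0 1 by simp))
  have hzt : F z ≠ ⊤ := hne z hz
  have hzb : F z ≠ ⊥ := by rintro h; simp [h] at hz0
  obtain ⟨m, hm⟩ : ∃ m : ℝ, F z = m := ⟨(F z).toReal, (EReal.coe_toReal hzt hzb).symm⟩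
  have hz1 : z ∈ Metric.ball (0 : ℂ) 1 := by
    by_contra hzn
    have hn : ‖z‖ = 1 := by
      simp only [Metric.mem_ball, dist_zero_right, not_lt, Metric.mem_closedBall] at hzn hz
      exact le_antisymm hz hzn
    obtain ⟨t, rfl⟩ : ∃ t : ℝ, z = circlePt t := by
      refine ⟨Complex.arg z / (2 * Real.pi), ?_⟩
      conv_lhs => rw [← Complex.norm_mul_exp_arg_mul_I z, hn]
      have : (Real.pi : ℂ) ≠ 0 := by exact_mod_cast Real.pi_ne_zero
      simp only [circlePt]
      push_cast
      field_simp
    have h2 := hle t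
    rw [hm] at hz0 h2
    norm_cast at hz0 h2
    simp only [hg, hn] at hz0
    linarith
  obtain ⟨r, hr, hsub, hmean⟩ := hloc z hz1
  -- on the circle of radius `r` about the maximum point `z`, `|ζ|²` is the real part of the affine
  -- function `r² - |z|² + 2 z̄ ζ`, so that `F` is bounded there by the real part of an entire `q'`
  set q' : ℂ → ℂ := fun ζ => ((g z + m - ε * (r ^ 2 - ‖z‖ ^ 2) : ℝ) : ℂ) + q ζ
    - ((2 * ε : ℝ) : ℂ) * (starRingEnd ℂ z * ζ) with hq'
  have hq'd : Differentiable ℂ q' := by rw [hq']; fun_prop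
  have hq're : ∀ ζ, (q' ζ).re = g z + m - ε * (r ^ 2 - ‖z‖ ^ 2) + (q ζ).re
      - 2 * ε * (starRingEnd ℂ z * ζ).re := fun ζ => by
    simp only [hq', Complex.sub_re, Complex.add_re, Complex.ofReal_re, Complex.re_ofReal_mul]
  have hcirc : ∀ t ∈ Ioc (0 : ℝ) 1,
      F (z + r * circlePt t) ≤ (((q' (z + r * circlePt t)).re : ℝ) : EReal) := by
    intro t _
    set ζ := z + r * circlePt t with hζ
    have hζd : ‖ζ - z‖ = r := by
      rw [hζ, add_sub_cancel_left, norm_mul, norm_circlePt]; simp [abs_of_pos hr]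
    have hζm : ζ ∈ Metric.closedBall (0 : ℂ) 1 := by
      apply hsub
      rw [Metric.mem_closedBall, dist_eq_norm, hζd]
    have h3 := hmax hζm
    simp only [mem_ofPred_eq, hm] at h3
    have h4 : (q' ζ).re = g z + m - g ζ := by
      have h5 : r ^ 2 = ‖ζ‖ ^ 2 + ‖z‖ ^ 2 - 2 * (starRingEnd ℂ z * ζ).re := by
        rw [← hζd, ← Complex.normSq_eq_norm_sq, ← Complex.normSq_eq_norm_sq,
          ← Complex.normSq_eq_norm_sq]
        simp [Complex.normSq_apply]
        ring
      rw [hq're, h5]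
      simp only [hg]
      ring
    rw [h4]
    induction hF : F ζ with
    | bot => simp
    | top => exact absurd hF (hne ζ hζm)
    | coe x =>
      rw [hF] at h3
      norm_cast at h3 ⊢
      linarith
  have h6 := hmean.trans (erealIntegral_mono hcirc)
  rw [erealIntegral_coe (f := fun t => (q' (z + r * circlePt t)).re), hm,
    setIntegral_re_circle hq'd] at h6
  · norm_cast at h6
    have h7 : (q' z).re = m - ε * r ^ 2 := by
      have h8 : ‖z‖ ^ 2 = (starRingEnd ℂ z * z).re := by
        rw [← Complex.normSq_eq_norm_sq]; simp [Complex.normSq_apply]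
      rw [hq're, ← h8]
      simp only [hg]
      ring
    rw [h7] at h6
    have : 0 < ε * r ^ 2 := by positivity
    linarith
  · have := hq'd.continuous
    have := continuous_circlePt
    fun_prop

/-- Continuous functions on the circle are uniform limits of real parts of entire functions
(in fact polynomials). -/
lemma exists_re_approx (f : C(AddCircle (1 : ℝ), ℝ)) {ε : ℝ} (hε : 0 < ε) :
    ∃ q : ℂ → ℂ, Differentiable ℂ q ∧
      ∀ t : ℝ, |f (t : AddCircle (1 : ℝ)) - (q (circlePt t)).re| ≤ ε := by
  have : Fact ((0 : ℝ) < 1) := ⟨one_pos⟩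
  set fc : C(AddCircle (1 : ℝ), ℂ) := ⟨fun x => (f x : ℂ), by fun_prop⟩ with hfc
  have hmem : fc ∈ closure (Submodule.span ℂ (range (fourier (T := (1 : ℝ)))) : Set _) := by
    rw [← Submodule.topologicalClosure_coe, span_fourier_closure_eq_top]; trivial
  obtain ⟨Q, hQ, hd⟩ := Metric.mem_closure_iff.mp hmem ε hε
  have key : ∀ Q ∈ Submodule.span ℂ (range (fourier (T := (1 : ℝ)))), ∀ c : ℂ,
      ∃ q : ℂ → ℂ, Differentiable ℂ q ∧
        ∀ t : ℝ, (c * Q (t : AddCircle (1 : ℝ))).re = (q (circlePt t)).re := by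
    intro Q hQ
    induction hQ using Submodule.span_induction with
    | mem x hx =>
      obtain ⟨n, rfl⟩ := hx
      intro c
      have hx : ∀ t : ℝ, fourier n (t : AddCircle (1 : ℝ)) = circlePt t ^ n := by
        intro t
        rw [fourier_coe_apply, circlePt, ← Complex.exp_int_mul]
        congr 1
        push_cast
        ring
      rcases n with n | n
      · refine ⟨fun z => c * z ^ n, by fun_prop, fun t => ?_⟩
        rw [hx]; simp
      · refine ⟨fun z => starRingEnd ℂ c * z ^ (n + 1), by fun_prop, fun t => ?_⟩
        rw [hx, zpow_negSucc, ← inv_pow, Complex.inv_eq_conj (norm_circlePt t), ← map_pow]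
        rw [← Complex.conj_re]
        simp only [map_mul, Complex.conj_conj]
    | zero => exact fun c => ⟨fun _ => 0, by fun_prop, by simp⟩
    | add x y _ _ hx hy =>
      intro c
      obtain ⟨q1, h1, h1'⟩ := hx c
      obtain ⟨q2, h2, h2'⟩ := hy c
      refine ⟨fun z => q1 z + q2 z, by fun_prop, fun t => ?_⟩
      rw [ContinuousMap.add_apply, mul_add, Complex.add_re, Complex.add_re, h1', h2']
    | smul a x _ hx =>
      intro c
      obtain ⟨q1, h1, h1'⟩ := hx (c * a)
      refine ⟨q1, h1, fun t => ?_⟩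
      rw [← h1', ContinuousMap.smul_apply, smul_eq_mul, mul_assoc]
  obtain ⟨q, hq, hq'⟩ := key Q hQ 1
  refine ⟨q, hq, fun t => ?_⟩
  rw [← hq', one_mul]
  have h1 : ‖fc t - Q t‖ ≤ ε := by
    have := (ContinuousMap.norm_coe_le_norm (fc - Q) (t : AddCircle (1 : ℝ)))
    rw [← dist_eq_norm fc Q] at this
    exact this.trans hd.le
  refine le_trans ?_ h1
  refine le_trans (le_of_eq ?_) (Complex.abs_re_le_norm _)
  simp [hfc]

/-- A lower semicontinuous function with values in `[0, ∞]` on a metric space is bounded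
below by continuous functions whose lower limit is at least the given function. -/
lemma exists_continuous_le_liminf {α : Type*} [PseudoMetricSpace α]
    {G : α → ENNReal} (hG : LowerSemicontinuous G) :
    ∃ p : ℕ → C(α, ℝ), (∀ n x, 0 ≤ p n x) ∧ (∀ n x, ENNReal.ofReal (p n x) ≤ G x) ∧
      ∀ x, G x ≤ liminf (fun n => ENNReal.ofReal (p n x)) atTop := by
  -- inf-convolution with `n · dist`, cut off at height `n`
  set P : ℕ → α → ENNReal := fun n x => min n (⨅ s, (G s + n * edist x s)) with hP
  have hPtop : ∀ n x, P n x ≠ ⊤ := fun n x =>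
    ne_top_of_le_ne_top (ENNReal.natCast_ne_top n) (min_le_left _ _)
  have hPlip : ∀ n x y, P n x ≤ P n y + n * edist x y := by
    intro n x y
    simp only [hP]
    rw [min_add]
    refine min_le_min le_self_add ?_
    rw [ENNReal.iInf_add]
    refine iInf_mono fun s => ?_
    rw [add_assoc, ← mul_add]
    gcongr
    rw [add_comm]
    exact edist_triangle _ _ _
  have hcont : ∀ n, Continuous fun x => (P n x).toReal := by
    intro n
    refine (LipschitzWith.of_le_add_mul (n : NNReal) fun x y => ?_).continuous
    have h := ENNReal.toReal_mono (by
      exact ENNReal.add_ne_top.2 ⟨hPtop n y, ENNReal.mul_ne_top (by simp) (edist_ne_top _ _)⟩)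
      (hPlip n x y)
    rw [ENNReal.toReal_add (hPtop n y) (ENNReal.mul_ne_top (by simp) (edist_ne_top _ _)),
      ENNReal.toReal_mul, ← dist_edist] at h
    simpa using h
  refine ⟨fun n => ⟨_, hcont n⟩, fun n x => ENNReal.toReal_nonneg, fun n x => ?_, fun x => ?_⟩
  · rw [ContinuousMap.coe_mk, ENNReal.ofReal_toReal (hPtop n x)]
    refine (min_le_right _ _).trans ((iInf_le _ x).trans (by simp))
  · simp only [ContinuousMap.coe_mk, ENNReal.ofReal_toReal (hPtop _ _)]
    refine le_of_forall_lt fun c hc => ?_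
    obtain ⟨c', hc', hc''⟩ := exists_between hc
    refine hc'.trans_le ?_
    obtain ⟨δ, hδ, hball⟩ := EMetric.mem_nhds_iff.mp (hG x c' hc'')
    have hc't : c' ≠ ⊤ := hc''.ne_top
    refine le_liminf_of_le (by isBoundedDefault) ?_
    have h1 : ∀ᶠ n : ℕ in atTop, c' ≤ n := by
      obtain ⟨n, hn⟩ := ENNReal.exists_nat_gt hc't
      filter_upwards [eventually_ge_atTop n] with m hm
      exact hn.le.trans (by exact_mod_cast hm)
    have h2 : ∀ᶠ n : ℕ in atTop, c' ≤ n * δ := by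
      by_cases hδt : δ = ⊤
      · filter_upwards [eventually_ge_atTop 1] with m hm
        rw [hδt, ENNReal.mul_top (by simp; omega)]; simp
      · obtain ⟨n, hn⟩ := ENNReal.exists_nat_mul_gt hδ.ne' hc't
        filter_upwards [eventually_ge_atTop n] with m hm
        exact hn.le.trans (by gcongr)
    filter_upwards [h1, h2] with n hn1 hn2
    refine le_min hn1 (le_iInf fun s => ?_)
    by_cases hs : edist s x < δ
    · exact (hball hs).le.trans le_self_add
    · push Not at hs
      rw [edist_comm] at hs
      exact hn2.trans ((mul_le_mul_right hs _).trans le_add_self)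

/-- An upper semicontinuous function on the closed unit disc which satisfies the sub-mean value
inequality on small circles satisfies it on the unit circle. The boundary values are approximated
from above by real parts of entire functions, to which the maximum principle applies. -/
lemma le_erealIntegral_circle_of_local {F : ℂ → EReal}
    (husc : UpperSemicontinuousOn F (Metric.closedBall 0 1))
    (hne : ∀ ζ ∈ Metric.closedBall (0 : ℂ) 1, F ζ ≠ ⊤)
    (hloc : ∀ ζ ∈ Metric.ball (0 : ℂ) 1, ∃ r : ℝ, 0 < r ∧
      Metric.closedBall ζ r ⊆ Metric.closedBall 0 1 ∧
      F ζ ≤ erealIntegral (fun t => F (ζ + r * circlePt t))) :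
    F 0 ≤ erealIntegral (fun t => F (circlePt t)) := by
  have : Fact ((0 : ℝ) < 1) := ⟨one_pos⟩
  obtain ⟨M, hM, hFM⟩ := exists_forall_le_of_usc (isCompact_closedBall 0 1) husc hne
  have hmem : ∀ t, circlePt t ∈ Metric.closedBall (0 : ℂ) 1 := fun t => by
    simp [norm_circlePt]
  have husc' : UpperSemicontinuous (fun t => F (circlePt t)) := by
    rw [← upperSemicontinuousOn_univ_iff]
    exact husc.comp continuous_circlePt.continuousOn fun t _ => hmem t
  rw [le_erealIntegral_iff hM husc'.measurable.aemeasurable (fun t _ => hFM _ (hmem t))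
    (hFM 0 (by simp))]
  set G : AddCircle (1 : ℝ) → ENNReal := fun θ => gap M (F (AddCircle.toCircle θ)) with hG
  have hGt : ∀ t : ℝ, G t = gap M (F (circlePt t)) := by
    intro t
    simp only [hG]
    rw [AddCircle.toCircle_apply_mk, Circle.coe_exp]
    simp [circlePt]
  have hGlsc : LowerSemicontinuous G := by
    have h1 : UpperSemicontinuous (fun θ : AddCircle (1 : ℝ) => F (AddCircle.toCircle θ)) := by
      rw [← upperSemicontinuousOn_univ_iff]
      refine husc.comp (g := fun θ : AddCircle (1 : ℝ) => (AddCircle.toCircle θ : ℂ)) ?_ ?_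
      · exact (continuous_subtype_val.comp AddCircle.continuous_toCircle).continuousOn
      · intro θ _; simp [Circle.norm_coe]
    exact (continuous_gap M).comp_upperSemicontinuous_antitone h1 (gap_antitone M)
  obtain ⟨p, hp0, hpG, hpl⟩ := exists_continuous_le_liminf hGlsc
  have hmain : ∀ n, ∫⁻ t in Ioc (0 : ℝ) 1, ENNReal.ofReal (p n (t : AddCircle (1 : ℝ)))
      ≤ gap M (F 0) := by
    intro n
    have hpc : Continuous fun t : ℝ => p n (t : AddCircle (1 : ℝ)) :=
      (p n).continuous.comp (AddCircle.continuous_mk' 1)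
    have hpi : IntegrableOn (fun t : ℝ => p n (t : AddCircle (1 : ℝ))) (Ioc 0 1) :=
      (hpc.integrableOn_Icc (a := 0) (b := 1)).mono_set Ioc_subset_Icc_self
    rw [← ofReal_integral_eq_lintegral_ofReal hpi (ae_of_all _ fun t => hp0 n _)]
    set I := ∫ t in Ioc (0 : ℝ) 1, p n (t : AddCircle (1 : ℝ)) with hI
    -- `M - p n ≥ F` on the circle; up to `ε`, `M - p n` is the real part of an entire function
    have hF0 : F 0 ≤ ((M - I : ℝ) : EReal) := by
      rw [← EReal.le_of_forall_lt_iff_le]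
      intro b hb
      have hb' : M - I < b := by exact_mod_cast hb
      set ε := (b - (M - I)) / 2 with hε
      have hε0 : 0 < ε := by rw [hε]; linarith
      obtain ⟨q, hq, hqa⟩ := exists_re_approx (p n) hε0
      have hle := le_re_of_le_re_on_circle (q := fun z => ((M + ε : ℝ) : ℂ) - q z)
        husc hne hloc (by fun_prop) (fun t => by
          have h1 := (abs_le.mp (hqa t)).1
          have h2 := hpG n (t : AddCircle (1 : ℝ))
          rw [hGt] at h2
          induction hF : F (circlePt t) with
          | bot => simp
          | top => exact absurd hF (hne _ (hmem t))
          | coe x =>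
            have hxM : x ≤ M := by
              have := hFM _ (hmem t); rw [hF] at this; exact_mod_cast this
            rw [hF, gap_coe, ENNReal.ofReal_le_ofReal_iff (by linarith)] at h2
            norm_cast
            simp only [Complex.sub_re, Complex.ofReal_re]
            linarith)
      refine hle.trans ?_
      norm_cast
      simp only [Complex.sub_re, Complex.ofReal_re]
      have h3 := setIntegral_re_circle hq 0 1
      simp only [Complex.ofReal_one, one_mul, zero_add] at h3
      have hqc : Continuous fun t : ℝ => (q (circlePt t)).re := by
        have := hq.continuous
        have := continuous_circlePt
        fun_prop
      have hqi : IntegrableOn (fun t : ℝ => (q (circlePt t)).re) (Ioc 0 1) :=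
        (hqc.integrableOn_Icc (a := 0) (b := 1)).mono_set Ioc_subset_Icc_self
      have h4 : I - ∫ t in Ioc (0 : ℝ) 1, (q (circlePt t)).re ≤ ε := by
        rw [hI, ← integral_sub hpi hqi]
        calc _ ≤ ∫ t in Ioc (0 : ℝ) 1, ε :=
              integral_mono (hpi.sub hqi) (by simp) fun t => (abs_le.mp (hqa t)).2
          _ = ε := by simp
      rw [h3] at h4
      have : b = M - I + 2 * ε := by rw [hε]; ring
      linarith
    calc ENNReal.ofReal I = gap M ((M - I : ℝ) : EReal) := by rw [gap_coe]; congr 1; ring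
      _ ≤ gap M (F 0) := gap_antitone M hF0
  calc ∫⁻ t in Ioc (0 : ℝ) 1, gap M (F (circlePt t))
      ≤ ∫⁻ t in Ioc (0 : ℝ) 1,
          liminf (fun n => ENNReal.ofReal (p n (t : AddCircle (1 : ℝ)))) atTop :=
        lintegral_mono fun t => by rw [← hGt]; exact hpl _
    _ ≤ liminf (fun n => ∫⁻ t in Ioc (0 : ℝ) 1,
          ENNReal.ofReal (p n (t : AddCircle (1 : ℝ)))) atTop :=
        lintegral_liminf_le fun n =>
          (((p n).continuous.comp (AddCircle.continuous_mk' 1)).measurable).ennreal_ofReal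
    _ ≤ gap M (F 0) := by
        refine liminf_le_of_le (by isBoundedDefault) fun b hb => ?_
        obtain ⟨n, hn⟩ := hb.exists
        exact hn.trans (hmain n)

/-! ### The operator `ddᶜ` on multiples of constant forms -/

/-- The iterated directional derivative `D_u (D_w σ)` at `y`. -/
noncomputable def secondDeriv {k : ℕ} (σ : Cn k → ℝ) (y u w : Cn k) : ℝ :=
  fderiv ℝ (fun z => fderiv ℝ σ z w) y u

lemma mulC_apply {k : ℕ} (c : ℂ) (v : Cn k) : mulC k c v = c • v := rfl

lemma dcForm_smul_const {k m : ℕ} {σ : Cn k → ℝ} {α : Cn k → Cn k [⋀^Fin m]→L[ℝ] ℝ}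
    {β : Cn k [⋀^Fin m]→L[ℝ] ℝ} {y : Cn k} (hα : α =ᶠ[𝓝 y] fun z => σ z • β)
    (hσ : DifferentiableAt ℝ σ y) :
    dcForm α y = ContinuousAlternatingMap.compContinuousLinearMapCLM (mulC k (-Complex.I))
      (ContinuousAlternatingMap.alternatizeUncurryFinCLM ℝ (Cn k) ℝ
        ((ContinuousLinearMap.smulRightL ℝ (Cn k) (Cn k [⋀^Fin m]→L[ℝ] ℝ)).flip
          (β.compContinuousLinearMap (mulC k Complex.I)) (fderiv ℝ σ y))) := by
  have h1 : (fun z => (α z).compContinuousLinearMap (mulC k Complex.I)) =ᶠ[𝓝 y]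
      fun z => σ z • (β.compContinuousLinearMap (mulC k Complex.I)) := by
    filter_upwards [hα] with z hz
    rw [hz]; rfl
  have h2 := (hσ.hasFDerivAt.smul_const (β.compContinuousLinearMap (mulC k Complex.I))).fderiv
  rw [dcForm, h1.extDeriv_eq, extDeriv]
  exact congrArg (fun L => ContinuousAlternatingMap.compContinuousLinearMapCLM
    (mulC k (-Complex.I)) (ContinuousAlternatingMap.alternatizeUncurryFinCLM ℝ (Cn k) ℝ L)) h2

lemma dcForm_smul_const_apply {k m : ℕ} {σ : Cn k → ℝ} {α : Cn k → Cn k [⋀^Fin m]→L[ℝ] ℝ}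
    {β : Cn k [⋀^Fin m]→L[ℝ] ℝ} {y : Cn k} (hα : α =ᶠ[𝓝 y] fun z => σ z • β)
    (hσ : DifferentiableAt ℝ σ y) (w : Fin (m + 1) → Cn k) :
    dcForm α y w = ∑ i : Fin (m + 1), (-1) ^ (i : ℕ) *
      (fderiv ℝ σ y (-Complex.I • w i) * β (i.removeNth w)) := by
  rw [dcForm_smul_const hα hσ]
  simp only [ContinuousAlternatingMap.compContinuousLinearMapCLM_apply,
    ContinuousAlternatingMap.compContinuousLinearMap_apply,
    ContinuousAlternatingMap.alternatizeUncurryFinCLM_apply,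
    ContinuousAlternatingMap.alternatizeUncurryFin_apply]
  refine Finset.sum_congr rfl fun i _ => ?_
  rw [zsmul_eq_mul]
  push_cast
  congr 1
  have h2 : (fun j => mulC k Complex.I ((i.removeNth (⇑(mulC k (-Complex.I)) ∘ w)) j))
      = i.removeNth w := by
    funext j
    simp [Fin.removeNth, mulC_apply, smul_smul]
  change fderiv ℝ σ y (-Complex.I • w i) *
    β (fun j => mulC k Complex.I ((i.removeNth (⇑(mulC k (-Complex.I)) ∘ w)) j)) = _
  rw [h2]

/-- For a constant form `β`, `ddᶜ (σ β)` is a sum of second derivatives of `σ` times values of `β`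
on the vectors that remain when two of them are removed. -/
lemma ddcForm_smul_const_apply {k m : ℕ} {σ : Cn k → ℝ} {α : Cn k → Cn k [⋀^Fin m]→L[ℝ] ℝ}
    {β : Cn k [⋀^Fin m]→L[ℝ] ℝ} {y : Cn k} (hα : α =ᶠ[𝓝 y] fun z => σ z • β)
    (hσ : ContDiffAt ℝ 2 σ y) (v : Fin (m + 2) → Cn k) :
    ddcForm α y v = ∑ l : Fin (m + 2), (-1) ^ (l : ℕ) * ∑ i : Fin (m + 1), (-1) ^ (i : ℕ) *
      (secondDeriv σ y (v l) (-Complex.I • v (l.succAbove i)) *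
        β (i.removeNth (l.removeNth v))) := by
  have hd : ∀ᶠ z in 𝓝 y, DifferentiableAt ℝ σ z := by
    filter_upwards [hσ.eventually (by simp)] with z hz
    exact hz.differentiableAt (by simp)
  have h1 : ∀ᶠ z in 𝓝 y, α =ᶠ[𝓝 z] fun z => σ z • β := hα.eventually_nhds
  have hfd : DifferentiableAt ℝ (fderiv ℝ σ) y :=
    (hσ.fderiv_right (m := 1) (by norm_num)).differentiableAt (by simp)
  have h2 : dcForm α =ᶠ[𝓝 y] fun z =>
      ContinuousAlternatingMap.compContinuousLinearMapCLM (mulC k (-Complex.I))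
      (ContinuousAlternatingMap.alternatizeUncurryFinCLM ℝ (Cn k) ℝ
        ((ContinuousLinearMap.smulRightL ℝ (Cn k) (Cn k [⋀^Fin m]→L[ℝ] ℝ)).flip
          (β.compContinuousLinearMap (mulC k Complex.I)) (fderiv ℝ σ z))) := by
    filter_upwards [hd, h1] with z hz hz'
    exact dcForm_smul_const hz' hz
  have h3 : DifferentiableAt ℝ (dcForm α) y := by
    refine DifferentiableAt.congr_of_eventuallyEq ?_ h2
    fun_prop
  rw [ddcForm, extDeriv_apply h3]
  refine Finset.sum_congr rfl fun l _ => ?_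
  rw [zsmul_eq_mul]
  push_cast
  congr 1
  have h4 : (fun z => dcForm α z (l.removeNth v)) =ᶠ[𝓝 y] fun z =>
      ∑ i : Fin (m + 1), (-1) ^ (i : ℕ) *
      (fderiv ℝ σ z (-Complex.I • v (l.succAbove i)) * β (i.removeNth (l.removeNth v))) := by
    filter_upwards [hd, h1] with z hz hz'
    exact dcForm_smul_const_apply hz' hz _
  rw [h4.fderiv_eq]
  have hfw : ∀ w : Cn k, DifferentiableAt ℝ (fun z => fderiv ℝ σ z w) y := fun w => by fun_prop
  rw [fderiv_fun_sum fun i _ => ((hfw _).mul_const _).const_mul _]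
  rw [sum_apply]
  refine Finset.sum_congr rfl fun i _ => ?_
  rw [fderiv_const_mul ((hfw _).mul_const _), fderiv_mul_const (hfw _)]
  simp only [smul_apply, smul_eq_mul, secondDeriv]
  ring

/-! ### Pluriharmonic functions -/

lemma ddcFun_apply_pair {k : ℕ} {g : Cn k → ℝ} {y : Cn k} (hg : ContDiffAt ℝ 2 g y) (b : Cn k) :
    ddcFun g y ![b, Complex.I • b]
      = secondDeriv g y b b + secondDeriv g y (Complex.I • b) (Complex.I • b) := by
  have h1 := ddcForm_smul_const_apply
    (α := fun y => ContinuousAlternatingMap.constOfIsEmpty ℝ (Cn k) (Fin 0) (g y)) (σ := g)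
    (β := ContinuousAlternatingMap.constOfIsEmpty ℝ (Cn k) (Fin 0) 1) (y := y)
    (Eventually.of_forall fun z => by ext v; simp) hg ![b, Complex.I • b]
  change ddcFun g y _ = _ at h1
  rw [h1]
  have h2 : secondDeriv g y (Complex.I • b) (-(Complex.I • b))
      = - secondDeriv g y (Complex.I • b) (Complex.I • b) := by
    simp [secondDeriv]
  simp [Fin.sum_univ_two, smul_smul, h2]

lemma secondDeriv_sub {k : ℕ} {f g : Cn k → ℝ} {y : Cn k} (hf : ContDiffAt ℝ 2 f y)
    (hg : ContDiffAt ℝ 2 g y) (u w : Cn k) :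
    secondDeriv (fun z => f z - g z) y u w = secondDeriv f y u w - secondDeriv g y u w := by
  have hd : ∀ {f : Cn k → ℝ}, ContDiffAt ℝ 2 f y → ∀ᶠ z in 𝓝 y, DifferentiableAt ℝ f z :=
    fun hf => (hf.eventually (by simp)).mono fun z hz => hz.differentiableAt (by simp)
  have hd2 : ∀ {f : Cn k → ℝ}, ContDiffAt ℝ 2 f y →
      DifferentiableAt ℝ (fun z => fderiv ℝ f z w) y := fun hf => by
    have := (hf.fderiv_right (m := 1) (by norm_num)).differentiableAt (by simp)
    fun_prop
  have h : (fun z => fderiv ℝ (fun z => f z - g z) z w) =ᶠ[𝓝 y]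
      fun z => fderiv ℝ f z w - fderiv ℝ g z w := by
    filter_upwards [hd hf, hd hg] with z h1 h2
    rw [fderiv_fun_sub h1 h2]; rfl
  rw [secondDeriv, h.fderiv_eq, fderiv_fun_sub (hd2 hf) (hd2 hg)]
  rfl

/-- A smooth function whose restrictions to complex lines are harmonic has the mean value property
on circles. -/
lemma setIntegral_circle_of_pluriharmonic {k : ℕ} {g : Cn k → ℝ} {V : Set (Cn k)}
    (hV : IsOpen V) (hg : ContDiffOn ℝ ∞ g V) (h : ∀ z ∈ V, ∀ b : Cn k,
      secondDeriv g z b b + secondDeriv g z (Complex.I • b) (Complex.I • b) = 0) {a b : Cn k}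
    (hab : ∀ ζ : ℂ, ‖ζ‖ ≤ 1 → a + ζ • b ∈ V) :
    ∫ t in Ioc (0 : ℝ) 1, g (a + circlePt t • b) = g a := by
  have hgat : ∀ z ∈ V, ContDiffAt ℝ 2 g z := fun z hz =>
    (hg.contDiffAt (hV.mem_nhds hz)).of_le ENat.LEInfty.out
  set φ : ℂ → Cn k := fun ζ => a + ζ • b with hφ
  set L : ℂ →L[ℝ] Cn k :=
    ((ContinuousLinearMap.toSpanSingleton ℂ b).restrictScalars ℝ) with hL
  have hLa : ∀ w : ℂ, L w = w • b := fun w => rfl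
  have hφL : φ = fun ζ => a + L ζ := rfl
  have hφd : ∀ ζ, HasFDerivAt φ L ζ := fun ζ => by
    rw [hφL]; exact (L.hasFDerivAt).const_add a
  have hφc : ContDiff ℝ ∞ φ := by rw [hφL]; exact contDiff_const.add L.contDiff
  have hopen : IsOpen (φ ⁻¹' V) := hV.preimage hφc.continuous
  have hfd : ∀ ζ ∈ φ ⁻¹' V, fderiv ℝ (g ∘ φ) ζ = (fderiv ℝ g (φ ζ)).comp L := fun ζ hζ => by
    have h1 : DifferentiableAt ℝ g (φ ζ) := (hgat _ hζ).differentiableAt (by simp)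
    exact (h1.hasFDerivAt.comp ζ (hφd ζ)).fderiv
  have hsecond : ∀ ζ ∈ φ ⁻¹' V, ∀ w : ℂ, iteratedFDeriv ℝ 2 (g ∘ φ) ζ ![w, w]
      = secondDeriv g (φ ζ) (w • b) (w • b) := by
    intro ζ hζ w
    rw [iteratedFDeriv_two_apply]
    simp only [Matrix.cons_val_zero, Matrix.cons_val_one]
    have hfg : DifferentiableAt ℝ (fderiv ℝ g) (φ ζ) :=
      ((hgat _ hζ).fderiv_right (m := 1) (by norm_num)).differentiableAt (by simp)
    have h1 : fderiv ℝ (g ∘ φ) =ᶠ[𝓝 ζ] fun ζ => (fderiv ℝ g (φ ζ)).comp L := by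
      filter_upwards [hopen.mem_nhds hζ] with ζ' hζ'
      exact hfd ζ' hζ'
    have h2 : HasFDerivAt (fun ζ => (fderiv ℝ g (φ ζ)))
        ((fderiv ℝ (fderiv ℝ g) (φ ζ)).comp L) ζ := hfg.hasFDerivAt.comp ζ (hφd ζ)
    have h3 := h2.clm_comp (hasFDerivAt_const L ζ)
    rw [h1.fderiv_eq, h3.fderiv]
    have h4 : secondDeriv g (φ ζ) (w • b) (w • b)
        = fderiv ℝ (fderiv ℝ g) (φ ζ) (w • b) (w • b) := by
      rw [secondDeriv, fderiv_clm_apply hfg (by fun_prop)]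
      simp
    rw [h4]
    simp [hLa]
  have hharm : InnerProductSpace.HarmonicOnNhd (g ∘ φ) (Metric.closedBall 0 |1|) := by
    intro ζ hζ
    have hmem : φ ⁻¹' V ∈ 𝓝 ζ := hopen.mem_nhds (hab ζ (by simpa using hζ))
    refine ⟨(hgat _ (mem_preimage.1 (mem_of_mem_nhds hmem : ζ ∈ φ ⁻¹' V))).comp ζ
      (hφc.contDiffAt.of_le ENat.LEInfty.out), ?_⟩
    filter_upwards [hmem] with ζ' hζ'
    rw [InnerProductSpace.laplacian_eq_iteratedFDeriv_complexPlane]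
    simp only [hsecond ζ' hζ', one_smul, Pi.zero_apply]
    exact h _ hζ' b
  have h5 := hharm.circleAverage_eq
  rw [circleAverage_eq_setIntegral] at h5
  simpa [hφ] using h5

/-! ### Plurisubharmonicity is a local property -/

lemma circleMean_eq {k : ℕ} (f : Cn k → EReal) (a b : Cn k) :
    circleMean f a b = erealIntegral (fun t => f (a + circlePt t • b)) := rfl

lemma gap_add_coe {M M' h : ℝ} {x : EReal} (hh : h ≤ M') (hx : x ≤ M) :
    gap (M' + M) ((h : EReal) + x) = ENNReal.ofReal (M' - h) + gap M x := by
  induction x with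
  | bot => simp [gap_bot]
  | top => simp at hx
  | coe x =>
    have hx' : x ≤ M := by exact_mod_cast hx
    rw [← EReal.coe_add, gap_coe, gap_coe, ← ENNReal.ofReal_add (by linarith) (by linarith)]
    congr 1; ring

lemma erealIntegral_coe_add {h : ℝ → ℝ} (hh : Continuous h) {F : ℝ → EReal} (hF : Measurable F)
    {M : ℝ} (hM : 0 ≤ M) (hFM : ∀ t, F t ≤ M) :
    erealIntegral (fun t => (h t : EReal) + F t)
      = ((∫ t in Ioc (0 : ℝ) 1, h t : ℝ) : EReal) + erealIntegral F := by
  obtain ⟨M', hM'⟩ := (isCompact_Icc (a := (0 : ℝ)) (b := 1)).bddAbove_image hh.continuousOn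
  set N := max M' 0 with hN
  have hhN : ∀ t ∈ Ioc (0 : ℝ) 1, h t ≤ N := fun t ht =>
    (hM' ⟨t, Ioc_subset_Icc_self ht, rfl⟩).trans (le_max_left _ _)
  have hi : IntegrableOn h (Ioc 0 1) :=
    (hh.integrableOn_Icc (a := 0) (b := 1)).mono_set Ioc_subset_Icc_self
  have hmeas : Measurable fun t => (h t : EReal) + F t :=
    (measurable_coe_real_ereal.comp hh.measurable).add hF
  rw [erealIntegral_eq (M := N + M) (add_nonneg (le_max_right _ _) hM) hmeas.aemeasurable,
    erealIntegral_eq hM hF.aemeasurable fun t _ => hFM t]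
  swap
  · intro t ht
    rw [EReal.coe_add]
    exact add_le_add (by exact_mod_cast hhN t ht) (hFM t)
  rw [setLIntegral_congr_fun measurableSet_Ioc fun t ht => gap_add_coe (hhN t ht) (hFM t),
    lintegral_add_left (by fun_prop),
    ← ofReal_integral_eq_lintegral_ofReal (f := fun t => N - h t) ((integrable_const N).sub hi)]
  swap
  · filter_upwards [ae_restrict_mem measurableSet_Ioc] with t ht
    simpa using hhN t ht
  have h1 : ∫ t in Ioc (0 : ℝ) 1, (N - h t) = N - ∫ t in Ioc (0 : ℝ) 1, h t := by
    rw [integral_sub (integrable_const N) hi]; simp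
  have h2 : 0 ≤ ∫ t in Ioc (0 : ℝ) 1, (N - h t) :=
    setIntegral_nonneg measurableSet_Ioc fun t ht => by simpa using hhN t ht
  set I := ∫ t in Ioc (0 : ℝ) 1, h t
  set G := ∫⁻ t in Ioc (0 : ℝ) 1, gap M (F t)
  rw [h1] at h2 ⊢
  by_cases hG : G = ⊤
  · rw [hG]; simp
  · rw [← ENNReal.ofReal_toReal hG, ← ENNReal.ofReal_add h2 ENNReal.toReal_nonneg]
    simp only [EReal.coe_ennreal_ofReal, max_eq_left ENNReal.toReal_nonneg,
      max_eq_left (add_nonneg h2 ENNReal.toReal_nonneg)]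
    norm_cast
    ring

lemma isCompact_disc {k : ℕ} (a b : Cn k) : IsCompact ((fun ζ : ℂ => a + ζ • b) ''
    Metric.closedBall 0 1) :=
  (isCompact_closedBall 0 1).image (by fun_prop)

/-- A function that satisfies the sub-mean value inequality on small circles in each direction is
plurisubharmonic. -/
lemma pshOn_of_local {k : ℕ} {F : Cn k → EReal} {V : Set (Cn k)}
    (husc : UpperSemicontinuousOn F V) (hne : ∀ y ∈ V, F y ≠ ⊤)
    (hloc : ∀ z ∈ V, ∀ b : Cn k, ∃ δ : ℝ, 0 < δ ∧ ∀ r : ℝ, 0 < r → r < δ →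
      F z ≤ circleMean F z ((r : ℂ) • b)) : PshOn F V := by
  refine ⟨husc, hne, fun a b hab => ?_⟩
  have hab' : ∀ ζ ∈ Metric.closedBall (0 : ℂ) 1, a + ζ • b ∈ V := fun ζ hζ =>
    hab ζ (by simpa using hζ)
  have h := le_erealIntegral_circle_of_local (F := fun ζ => F (a + ζ • b))
    (husc.comp (g := fun ζ : ℂ => a + ζ • b) (by fun_prop) hab') (fun ζ hζ => hne _ (hab' ζ hζ)) ?_
  · simpa [circleMean_eq] using h
  · intro ζ hζ
    obtain ⟨δ, hδ, hle⟩ := hloc _ (hab' ζ (Metric.ball_subset_closedBall hζ)) b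
    have hζ1 : ‖ζ‖ < 1 := by simpa using hζ
    set r := min (δ / 2) (1 - ‖ζ‖) with hr
    have hr0 : 0 < r := lt_min (by linarith) (by linarith)
    refine ⟨r, hr0, ?_, ?_⟩
    · refine Metric.closedBall_subset_closedBall' ?_
      have : r ≤ 1 - ‖ζ‖ := min_le_right _ _
      simp only [dist_zero_right]
      linarith
    · have h1 := hle r hr0 ((min_le_left _ _).trans_lt (by linarith))
      rw [circleMean_eq] at h1
      convert h1 using 4 with t
      rw [add_smul, smul_smul, add_assoc, mul_comm]

lemma PshOn.lintegral_gap_le {k : ℕ} {f : Cn k → EReal} {V : Set (Cn k)} (hf : PshOn f V)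
    {a b : Cn k} (hab : ∀ ζ : ℂ, ‖ζ‖ ≤ 1 → a + ζ • b ∈ V) {M : ℝ} (hM : 0 ≤ M)
    (hfM : ∀ ζ : ℂ, ‖ζ‖ ≤ 1 → f (a + ζ • b) ≤ M) :
    ∫⁻ t in Ioc (0 : ℝ) 1, gap M (f (a + circlePt t • b)) ≤ gap M (f a) := by
  have husc : UpperSemicontinuous fun t => f (a + circlePt t • b) := by
    rw [← upperSemicontinuousOn_univ_iff]
    have := continuous_circlePt
    exact hf.usc.comp (g := fun t => a + circlePt t • b) (by fun_prop)
      fun t _ => hab _ (norm_circlePt t).le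
  rw [← le_erealIntegral_iff hM husc.measurable.aemeasurable
    (fun t _ => hfM _ (norm_circlePt t).le) (by simpa using hfM 0 (by simp))]
  exact hf.submean a b hab

lemma usc_comp_symm {k : ℕ} {X : Type*} [TopologicalSpace X] {u : X → EReal} (hu : UpperSemicontinuous u)
    (e : OpenPartialHomeomorph X (Cn k)) :
    UpperSemicontinuousOn (fun z => u (e.symm z)) e.target :=
  (upperSemicontinuousOn_univ_iff.2 hu).comp e.continuousOn_symm fun _ _ => mem_univ _

section Manifold

variable {k : ℕ} {X : Type*} [TopologicalSpace X] [ChartedSpace (Cn k) X]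

/-- In the definition of `θ`-plurisubharmonic functions, the local potential can be any potential
of `θ` on any open subset of a chart: two potentials differ by a pluriharmonic function. -/
lemma IsThetaPsh.pshOn {θ : SmoothForm k X 2} {u : X → EReal} (hu : IsThetaPsh θ u)
    {e : OpenPartialHomeomorph X (Cn k)} (he : e ∈ atlas (Cn k) X) {V : Set (Cn k)}
    (hV : IsOpen V) (hVe : V ⊆ e.target) {g : Cn k → ℝ} (hg : ContDiffOn ℝ ∞ g V)
    (hgθ : ∀ z ∈ V, ddcFun g z = inChart θ e z) :
    PshOn (fun z => (g z : EReal) + u (e.symm z)) V := by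
  refine pshOn_of_local (usc_coe_add hg.continuousOn ((usc_comp_symm hu.usc e).mono hVe))
    (fun y _ => EReal.add_ne_top (EReal.coe_ne_top _) (hu.ne_top _)) fun z hz b => ?_
  obtain ⟨V', g', hV', hz', hVe', hg', hgθ', hpsh⟩ := hu.psh e he z (hVe hz)
  have hW : IsOpen (V ∩ V') := hV.inter hV'
  have hgc : ∀ {g : Cn k → ℝ} {V : Set (Cn k)}, IsOpen V → ContDiffOn ℝ ∞ g V → ∀ w ∈ V,
      ContDiffAt ℝ 2 g w := fun hV hg w hw =>
    (hg.contDiffAt (hV.mem_nhds hw)).of_le ENat.LEInfty.out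
  have hmean := fun (a b : Cn k) (hab : ∀ ζ : ℂ, ‖ζ‖ ≤ 1 → a + ζ • b ∈ V ∩ V') =>
    setIntegral_circle_of_pluriharmonic (g := fun z => g z - g' z) hW
      ((hg.mono inter_subset_left).sub (hg'.mono inter_subset_right)) (fun w hw b => by
        have h1 := hgc hV hg w hw.1
        have h2 := hgc hV' hg' w hw.2
        rw [secondDeriv_sub h1 h2, secondDeriv_sub h1 h2]
        have h3 := ddcFun_apply_pair h1 b
        have h4 := ddcFun_apply_pair h2 b
        rw [hgθ w hw.1] at h3
        rw [hgθ' w hw.2] at h4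
        linarith) hab
  obtain ⟨ρ, hρ, hball⟩ := Metric.isOpen_iff.mp hW z ⟨hz, hz'⟩
  refine ⟨ρ / (‖b‖ + 1), by positivity, fun r hr hrδ => ?_⟩
  have hdisc : ∀ ζ : ℂ, ‖ζ‖ ≤ 1 → z + ζ • ((r : ℂ) • b) ∈ V ∩ V' := fun ζ hζ => by
    apply hball
    rw [Metric.mem_ball, dist_eq_norm, add_sub_cancel_left, norm_smul, norm_smul]
    rw [lt_div_iff₀ (by positivity)] at hrδ
    have h1 : ‖(r : ℂ)‖ = r := by simp [abs_of_pos hr]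
    rw [h1]
    calc ‖ζ‖ * (r * ‖b‖) ≤ 1 * (r * (‖b‖ + 1)) := by gcongr; linarith
      _ < ρ := by linarith
  set b' := (r : ℂ) • b
  have hsub := hpsh.submean z b' fun ζ hζ => (hdisc ζ hζ).2
  have hFusc : UpperSemicontinuous fun t => ((g' (z + circlePt t • b') : ℝ) : EReal)
      + u (e.symm (z + circlePt t • b')) := by
    rw [← upperSemicontinuousOn_univ_iff]
    have := continuous_circlePt
    exact hpsh.usc.comp (g := fun t => z + circlePt t • b') (by fun_prop)
      fun t _ => (hdisc _ (norm_circlePt t).le).2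
  obtain ⟨M, hM, hFM⟩ := exists_forall_le_of_usc (isCompact_disc z b')
    (hpsh.usc.mono (by rintro _ ⟨ζ, hζ, rfl⟩; exact (hdisc ζ (by simpa using hζ)).2))
    (fun x _ => EReal.add_ne_top (EReal.coe_ne_top _) (hu.ne_top _))
  have hhc : Continuous fun t => g (z + circlePt t • b') - g' (z + circlePt t • b') := by
    rw [← continuousOn_univ]
    have := continuous_circlePt
    exact ((hg.continuousOn.mono inter_subset_left).sub
      (hg'.continuousOn.mono inter_subset_right)).comp
      (f := fun t => z + circlePt t • b') (by fun_prop)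
      fun t _ => hdisc _ (norm_circlePt t).le
  have h1 := erealIntegral_coe_add hhc hFusc.measurable hM
    (fun t => hFM _ ⟨circlePt t, by simp [norm_circlePt], rfl⟩)
  have h2 : ∀ x : Cn k, ((g x - g' x : ℝ) : EReal) + ((g' x : EReal) + u (e.symm x))
      = (g x : EReal) + u (e.symm x) := fun x => by
    rw [← add_assoc, ← EReal.coe_add, sub_add_cancel]
  simp only [h2] at h1
  rw [circleMean_eq, h1, ← h2 z, hmean z b' hdisc]
  exact add_le_add le_rfl hsub

end Manifold

/-! ### Upper envelopes -/

section RegSup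

variable {X : Type*} [TopologicalSpace X] {S : Set (X → EReal)}

lemma le_regSup {u : X → EReal} (hu : u ∈ S) (x : X) : u x ≤ regSup S x := by
  refine le_limsup_of_frequently_le ?_
  refine Filter.Frequently.filter_mono (f := pure x) ?_ (pure_le_nhds x)
  rw [frequently_pure]
  exact le_iSup₂ (f := fun (u : X → EReal) (_ : u ∈ S) => u x) u hu

lemma regSup_le {c : EReal} {x : X} (h : ∀ᶠ y in 𝓝 x, ∀ u ∈ S, u y ≤ c) : regSup S x ≤ c :=
  limsup_le_of_le (h := h.mono fun _ hy => iSup₂_le hy)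

lemma frequently_of_lt_regSup {c : EReal} {x : X} (h : c < regSup S x) :
    ∃ᶠ y in 𝓝 x, ∃ u ∈ S, c < u y := by
  refine (frequently_lt_of_lt_limsup (by isBoundedDefault) h).mono fun y hy => ?_
  obtain ⟨u, hu, hlt⟩ := lt_biSup_iff.mp hy
  exact ⟨u, hu, hlt⟩

lemma upperSemicontinuous_regSup (S : Set (X → EReal)) : UpperSemicontinuous (regSup S) := by
  intro x c hc
  obtain ⟨c', h1, h2⟩ := exists_between hc
  have h3 : ∀ᶠ y in 𝓝 x, (⨆ u ∈ S, u y) < c' := eventually_lt_of_limsup_lt h1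
  filter_upwards [h3.eventually_nhds] with y hy
  refine lt_of_le_of_lt (regSup_le (c := c') ?_) h2
  filter_upwards [hy] with w hw u hu
  exact (le_iSup₂ (f := fun (u : X → EReal) (_ : u ∈ S) => u w) u hu).trans hw.le

end RegSup

/-- The upper semicontinuous regularisation of the supremum of a family of `θ`-plurisubharmonic
functions that is locally bounded above is `θ`-plurisubharmonic. The sub-mean value inequality holds on
circles around nearby points where a member of the family almost attains the regularised supremum,
and it passes to the limit by Fatou's lemma. -/
lemma isThetaPsh_regSup {k : ℕ} {X : Type*} [TopologicalSpace X] [ChartedSpace (Cn k) X]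
    {θ : SmoothForm k X 2} {S : Set (X → EReal)} (hS : ∀ u ∈ S, IsThetaPsh θ u)
    (hne : S.Nonempty) (hbdd : ∀ x, ∃ C : ℝ, ∀ᶠ y in 𝓝 x, ∀ u ∈ S, u y ≤ C) :
    IsThetaPsh θ (regSup S) := by
  classical
  have htop : ∀ x, regSup S x ≠ ⊤ := fun x => by
    obtain ⟨C, hC⟩ := hbdd x
    exact ((regSup_le hC).trans_lt (EReal.coe_lt_top C)).ne
  obtain ⟨u₀, hu₀⟩ := hne
  refine ⟨upperSemicontinuous_regSup S, htop, ?_, fun e he y hy => ?_⟩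
  · obtain ⟨x, hx⟩ := (hS u₀ hu₀).ne_bot
    exact ⟨x, fun h => hx (le_bot_iff.mp (h ▸ le_regSup hu₀ x))⟩
  obtain ⟨V, g, hV, hyV, hVe, hg, hgθ, -⟩ := (hS u₀ hu₀).psh e he y hy
  refine ⟨V, g, hV, hyV, hVe, hg, hgθ, ?_⟩
  set F : Cn k → EReal := fun z => (g z : EReal) + regSup S (e.symm z) with hF
  have hFusc : UpperSemicontinuousOn F V :=
    usc_coe_add hg.continuousOn ((usc_comp_symm (upperSemicontinuous_regSup S) e).mono hVe)
  have hFtop : ∀ z ∈ V, F z ≠ ⊤ := fun z _ =>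
    EReal.add_ne_top (EReal.coe_ne_top _) (htop _)
  refine ⟨hFusc, hFtop, fun a b hab => ?_⟩
  have hKV : ((fun ζ : ℂ => a + ζ • b) '' Metric.closedBall 0 1) ⊆ V := by
    rintro _ ⟨ζ, hζ, rfl⟩
    exact hab ζ (by simpa using hζ)
  obtain ⟨δ, hδ, hthick⟩ := (isCompact_disc a b).exists_cthickening_subset_open hV hKV
  obtain ⟨M, hM, hFM⟩ := exists_forall_le_of_usc (isCompact_disc a b).cthickening
    (hFusc.mono hthick) (fun z hz => hFtop z (hthick hz))
  have hnear : ∀ x ∈ Metric.ball a δ, ∀ ζ : ℂ, ‖ζ‖ ≤ 1 →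
      x + ζ • b ∈ Metric.cthickening δ ((fun ζ : ℂ => a + ζ • b) '' Metric.closedBall 0 1) := by
    intro x hx ζ hζ
    refine Metric.mem_cthickening_of_dist_le _ (a + ζ • b) _ _
      ⟨ζ, by simpa using hζ, rfl⟩ ?_
    simpa using (Metric.mem_ball.mp hx).le
  have ha : a ∈ Metric.ball a δ := Metric.mem_ball_self hδ
  have haV : a ∈ V := by simpa using hab 0 (by simp)
  have hFaM : F a ≤ M := by simpa using hFM _ (hnear a ha 0 (by simp))
  -- a globally measurable modification of `F`
  set F' : Cn k → EReal := V.piecewise F (fun _ => ⊥) with hF'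
  have hF'm : Measurable F' := measurable_piecewise_of_usc hV hFusc ⊥
  have hF'F : ∀ z ∈ V, F' z = F z := fun z hz => by simp [hF', hz]
  have hmeas : ∀ x, Measurable fun t : ℝ => gap M (F' (x + circlePt t • b)) := fun x => by
    have := continuous_circlePt
    exact (measurable_gap M).comp (hF'm.comp (by fun_prop : Continuous _).measurable)
  have husc' : UpperSemicontinuous fun t => F (a + circlePt t • b) := by
    rw [← upperSemicontinuousOn_univ_iff]
    have := continuous_circlePt
    exact hFusc.comp (g := fun t => a + circlePt t • b) (by fun_prop)
      fun t _ => hab _ (norm_circlePt t).le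
  rw [circleMean_eq, le_erealIntegral_iff hM husc'.measurable.aemeasurable
    (fun t _ => hFM _ (hnear a ha _ (norm_circlePt t).le)) hFaM]
  have main : ∀ c : ℝ, (c : EReal) < F a →
      ∫⁻ t in Ioc (0 : ℝ) 1, gap M (F (a + circlePt t • b)) ≤ gap M c := by
    intro c hc
    have hfreq : ∃ᶠ x in 𝓝 a, ∃ u ∈ S, (c : EReal) < (g x : EReal) + u (e.symm x) := by
      have h1 : ((c - g a : ℝ) : EReal) < regSup S (e.symm a) := by
        rw [EReal.coe_sub]
        refine EReal.sub_lt_of_lt_add' hc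
      obtain ⟨c', hc1, hc2⟩ := EReal.lt_iff_exists_real_btwn.mp h1
      have h2 := frequently_of_lt_regSup hc2
      rw [← e.symm.map_nhds_eq (hVe haV), frequently_map] at h2
      have hgc : ContinuousAt g a := hg.continuousOn.continuousAt (hV.mem_nhds haV)
      have h3 : ∀ᶠ x in 𝓝 a, c - c' < g x := by
        refine hgc.eventually_const_lt ?_
        have : c - g a < c' := by exact_mod_cast hc1
        linarith
      refine (h2.and_eventually h3).mono ?_
      rintro x ⟨⟨u, hu, hlt⟩, hgx⟩
      refine ⟨u, hu, ?_⟩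
      have : (c : EReal) = ((c - c' : ℝ) : EReal) + (c' : EReal) := by
        rw [← EReal.coe_add]; simp
      rw [this]
      exact EReal.add_lt_add (by exact_mod_cast hgx) hlt
    -- Fatou's lemma is applied along the centres `x → a` at which some member exceeds `c`
    set s : Set (Cn k) := {x | ∃ u ∈ S, (c : EReal) < (g x : EReal) + u (e.symm x)} with hs
    set l : Filter (Cn k) := 𝓝 a ⊓ 𝓟 s with hl
    have hlne : l.NeBot := by
      rw [hl, ← frequently_iff_neBot]; exact hfreq
    have hball : ∀ᶠ x in l, x ∈ Metric.ball a δ :=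
      mem_inf_of_left (Metric.ball_mem_nhds a hδ)
    calc ∫⁻ t in Ioc (0 : ℝ) 1, gap M (F (a + circlePt t • b))
        ≤ ∫⁻ t in Ioc (0 : ℝ) 1, liminf (fun x => gap M (F' (x + circlePt t • b))) l := by
          refine lintegral_mono fun t => ?_
          refine le_of_forall_lt fun m hm => ?_
          obtain ⟨m', hm1, hm2⟩ := exists_between hm
          refine hm1.trans_le (le_liminf_of_le (by isBoundedDefault) ?_)
          have hp : a + circlePt t • b ∈ V := hab _ (norm_circlePt t).le
          have hex : ∃ z : EReal, F (a + circlePt t • b) < z ∧ m' ≤ gap M z := by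
            by_contra! hcon
            have hcont : Tendsto (gap M) (𝓝[>] (F (a + circlePt t • b)))
                (𝓝 (gap M (F (a + circlePt t • b)))) := by
              exact ((continuous_gap M).tendsto _).mono_left nhdsWithin_le_nhds
            have hnb : (𝓝[>] (F (a + circlePt t • b))).NeBot := by
              refine mem_closure_iff_nhdsWithin_neBot.mp ?_
              rw [closure_Ioi' ⟨⊤, (hFtop _ hp).lt_top⟩]
              exact self_mem_Ici
            have := le_of_tendsto hcont (eventually_nhdsWithin_of_forall
              fun z hz => (hcon z hz).le)
            exact absurd hm2 (not_lt.2 this)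
          obtain ⟨z, hz1, hz2⟩ := hex
          have h4 : ∀ᶠ w in 𝓝 (a + circlePt t • b), F w < z ∧ w ∈ V := by
            have := hFusc _ hp z hz1
            rw [hV.nhdsWithin_eq hp] at this
            exact this.and (hV.mem_nhds hp)
          have h5 : Tendsto (fun x => x + circlePt t • b) l (𝓝 (a + circlePt t • b)) :=
            ((continuous_id.add continuous_const).tendsto a).mono_left inf_le_left
          filter_upwards [h5.eventually h4] with x hx
          rw [hF'F _ hx.2]
          exact hz2.trans (gap_antitone M hx.1.le)
      _ ≤ liminf (fun x => ∫⁻ t in Ioc (0 : ℝ) 1, gap M (F' (x + circlePt t • b))) l :=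
          lintegral_liminf_le hmeas
      _ ≤ gap M c := by
          refine liminf_le_of_frequently_le ?_
          refine Eventually.frequently ?_
          have hsl : ∀ᶠ x in l, x ∈ s := mem_inf_of_right (mem_principal_self s)
          filter_upwards [hball, hsl] with x hx hxs
          obtain ⟨u, hu, hlt⟩ := hxs
          have hin : ∀ ζ : ℂ, ‖ζ‖ ≤ 1 → x + ζ • b ∈ V := fun ζ hζ => hthick (hnear x hx ζ hζ)
          have huF : ∀ z, (g z : EReal) + u (e.symm z) ≤ F z := fun z =>
            add_le_add le_rfl (le_regSup hu _)
          have hpu := (hS u hu).pshOn he hV hVe hg hgθ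
          have h6 := hpu.lintegral_gap_le hin hM
            (fun ζ hζ => (huF _).trans (hFM _ (hnear x hx ζ hζ)))
          refine le_trans (lintegral_mono fun t => ?_) (h6.trans (gap_antitone M hlt.le))
          rw [hF'F _ (hin _ (norm_circlePt t).le)]
          exact gap_antitone M (huF _)
  induction hFa : F a with
  | bot => simp [gap_bot]
  | top => exact absurd hFa (hFtop a haV)
  | coe f₀ =>
    have h7 : Tendsto (fun c : ℝ => gap M c) (𝓝[<] f₀) (𝓝 (gap M f₀)) := by
      simp only [gap_coe]
      exact ((ENNReal.continuous_ofReal.comp (continuous_sub_left M)).tendsto f₀).mono_left nhdsWithin_le_nhds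
    refine ge_of_tendsto h7 (eventually_nhdsWithin_of_forall fun c hc => main c ?_)
    rw [hFa]
    exact_mod_cast hc

/-! ### Radial averaging kernels -/

/-- The square of the Euclidean norm on `ℂᵏ`. -/
noncomputable def euclSq {k : ℕ} (b : Cn k) : ℝ := ∑ j, ((b j).re ^ 2 + (b j).im ^ 2)

lemma euclSq_nonneg {k : ℕ} (b : Cn k) : 0 ≤ euclSq b :=
  Finset.sum_nonneg fun _ _ => by positivity

lemma contDiff_euclSq {k : ℕ} : ContDiff ℝ ∞ (euclSq (k := k)) := by
  unfold euclSq
  refine ContDiff.sum fun j _ => ?_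
  have h1 : ContDiff ℝ ∞ fun b : Cn k => (b j).re :=
    Complex.reCLM.contDiff.comp (contDiff_apply ℝ ℂ j)
  have h2 : ContDiff ℝ ∞ fun b : Cn k => (b j).im :=
    Complex.imCLM.contDiff.comp (contDiff_apply ℝ ℂ j)
  exact (h1.pow 2).add (h2.pow 2)

lemma euclSq_smul {k : ℕ} (c : ℂ) (b : Cn k) : euclSq (c • b) = ‖c‖ ^ 2 * euclSq b := by
  simp only [euclSq, Finset.mul_sum]
  refine Finset.sum_congr rfl fun j _ => ?_
  rw [← Complex.normSq_eq_norm_sq]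
  simp [Complex.normSq_apply]
  ring

lemma norm_sq_le_euclSq {k : ℕ} (b : Cn k) : ‖b‖ ^ 2 ≤ euclSq b := by
  have h : ‖b‖ ≤ Real.sqrt (euclSq b) := by
    refine (pi_norm_le_iff_of_nonneg (Real.sqrt_nonneg _)).2 fun j => ?_
    refine Real.le_sqrt_of_sq_le ?_
    rw [← Complex.normSq_eq_norm_sq, Complex.normSq_apply, ← sq, ← sq]
    exact Finset.single_le_sum (f := fun j => (b j).re ^ 2 + (b j).im ^ 2)
      (fun _ _ => by positivity) (Finset.mem_univ j)
  calc ‖b‖ ^ 2 ≤ Real.sqrt (euclSq b) ^ 2 := by gcongr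
    _ = euclSq b := Real.sq_sqrt (euclSq_nonneg b)

/-- A smooth non-decreasing function that vanishes on `[1, ∞)`. -/
noncomputable def profileInt (s : ℝ) : ℝ := -expNegInvGlue (1 - s)

/-- The derivative of `profileInt`: a smooth non-negative function that vanishes on `[1, ∞)`. -/
noncomputable def profile : ℝ → ℝ := deriv profileInt

lemma contDiff_profileInt : ContDiff ℝ ∞ profileInt :=
  (expNegInvGlue.contDiff.comp (contDiff_const.sub contDiff_id)).neg

lemma contDiff_profile : ContDiff ℝ ∞ profile :=
  contDiff_infty_iff_deriv.1 contDiff_profileInt |>.2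

lemma hasDerivAt_profileInt (s : ℝ) : HasDerivAt profileInt (profile s) s :=
  ((contDiff_profileInt.differentiable (by simp)) s).hasDerivAt

lemma profileInt_of_one_le {s : ℝ} (hs : 1 ≤ s) : profileInt s = 0 := by
  rw [profileInt, expNegInvGlue.zero_of_nonpos (by linarith), neg_zero]

lemma monotone_profileInt : Monotone profileInt := fun a b h => by
  simp only [profileInt]
  have := expNegInvGlue.monotone (show 1 - b ≤ 1 - a by linarith)
  linarith

lemma profile_nonneg (s : ℝ) : 0 ≤ profile s := monotone_profileInt.deriv_nonneg

lemma profile_of_one_le {s : ℝ} (hs : 1 ≤ s) : profile s = 0 := by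
  rcases hs.eq_or_lt with rfl | hs
  · have h : IsLocalMax profileInt 1 := by
      refine Eventually.of_forall fun s => ?_
      rw [profileInt_of_one_le le_rfl]
      exact neg_nonpos.2 (expNegInvGlue.nonneg _)
    exact h.deriv_eq_zero
  · have h : profileInt =ᶠ[𝓝 s] fun _ => 0 := by
      filter_upwards [Ioi_mem_nhds hs] with x hx
      exact profileInt_of_one_le (le_of_lt hx)
    rw [profile, h.deriv_eq, deriv_const]

lemma profile_zero_pos : 0 < profile 0 := by
  have h : profileInt =ᶠ[𝓝 0] fun s => -Real.exp (-(1 - s)⁻¹) := by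
    filter_upwards [Iio_mem_nhds (show (0 : ℝ) < 1 by norm_num)] with s hs
    have : ¬ (1 - s ≤ 0) := by
      have : s < 1 := hs
      linarith
    simp [profileInt, expNegInvGlue, this]
  have h1 : HasDerivAt (fun s : ℝ => -Real.exp (-(1 - s)⁻¹)) (Real.exp (-1)) 0 := by
    have h2 : HasDerivAt (fun s : ℝ => 1 - s) (-1) 0 := by
      simpa using (hasDerivAt_id (0 : ℝ)).const_sub 1
    have h3 := ((h2.inv (by norm_num)).neg.exp).neg
    exact h3.congr_deriv (by norm_num)
  rw [profile, h.deriv_eq, h1.deriv]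
  positivity

/-- The kernel `ρ_t(b) = tᵏ p(t |b|²)`, where `p` is `profile`; it is supported in the ball of
radius `t^(-1/2)` and its integral does not depend on `t`. -/
noncomputable def kern {k : ℕ} (t : ℝ) (b : Cn k) : ℝ := t ^ k * profile (t * euclSq b)

variable (k : ℕ) in
/-- The total mass of the kernels `kern`. -/
noncomputable def kernMass : ℝ := ∫ b : Cn k, profile (euclSq b)

lemma contDiff_kern {k : ℕ} (t : ℝ) : ContDiff ℝ ∞ (kern (k := k) t) :=
  contDiff_const.mul (contDiff_profile.comp (contDiff_const.mul contDiff_euclSq))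

lemma continuous_kern {k : ℕ} (t : ℝ) : Continuous (kern (k := k) t) := (contDiff_kern t).continuous

lemma kern_nonneg {k : ℕ} {t : ℝ} (ht : 0 ≤ t) (b : Cn k) : 0 ≤ kern t b :=
  mul_nonneg (pow_nonneg ht k) (profile_nonneg _)

lemma one_le_mul_euclSq {k : ℕ} {t r : ℝ} (ht : 0 ≤ t) (hr : 0 ≤ r) (htr : 1 ≤ t * r ^ 2) {b : Cn k}
    (hb : r ≤ ‖b‖) : 1 ≤ t * euclSq b := by
  refine htr.trans ?_
  have := norm_sq_le_euclSq b
  have h : r ^ 2 ≤ ‖b‖ ^ 2 := by gcongr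
  gcongr
  linarith

lemma kern_eq_zero {k : ℕ} {t r : ℝ} (ht : 0 ≤ t) (hr : 0 ≤ r) (htr : 1 ≤ t * r ^ 2) {b : Cn k}
    (hb : r ≤ ‖b‖) : kern t b = 0 := by
  rw [kern, profile_of_one_le (one_le_mul_euclSq ht hr htr hb), mul_zero]

lemma kern_rotate {k : ℕ} (t : ℝ) {c : ℂ} (hc : ‖c‖ = 1) (b : Cn k) :
    kern t (c • b) = kern t b := by
  rw [kern, kern, euclSq_smul, hc]; simp

lemma hasCompactSupport_kern {k : ℕ} {t : ℝ} (ht : 0 < t) :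
    HasCompactSupport (kern (k := k) t) := by
  refine HasCompactSupport.intro (isCompact_closedBall 0 (Real.sqrt t⁻¹)) fun b hb => ?_
  refine kern_eq_zero ht.le (Real.sqrt_nonneg t⁻¹) ?_ ?_
  · rw [Real.sq_sqrt (by positivity), mul_inv_cancel₀ ht.ne']
  · simpa using (not_le.1 (fun h => hb (by simpa using h))).le

lemma integrable_kern {k : ℕ} {t : ℝ} (ht : 0 < t) : Integrable (kern (k := k) t) :=
  (continuous_kern t).integrable_of_hasCompactSupport (hasCompactSupport_kern ht)

lemma integral_kern {k : ℕ} {t : ℝ} (ht : 0 < t) : ∫ b : Cn k, kern t b = kernMass k := by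
  have h := Measure.integral_comp_smul (volume : Measure (Cn k))
    (fun b => profile (euclSq b)) (Real.sqrt t)
  have h1 : ∀ b : Cn k, euclSq (Real.sqrt t • b) = t * euclSq b := fun b => by
    have : Real.sqrt t • b = ((Real.sqrt t : ℝ) : ℂ) • b := by ext; simp
    rw [this, euclSq_smul]
    simp [abs_of_nonneg, Real.sq_sqrt ht.le]
  have h2 : Module.finrank ℝ (Cn k) = 2 * k := by
    simp [Module.finrank_pi_fintype, Complex.finrank_real_complex, mul_comm]
  simp only [h1, h2, pow_mul, Real.sq_sqrt ht.le, smul_eq_mul] at h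
  simp only [kern]
  rw [integral_const_mul, h, kernMass, abs_of_pos (by positivity), ← mul_assoc,
    mul_inv_cancel₀ (by positivity), one_mul]

lemma kernMass_pos (k : ℕ) : 0 < kernMass k := by
  have h := integral_kern (k := k) one_pos
  rw [← h]
  refine (continuous_kern 1).integral_pos_of_hasCompactSupport_nonneg_nonzero
    (hasCompactSupport_kern one_pos) (kern_nonneg zero_le_one) (x := 0) ?_
  have : euclSq (0 : Cn k) = 0 := by simp [euclSq]
  simp [kern, this, profile_zero_pos.ne']

/-- The unnormalised average `∫ ρ_t(z - x) f(z) dz`. -/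
noncomputable def kernAvg {k : ℕ} (t : ℝ) (f : Cn k → ℝ) (x : Cn k) : ℝ :=
  ∫ z, kern t (z - x) * f z

lemma integral_kern_sub {k : ℕ} {t : ℝ} (ht : 0 < t) (x : Cn k) :
    ∫ z : Cn k, kern t (z - x) = kernMass k := by
  rw [integral_sub_right_eq_self (fun z => kern t z), integral_kern ht]

lemma exists_kern_le {k : ℕ} {t : ℝ} (ht : 0 < t) : ∃ C, ∀ b : Cn k, ‖kern t b‖ ≤ C :=
  (hasCompactSupport_kern ht).exists_bound_of_continuous (continuous_kern t)

lemma kern_sub_mul_eq_indicator {k : ℕ} {t r : ℝ} (ht : 0 ≤ t) (hr : 0 ≤ r) (htr : 1 ≤ t * r ^ 2)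
    {x : Cn k} {s : Set (Cn k)} (hs : Metric.closedBall x r ⊆ s) (f : Cn k → ℝ) (z : Cn k) :
    kern t (z - x) * f z = kern t (z - x) * s.indicator f z := by
  by_cases hz : z ∈ s
  · rw [indicator_of_mem hz]
  · have : kern t (z - x) = 0 := by
      refine kern_eq_zero ht hr htr ?_
      by_contra! h
      exact hz (hs (by rw [Metric.mem_closedBall, dist_eq_norm]; exact h.le))
    rw [this, zero_mul, zero_mul]

lemma integrable_kern_mul_of_integrable {k : ℕ} {t : ℝ} (ht : 0 < t) {f : Cn k → ℝ}
    (hf : Integrable f) (x : Cn k) : Integrable fun z => kern t (z - x) * f z := by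
  obtain ⟨C, hC⟩ := exists_kern_le (k := k) ht
  refine hf.bdd_mul (c := C) ?_ (ae_of_all _ fun z => hC _)
  exact ((continuous_kern t).comp (continuous_id.sub continuous_const)).aestronglyMeasurable

lemma integrable_kern_mul {k : ℕ} {t r : ℝ} (ht : 0 < t) (hr : 0 ≤ r) (htr : 1 ≤ t * r ^ 2)
    {x : Cn k} {f : Cn k → ℝ} (hf : IntegrableOn f (Metric.closedBall x r)) :
    Integrable fun z => kern t (z - x) * f z := by
  simp only [kern_sub_mul_eq_indicator ht.le hr htr subset_rfl f]
  exact integrable_kern_mul_of_integrable ht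
    ((integrable_indicator_iff Metric.isClosed_closedBall.measurableSet).2 hf) x

lemma kernAvg_mono {k : ℕ} {t r : ℝ} (ht : 0 < t) (hr : 0 ≤ r) (htr : 1 ≤ t * r ^ 2)
    {x : Cn k} {f g : Cn k → ℝ} (hf : IntegrableOn f (Metric.closedBall x r))
    (hg : IntegrableOn g (Metric.closedBall x r))
    (h : ∀ᵐ z ∂volume.restrict (Metric.closedBall x r), f z ≤ g z) :
    kernAvg t f x ≤ kernAvg t g x := by
  refine integral_mono_ae (integrable_kern_mul ht hr htr hf) (integrable_kern_mul ht hr htr hg) ?_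
  rw [ae_restrict_iff' Metric.isClosed_closedBall.measurableSet] at h
  filter_upwards [h] with z hz
  by_cases hzb : z ∈ Metric.closedBall x r
  · exact mul_le_mul_of_nonneg_left (hz hzb) (kern_nonneg ht.le _)
  · have : kern t (z - x) = 0 := by
      refine kern_eq_zero ht.le hr htr ?_
      by_contra! h
      exact hzb (by rw [Metric.mem_closedBall, dist_eq_norm]; exact h.le)
    simp [this]

lemma kernAvg_const {k : ℕ} {t : ℝ} (ht : 0 < t) (x : Cn k) (c : ℝ) :
    kernAvg t (fun _ => c) x = kernMass k * c := by
  rw [kernAvg, integral_mul_const, integral_kern_sub ht]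

lemma kernAvg_add {k : ℕ} {t r : ℝ} (ht : 0 < t) (hr : 0 ≤ r) (htr : 1 ≤ t * r ^ 2)
    {x : Cn k} {f g : Cn k → ℝ} (hf : IntegrableOn f (Metric.closedBall x r))
    (hg : IntegrableOn g (Metric.closedBall x r)) :
    kernAvg t (fun z => f z + g z) x = kernAvg t f x + kernAvg t g x := by
  simp only [kernAvg, mul_add]
  exact integral_add (integrable_kern_mul ht hr htr hf) (integrable_kern_mul ht hr htr hg)

lemma kernAvg_sub {k : ℕ} {t r : ℝ} (ht : 0 < t) (hr : 0 ≤ r) (htr : 1 ≤ t * r ^ 2)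
    {x : Cn k} {f g : Cn k → ℝ} (hf : IntegrableOn f (Metric.closedBall x r))
    (hg : IntegrableOn g (Metric.closedBall x r)) :
    kernAvg t (fun z => f z - g z) x = kernAvg t f x - kernAvg t g x := by
  simp only [kernAvg, mul_sub]
  exact integral_sub (integrable_kern_mul ht hr htr hf) (integrable_kern_mul ht hr htr hg)

lemma continuousAt_kernAvg {k : ℕ} {t r : ℝ} (ht : 0 < t) (hr : 0 < r) (htr : 1 ≤ t * r ^ 2)
    {y : Cn k} {f : Cn k → ℝ} (hf : IntegrableOn f (Metric.closedBall y (2 * r))) {x : Cn k}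
    (hx : x ∈ Metric.ball y r) : ContinuousAt (kernAvg t f) x := by
  set F := (Metric.closedBall y (2 * r)).indicator f with hF
  have hFi : Integrable F :=
    (integrable_indicator_iff Metric.isClosed_closedBall.measurableSet).2 hf
  obtain ⟨C, hC⟩ := exists_kern_le (k := k) ht
  have hcont : Continuous fun x => ∫ z, kern t (z - x) * F z := by
    refine continuous_of_dominated (bound := fun z => C * ‖F z‖)
      (fun x => (integrable_kern_mul_of_integrable ht hFi x).aestronglyMeasurable)
      (fun x => ae_of_all _ fun z => ?_) (hFi.norm.const_mul C) (ae_of_all _ fun z => ?_)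
    · rw [norm_mul]
      exact mul_le_mul_of_nonneg_right (hC _) (norm_nonneg _)
    · exact ((continuous_kern t).comp (continuous_const.sub continuous_id)).mul continuous_const
  refine hcont.continuousAt.congr ?_
  filter_upwards [Metric.isOpen_ball.mem_nhds hx] with x' hx'
  rw [kernAvg]
  refine integral_congr_ae (ae_of_all _ fun z => ?_)
  refine (kern_sub_mul_eq_indicator ht.le hr.le htr ?_ f z).symm
  refine Metric.closedBall_subset_closedBall' ?_
  rw [Metric.mem_ball] at hx'
  linarith

/-! ### Averages of plurisubharmonic functions -/

lemma measurePreserving_rotate (k : ℕ) {c : ℂ} (hc : ‖c‖ = 1) :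
    MeasurePreserving (fun b : Cn k => c • b) := by
  have h := volume_preserving_pi (ι := Fin k) (f := fun _ => rotation ⟨c, mem_sphere_zero_iff_norm.2 hc⟩)
    (fun _ => (rotation ⟨c, mem_sphere_zero_iff_norm.2 hc⟩ : ℂ ≃ₗᵢ[ℝ] ℂ).measurePreserving)
  exact h

/-- The sub-mean value inequality for averages with respect to weights that are invariant under
the circle action: average the inequality on circles over all directions. -/
lemma PshOn.lintegral_mul_gap_le {k : ℕ} {f : Cn k → EReal} {V : Set (Cn k)} (hV : IsOpen V)
    (hf : PshOn f V) {a : Cn k} {r : ℝ} (har : Metric.closedBall a r ⊆ V) {M : ℝ}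
    (hM : 0 ≤ M) (hfM : ∀ z ∈ Metric.closedBall a r, f z ≤ M) {η : Cn k → ENNReal}
    (hη : Measurable η) (hrot : ∀ (c : ℂ) (b : Cn k), ‖c‖ = 1 → η (c • b) = η b)
    (hsupp : ∀ b, r < ‖b‖ → η b = 0) :
    ∫⁻ b, η b * gap M (f (a + b)) ≤ (∫⁻ b, η b) * gap M (f a) := by
  classical
  set f' : Cn k → EReal := V.piecewise f (fun _ => ⊥) with hf'
  have hf'm : Measurable f' := measurable_piecewise_of_usc hV hf.usc ⊥
  have hmem : ∀ b : Cn k, ‖b‖ ≤ r → a + b ∈ Metric.closedBall a r := fun b hb => by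
    simpa [dist_eq_norm] using hb
  have hf'f : ∀ b, η b * gap M (f (a + b)) = η b * gap M (f' (a + b)) := fun b => by
    by_cases hb : r < ‖b‖
    · simp [hsupp b hb]
    · have : a + b ∈ V := har (hmem b (not_lt.1 hb))
      simp [hf', this]
  have hg : Measurable fun b => gap M (f' (a + b)) :=
    (measurable_gap M).comp (hf'm.comp (measurable_const_add a))
  have hrotate : ∀ t : ℝ, ∫⁻ b, η b * gap M (f' (a + circlePt t • b))
      = ∫⁻ b, η b * gap M (f' (a + b)) := fun t => by
    have h := (measurePreserving_rotate k (norm_circlePt t)).lintegral_comp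
      (f := fun b => η b * gap M (f' (a + b))) (hη.mul hg)
    rw [← h]
    refine lintegral_congr fun b => ?_
    rw [hrot _ _ (norm_circlePt t)]
  calc ∫⁻ b, η b * gap M (f (a + b)) = ∫⁻ b, η b * gap M (f' (a + b)) := lintegral_congr hf'f
    _ = ∫⁻ _ in Ioc (0 : ℝ) 1, ∫⁻ b, η b * gap M (f' (a + b)) := by simp
    _ = ∫⁻ t in Ioc (0 : ℝ) 1, ∫⁻ b, η b * gap M (f' (a + circlePt t • b)) :=
        lintegral_congr fun t => (hrotate t).symm
    _ = ∫⁻ b, ∫⁻ t in Ioc (0 : ℝ) 1, η b * gap M (f' (a + circlePt t • b)) := by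
        refine lintegral_lintegral_swap (Measurable.aemeasurable ?_)
        have hc : Measurable fun p : ℝ × Cn k => a + circlePt p.1 • p.2 := by
          have := continuous_circlePt
          exact (by fun_prop : Continuous _).measurable
        exact (hη.comp measurable_snd).mul ((measurable_gap M).comp (hf'm.comp hc))
    _ ≤ ∫⁻ b, η b * gap M (f a) := by
        refine lintegral_mono fun b => ?_
        by_cases hb : r < ‖b‖
        · simp [hsupp b hb]
        · have hin : ∀ ζ : ℂ, ‖ζ‖ ≤ 1 → a + ζ • b ∈ Metric.closedBall a r := fun ζ hζ => by
            refine hmem _ ?_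
            rw [norm_smul]
            calc ‖ζ‖ * ‖b‖ ≤ 1 * r := by gcongr; exact not_lt.1 hb
              _ = r := one_mul r
          have hm : Measurable fun t : ℝ => gap M (f' (a + circlePt t • b)) := by
            have := continuous_circlePt
            exact (measurable_gap M).comp (hf'm.comp (by fun_prop : Continuous _).measurable)
          rw [lintegral_const_mul _ hm]
          gcongr
          refine le_trans (le_of_eq (lintegral_congr fun t => ?_))
            (hf.lintegral_gap_le (fun ζ hζ => har (hin ζ hζ)) hM fun ζ hζ => hfM _ (hin ζ hζ))
          have : a + circlePt t • b ∈ V := har (hin _ (norm_circlePt t).le)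
          simp [hf', this]
    _ = (∫⁻ b, η b) * gap M (f a) := lintegral_mul_const _ hη

lemma PshOn.exists_bound {k : ℕ} {f : Cn k → EReal} {V : Set (Cn k)} (hf : PshOn f V) {a : Cn k}
    {r : ℝ} (har : Metric.closedBall a r ⊆ V) :
    ∃ M : ℝ, 0 ≤ M ∧ ∀ z ∈ Metric.closedBall a r, f z ≤ M :=
  exists_forall_le_of_usc (isCompact_closedBall a r) (hf.usc.mono har) fun z hz =>
    hf.ne_top z (har hz)

lemma aemeasurable_of_usc {k : ℕ} {f : Cn k → EReal} {V : Set (Cn k)} (hV : IsOpen V)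
    (hf : UpperSemicontinuousOn f V) {s : Set (Cn k)} (hs : MeasurableSet s) (hsV : s ⊆ V) :
    AEMeasurable f (volume.restrict s) := by
  classical
  refine ⟨V.piecewise f fun _ => ⊥, measurable_piecewise_of_usc hV hf ⊥, ?_⟩
  filter_upwards [ae_restrict_mem hs] with z hz
  simp [hsV hz]

/-- A plurisubharmonic function that is finite at a point is finite almost everywhere and
integrable on balls around this point. -/
lemma PshOn.integrableOn {k : ℕ} {f : Cn k → EReal} {V : Set (Cn k)} (hV : IsOpen V)
    (hf : PshOn f V) {a : Cn k} {r : ℝ} (har : Metric.closedBall a r ⊆ V) (ha : f a ≠ ⊥) :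
    (∀ᵐ z ∂volume.restrict (Metric.closedBall a r), f z ≠ ⊥) ∧
      IntegrableOn (fun z => (f z).toReal) (Metric.closedBall a r) := by
  obtain ⟨M, hM, hfM⟩ := hf.exists_bound har
  have hms : MeasurableSet (Metric.closedBall a r) := Metric.isClosed_closedBall.measurableSet
  -- the weight is the characteristic function of the ball
  have h := hf.lintegral_mul_gap_le hV har hM hfM
    (η := (Metric.closedBall (0 : Cn k) r).indicator 1)
    ((measurable_one).indicator Metric.isClosed_closedBall.measurableSet)
    (fun c b hc => by
      simp [indicator, norm_smul, hc])
    (fun b hb => by simp [hb])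
  have hfin : ∫⁻ z in Metric.closedBall a r, gap M (f z) ≠ ⊤ := by
    have h1 : ∫⁻ z in Metric.closedBall a r, gap M (f z)
        = ∫⁻ b, (Metric.closedBall (0 : Cn k) r).indicator 1 b * gap M (f (a + b)) := by
      rw [← lintegral_indicator hms, ← lintegral_add_left_eq_self _ a]
      refine lintegral_congr fun b => ?_
      by_cases hb : ‖b‖ ≤ r <;> simp [indicator, hb]
    rw [h1]
    refine ne_top_of_le_ne_top (ENNReal.mul_ne_top ?_ (gap_ne_top_iff.2 ha)) h
    rw [lintegral_indicator_one Metric.isClosed_closedBall.measurableSet]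
    exact (isCompact_closedBall (0 : Cn k) r).measure_lt_top.ne
  have hmeas := aemeasurable_of_usc hV hf.usc hms har
  have hmg : AEMeasurable (fun z => gap M (f z)) (volume.restrict (Metric.closedBall a r)) :=
    (measurable_gap M).comp_aemeasurable hmeas
  have hae : ∀ᵐ z ∂volume.restrict (Metric.closedBall a r), f z ≠ ⊥ := by
    filter_upwards [ae_lt_top' hmg hfin] with z hz
    exact gap_ne_top_iff.1 hz.ne
  refine ⟨hae, ?_⟩
  have hi : IntegrableOn (fun z => (gap M (f z)).toReal) (Metric.closedBall a r) :=
    integrable_toReal_of_lintegral_ne_top hmg hfin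
  have hMi : IntegrableOn (fun _ : Cn k => M) (Metric.closedBall a r) :=
    integrableOn_const (isCompact_closedBall a r).measure_lt_top.ne
  refine (hMi.sub hi).congr ?_
  filter_upwards [hae, ae_restrict_mem hms] with z hz hzm
  have hzt := hf.ne_top z (har hzm)
  obtain ⟨x, hx⟩ : ∃ x : ℝ, f z = x := ⟨(f z).toReal, (EReal.coe_toReal hzt hz).symm⟩
  have hxM : x ≤ M := by have := hfM z hzm; rw [hx] at this; exact_mod_cast this
  simp [hx, gap_coe, ENNReal.toReal_ofReal (show 0 ≤ M - x by linarith)]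

/-- The sub-mean value inequality for averages with respect to the kernels `kern`. -/
lemma PshOn.kernMass_mul_le {k : ℕ} {f : Cn k → EReal} {V : Set (Cn k)} (hV : IsOpen V)
    (hf : PshOn f V) {a : Cn k} {r : ℝ} (hr : 0 ≤ r) (har : Metric.closedBall a r ⊆ V)
    (ha : f a ≠ ⊥) {t : ℝ} (ht : 0 < t) (htr : 1 ≤ t * r ^ 2) :
    kernMass k * (f a).toReal ≤ kernAvg t (fun z => (f z).toReal) a := by
  obtain ⟨M, hM, hfM⟩ := hf.exists_bound har
  obtain ⟨hae, hint⟩ := hf.integrableOn hV har ha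
  have hms : MeasurableSet (Metric.closedBall a r) := Metric.isClosed_closedBall.measurableSet
  have h := hf.lintegral_mul_gap_le hV har hM hfM (η := fun b => ENNReal.ofReal (kern t b))
    (continuous_kern t).measurable.ennreal_ofReal (fun c b hc => by rw [kern_rotate t hc])
    (fun b hb => by rw [kern_eq_zero ht.le hr htr hb.le, ENNReal.ofReal_zero])
  rw [← ofReal_integral_eq_lintegral_ofReal (integrable_kern ht)
    (ae_of_all _ (kern_nonneg ht.le)), integral_kern ht] at h
  have haM : f a ≤ M := hfM a (Metric.mem_closedBall_self hr)
  obtain ⟨x, hx⟩ : ∃ x : ℝ, f a = x :=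
    ⟨(f a).toReal, (EReal.coe_toReal (hf.ne_top a (har (Metric.mem_closedBall_self hr))) ha).symm⟩
  have hxM : x ≤ M := by rw [hx] at haM; exact_mod_cast haM
  have hMi : IntegrableOn (fun _ : Cn k => M) (Metric.closedBall a r) :=
    integrableOn_const (isCompact_closedBall a r).measure_lt_top.ne
  have h1 : ∫⁻ b, ENNReal.ofReal (kern t b) * gap M (f (a + b))
      = ENNReal.ofReal (kernAvg t (fun z => M - (f z).toReal) a) := by
    have h2 : ∀ᵐ z : Cn k, ENNReal.ofReal (kern t (z - a)) * gap M (f z)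
        = ENNReal.ofReal (kern t (z - a) * (M - (f z).toReal)) ∧
          0 ≤ kern t (z - a) * (M - (f z).toReal) := by
      rw [ae_restrict_iff' hms] at hae
      filter_upwards [hae] with z hz
      by_cases hzb : z ∈ Metric.closedBall a r
      · obtain ⟨w, hw⟩ : ∃ w : ℝ, f z = w :=
          ⟨(f z).toReal, (EReal.coe_toReal (hf.ne_top z (har hzb)) (hz hzb)).symm⟩
        have hwM : w ≤ M := by have := hfM z hzb; rw [hw] at this; exact_mod_cast this
        rw [hw, gap_coe, EReal.toReal_coe, ENNReal.ofReal_mul (kern_nonneg ht.le _)]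
        exact ⟨rfl, mul_nonneg (kern_nonneg ht.le _) (by linarith)⟩
      · have : kern t (z - a) = 0 := by
          refine kern_eq_zero ht.le hr htr ?_
          by_contra! h
          exact hzb (by rw [Metric.mem_closedBall, dist_eq_norm]; exact h.le)
        simp [this]
    rw [kernAvg, ofReal_integral_eq_lintegral_ofReal
      (integrable_kern_mul (f := fun z => M - (f z).toReal) ht hr htr (hMi.sub hint))
      (h2.mono fun z hz => hz.2)]
    rw [← lintegral_congr_ae (h2.mono fun z hz => hz.1)]
    have h3 := lintegral_add_left_eq_self (μ := (volume : Measure (Cn k)))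
      (fun z => ENNReal.ofReal (kern t (z - a)) * gap M (f z)) a
    simp only [add_sub_cancel_left] at h3
    exact h3
  rw [h1, hx, gap_coe, ← ENNReal.ofReal_mul (kernMass_pos k).le, ENNReal.ofReal_le_ofReal_iff
    (mul_nonneg (kernMass_pos k).le (by linarith)), kernAvg_sub ht hr htr hMi hint,
    kernAvg_const ht] at h
  rw [hx, EReal.toReal_coe]
  linarith

/-! ### Local integrability of quasi-plurisubharmonic functions -/

lemma coe_add_ne_bot {c : ℝ} {x : EReal} : (c : EReal) + x ≠ ⊥ ↔ x ≠ ⊥ := by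
  simp

lemma toReal_coe_add {c : ℝ} {x : EReal} (h1 : x ≠ ⊥) (h2 : x ≠ ⊤) :
    ((c : EReal) + x).toReal = c + x.toReal := by
  rw [EReal.toReal_add (EReal.coe_ne_top _) (EReal.coe_ne_bot _) h2 h1, EReal.toReal_coe]

lemma PshOn.ne_top_of_add {k : ℕ} {g : Cn k → ℝ} {u : Cn k → EReal} {V : Set (Cn k)}
    (h : PshOn (fun z => (g z : EReal) + u z) V) {z : Cn k} (hz : z ∈ V) : u z ≠ ⊤ := by
  intro hu
  exact h.ne_top z hz (by simp [hu])

lemma integrableOn_of_pshOn_add {k : ℕ} {g : Cn k → ℝ} {u : Cn k → EReal} {V : Set (Cn k)}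
    (hV : IsOpen V) (hg : ContinuousOn g V) (hu : PshOn (fun z => (g z : EReal) + u z) V)
    {x : Cn k} {r : ℝ} (hxr : Metric.closedBall x r ⊆ V) (hux : u x ≠ ⊥) :
    (∀ᵐ z ∂volume.restrict (Metric.closedBall x r), u z ≠ ⊥) ∧
      IntegrableOn (fun z => (u z).toReal) (Metric.closedBall x r) := by
  have hms : MeasurableSet (Metric.closedBall x r) := Metric.isClosed_closedBall.measurableSet
  obtain ⟨hae, hint⟩ := hu.integrableOn hV hxr (coe_add_ne_bot.2 hux)
  have hgi : IntegrableOn g (Metric.closedBall x r) :=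
    (hg.mono hxr).integrableOn_compact (isCompact_closedBall x r)
  refine ⟨hae.mono fun z hz => coe_add_ne_bot.1 hz, (hint.sub hgi).congr ?_⟩
  filter_upwards [hae, ae_restrict_mem hms] with z hz hzm
  simp only [Pi.sub_apply]
  rw [toReal_coe_add (coe_add_ne_bot.1 hz) (hu.ne_top_of_add (hxr hzm))]
  ring

/-- Averages of a function `u` such that `g + u` is plurisubharmonic, for a function `g` which
oscillates little. -/
lemma kernMass_mul_sub_le {k : ℕ} {g : Cn k → ℝ} {u : Cn k → EReal} {V : Set (Cn k)}
    (hV : IsOpen V) (hg : ContinuousOn g V) (hu : PshOn (fun z => (g z : EReal) + u z) V)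
    {x : Cn k} {r : ℝ} (hr : 0 ≤ r) (hxr : Metric.closedBall x r ⊆ V) (hux : u x ≠ ⊥) {t : ℝ}
    (ht : 0 < t) (htr : 1 ≤ t * r ^ 2) {δ : ℝ}
    (hδ : ∀ z ∈ Metric.closedBall x r, |g z - g x| ≤ δ) :
    kernMass k * ((u x).toReal - δ) ≤ kernAvg t (fun z => (u z).toReal) x := by
  have hms : MeasurableSet (Metric.closedBall x r) := Metric.isClosed_closedBall.measurableSet
  have hxV : x ∈ V := hxr (Metric.mem_closedBall_self hr)
  have h1 := hu.kernMass_mul_le hV hr hxr (coe_add_ne_bot.2 hux) ht htr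
  obtain ⟨hae, hint⟩ := hu.integrableOn hV hxr (coe_add_ne_bot.2 hux)
  have hui := (integrableOn_of_pshOn_add hV hg hu hxr hux).2
  have hci : IntegrableOn (fun _ : Cn k => g x + δ) (Metric.closedBall x r) :=
    integrableOn_const (isCompact_closedBall x r).measure_lt_top.ne
  have h2 : kernAvg t (fun z => ((g z : EReal) + u z).toReal) x
      ≤ kernAvg t (fun z => (g x + δ) + (u z).toReal) x := by
    refine kernAvg_mono ht hr htr hint (hci.add hui) ?_
    filter_upwards [hae, ae_restrict_mem hms] with z hz hzm
    rw [toReal_coe_add (coe_add_ne_bot.1 hz) (hu.ne_top_of_add (hxr hzm))]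
    have := (abs_le.mp (hδ z hzm)).2
    linarith
  rw [kernAvg_add ht hr htr hci hui, kernAvg_const ht] at h2
  rw [toReal_coe_add hux (hu.ne_top_of_add hxV)] at h1
  linarith

/-- `u` is quasi-plurisubharmonic on the open set `V`, with local potential `g`, and
`(u z).toReal`, which is `0` where `u = -∞`, is locally integrable. -/
structure QPshOn {k : ℕ} (g : Cn k → ℝ) (u : Cn k → EReal) (V : Set (Cn k)) : Prop where
  cont : ContinuousOn g V
  psh : PshOn (fun z => (g z : EReal) + u z) V
  locInt : LocallyIntegrableOn (fun z => (u z).toReal) V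

section Connected

variable {k : ℕ} {X : Type*} [TopologicalSpace X] [ChartedSpace (Cn k) X] {θ : SmoothForm k X 2}
  {u : X → EReal}

/-- Around each point of a chart there are balls on which a `θ`-plurisubharmonic function is
integrable, provided that the function is finite at points arbitrarily close to the given one. -/
lemma IsThetaPsh.exists_ball_integrableOn (hu : IsThetaPsh θ u)
    {e : OpenPartialHomeomorph X (Cn k)} (he : e ∈ atlas (Cn k) X) {y : Cn k} (hy : y ∈ e.target)
    (hcl : e.symm y ∈ closure {x | u x ≠ ⊥}) :
    ∃ r : ℝ, 0 < r ∧ Metric.closedBall y r ⊆ e.target ∧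
      (∀ᵐ z ∂volume.restrict (Metric.closedBall y r), u (e.symm z) ≠ ⊥) ∧
      IntegrableOn (fun z => (u (e.symm z)).toReal) (Metric.closedBall y r) := by
  obtain ⟨V, g, hV, hyV, hVe, hg, hgθ, hpsh⟩ := hu.psh e he y hy
  obtain ⟨R, hR, hball⟩ := Metric.isOpen_iff.mp hV y hyV
  set r := R / 4 with hr
  have hnhds : e.symm '' Metric.ball y r ∈ 𝓝 (e.symm y) :=
    e.symm.image_mem_nhds hy (Metric.ball_mem_nhds y (by positivity))
  obtain ⟨_, ⟨z, hz, rfl⟩, hzu⟩ := mem_closure_iff_nhds.mp hcl _ hnhds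
  rw [Metric.mem_ball] at hz
  have hsub : Metric.closedBall z (2 * r) ⊆ V := by
    refine (Metric.closedBall_subset_ball' ?_).trans hball
    linarith
  have hsub2 : Metric.closedBall y r ⊆ Metric.closedBall z (2 * r) := by
    refine Metric.closedBall_subset_closedBall' ?_
    rw [dist_comm]
    linarith
  obtain ⟨h1, h2⟩ := integrableOn_of_pshOn_add hV hg.continuousOn hpsh hsub hzu
  exact ⟨r, by positivity, (hsub2.trans hsub).trans hVe, ae_restrict_of_ae_restrict_of_subset hsub2 h1,
    h2.mono_set hsub2⟩

/-- On a connected manifold, a `θ`-plurisubharmonic function is finite on a dense set: the closure of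
the set where it is finite is open, since near each point of it the function is finite almost
everywhere. -/
lemma closure_eq_univ_of_isThetaPsh [PreconnectedSpace X] (hu : IsThetaPsh θ u) :
    closure {x | u x ≠ ⊥} = univ := by
  refine IsClopen.eq_univ ⟨isClosed_closure, ?_⟩ ?_
  swap
  · obtain ⟨x, hx⟩ := hu.ne_bot
    exact ⟨x, subset_closure hx⟩
  rw [isOpen_iff_mem_nhds]
  intro x hx
  set e := chartAt (Cn k) x
  have hxe : x ∈ e.source := mem_chart_source _ x
  have hx' : e.symm (e x) = x := e.left_inv hxe
  obtain ⟨r, hr, hball, hae, -⟩ := hu.exists_ball_integrableOn (chart_mem_atlas _ x)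
    (e.map_source hxe) (by rw [hx']; exact hx)
  have hnhds : e.symm '' Metric.ball (e x) r ∈ 𝓝 (e.symm (e x)) :=
    e.symm.image_mem_nhds (e.map_source hxe) (Metric.ball_mem_nhds _ hr)
  rw [hx'] at hnhds
  filter_upwards [hnhds]
  rintro _ ⟨z, hz, rfl⟩
  have hzt : z ∈ e.target := hball (Metric.ball_subset_closedBall hz)
  rw [mem_closure_iff_nhds]
  intro N hN
  -- the set where `u` is finite has full measure near `z`, hence meets each neighbourhood
  have hN' : e.symm ⁻¹' N ∩ Metric.ball (e x) r ∈ 𝓝 z :=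
    inter_mem ((e.continuousAt_symm hzt).preimage_mem_nhds hN) (Metric.isOpen_ball.mem_nhds hz)
  obtain ⟨s, hsN, hs, hzs⟩ := mem_nhds_iff.mp hN'
  by_contra hcon
  have hall : ∀ w ∈ s, u (e.symm w) = ⊥ := fun w hw => by
    by_contra hne
    exact hcon ⟨e.symm w, (hsN hw).1, hne⟩
  have hae' := ae_restrict_of_ae_restrict_of_subset
    (fun w hw => Metric.ball_subset_closedBall (hsN hw).2 : s ⊆ Metric.closedBall (e x) r) hae
  rw [ae_restrict_iff' hs.measurableSet] at hae'
  have hnull : volume s = 0 := by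
    refine measure_mono_null (fun w hw => ?_) (ae_iff.mp hae')
    simp only [mem_ofPred_eq, Classical.not_imp, not_not]
    exact ⟨hw, hall w hw⟩
  exact (hs.measure_pos volume ⟨z, hzs⟩).ne' hnull

lemma IsThetaPsh.locallyIntegrableOn [PreconnectedSpace X] (hu : IsThetaPsh θ u)
    {e : OpenPartialHomeomorph X (Cn k)} (he : e ∈ atlas (Cn k) X) :
    LocallyIntegrableOn (fun z => (u (e.symm z)).toReal) e.target := fun y hy => by
  obtain ⟨r, hr, -, -, hint⟩ := hu.exists_ball_integrableOn he hy
    (by rw [closure_eq_univ_of_isThetaPsh hu]; trivial)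
  exact ⟨_, mem_nhdsWithin_of_mem_nhds (Metric.closedBall_mem_nhds y hr), hint⟩

lemma IsThetaPsh.ae_ne_bot [PreconnectedSpace X] (hu : IsThetaPsh θ u)
    {e : OpenPartialHomeomorph X (Cn k)} (he : e ∈ atlas (Cn k) X) :
    ∀ᵐ z ∂volume.restrict e.target, u (e.symm z) ≠ ⊥ := by
  rw [ae_restrict_iff' e.open_target.measurableSet, ae_iff]
  refine measure_null_of_locally_null _ fun y hy => ?_
  have hyt : y ∈ e.target := by
    by_contra h
    exact hy fun h' => absurd h' h
  obtain ⟨r, hr, -, hae, -⟩ := hu.exists_ball_integrableOn he hyt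
    (by rw [closure_eq_univ_of_isThetaPsh hu]; trivial)
  rw [ae_restrict_iff' Metric.isClosed_closedBall.measurableSet, ae_iff] at hae
  refine ⟨_, inter_mem self_mem_nhdsWithin
    (mem_nhdsWithin_of_mem_nhds (Metric.closedBall_mem_nhds y hr)), ?_⟩
  refine measure_mono_null ?_ hae
  rintro z ⟨hz1, hz2⟩
  simp only [mem_ofPred_eq, Classical.not_imp, not_not] at hz1 ⊢
  exact ⟨hz2, hz1.2⟩

lemma IsThetaPsh.qpshOn [PreconnectedSpace X] (hu : IsThetaPsh θ u)
    {e : OpenPartialHomeomorph X (Cn k)} (he : e ∈ atlas (Cn k) X) {V : Set (Cn k)}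
    (hV : IsOpen V) (hVe : V ⊆ e.target) {g : Cn k → ℝ} (hg : ContDiffOn ℝ ∞ g V)
    (hgθ : ∀ z ∈ V, ddcFun g z = inChart θ e z) :
    QPshOn g (fun z => u (e.symm z)) V :=
  ⟨hg.continuousOn, hu.pshOn he hV hVe hg hgθ, (hu.locallyIntegrableOn he).mono_set hVe⟩

end Connected

/-! ### Comparison of envelopes through averages -/

/-- Near a point, members of a family with a common potential are bounded by the averages of an
integrable function that bounds each of them almost everywhere. -/
lemma exists_eventually_forall_le {k : ℕ} {g : Cn k → ℝ} {S : Set (Cn k → EReal)} {V : Set (Cn k)}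
    (hV : IsOpen V) {y : Cn k} (hy : y ∈ V) (hS : ∀ u ∈ S, QPshOn g u V) {f : Cn k → ℝ}
    (hf : LocallyIntegrableOn f V)
    (hle : ∀ u ∈ S, ∀ᵐ z ∂volume.restrict V, (u z).toReal ≤ f z) :
    ∃ C : ℝ, ∀ᶠ x in 𝓝 y, ∀ u ∈ S, u x ≤ C := by
  rcases S.eq_empty_or_nonempty with rfl | ⟨u₀, hu₀⟩
  · exact ⟨0, by simp⟩
  have hg := (hS u₀ hu₀).cont
  obtain ⟨R, hR, hball⟩ := Metric.isOpen_iff.mp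
    ((hg.isOpen_inter_preimage hV (Metric.isOpen_ball (x := g y) (ε := 1)))) y
    ⟨hy, Metric.mem_ball_self one_pos⟩
  set r := R / 4 with hr
  have hr0 : 0 < r := by positivity
  set t := (r ^ 2)⁻¹ with ht
  have ht0 : 0 < t := by positivity
  have htr : 1 ≤ t * r ^ 2 := by rw [ht, inv_mul_cancel₀ (by positivity)]
  have hsub : Metric.closedBall y (2 * r) ⊆ V := fun z hz =>
    (hball (Metric.closedBall_subset_ball (by linarith) hz)).1
  have hfi : IntegrableOn f (Metric.closedBall y (2 * r)) :=
    hf.integrableOn_compact_subset hsub (isCompact_closedBall _ _)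
  have hcont := continuousAt_kernAvg ht0 hr0 htr hfi (Metric.mem_ball_self hr0)
  have hm := kernMass_pos k
  refine ⟨(kernAvg t f y + 1) / kernMass k + 2, ?_⟩
  filter_upwards [hcont.eventually_lt_const (show kernAvg t f y < kernAvg t f y + 1 by linarith),
    Metric.ball_mem_nhds y hr0] with x hx hxr u hu
  rw [Metric.mem_ball] at hxr
  have hxsub : Metric.closedBall x r ⊆ Metric.closedBall y (2 * r) :=
    Metric.closedBall_subset_closedBall' (by linarith)
  by_cases hux : u x = ⊥
  · simp [hux]
  have hosc : ∀ z ∈ Metric.closedBall x r, |g z - g x| ≤ 2 := fun z hz => by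
    have h1 := (hball (Metric.closedBall_subset_ball (by linarith) (hxsub hz))).2
    have h2 := (hball (Metric.closedBall_subset_ball (by linarith)
      (hxsub (Metric.mem_closedBall_self hr0.le)))).2
    simp only [mem_preimage, Metric.mem_ball, Real.dist_eq] at h1 h2
    have := abs_sub_le (g z) (g y) (g x)
    rw [abs_sub_comm (g y)] at this
    linarith
  have h1 := kernMass_mul_sub_le hV hg (hS u hu).psh hr0.le (hxsub.trans hsub) hux ht0 htr hosc
  have h2 : kernAvg t (fun z => (u z).toReal) x ≤ kernAvg t f x := by
    refine kernAvg_mono ht0 hr0.le htr ?_ (hfi.mono_set hxsub)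
      (ae_restrict_of_ae_restrict_of_subset (hxsub.trans hsub) (hle u hu))
    exact (hS u hu).locInt.integrableOn_compact_subset (hxsub.trans hsub) (isCompact_closedBall _ _)
  have h3 : (u x).toReal - 2 ≤ (kernAvg t f y + 1) / kernMass k := by
    rw [le_div_iff₀ hm]
    linarith
  have hxt : u x ≠ ⊤ := (hS u hu).psh.ne_top_of_add (hsub (hxsub (Metric.mem_closedBall_self hr0.le)))
  rw [← EReal.coe_toReal hxt hux]
  norm_cast
  linarith

/-- Comparison of an upper envelope with a function through averages. If `u + p` has smaller
averages near `y` than `q + H`, for all members `u` of a family, then the upper semicontinuous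
envelope of the family (here: a number `c` exceeded by members at points close to `y`) satisfies
`c + p(y) ≤ q(y) + H(y)` (here: `q` is bounded by `c'` near `y`). -/
lemma add_le_of_kernAvg_le {k : ℕ} {g gp : Cn k → ℝ} {S : Set (Cn k → EReal)}
    {p : Cn k → EReal} {q H : Cn k → ℝ} {V : Set (Cn k)} (hV : IsOpen V) {y : Cn k} (hy : y ∈ V)
    (hS : ∀ u ∈ S, QPshOn g u V) (hp : QPshOn gp p V) (hq : LocallyIntegrableOn q V)
    (hH : ContinuousAt H y) {t₀ : ℝ}
    (havg : ∀ᶠ x in 𝓝 y, ∀ t ≥ t₀, ∀ u ∈ S,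
      kernAvg t (fun z => (u z).toReal) x + kernAvg t (fun z => (p z).toReal) x
        ≤ kernAvg t q x + kernMass k * H x)
    (hpy : p y ≠ ⊥) {c c' : ℝ} (hc : ∃ᶠ x in 𝓝 y, ∃ u ∈ S, (c : EReal) < u x)
    {W : Set (Cn k)} (hW : W ∈ 𝓝 y) (hc' : ∀ᵐ z ∂volume.restrict W, q z ≤ c') :
    c + (p y).toReal ≤ c' + H y := by
  have hm := kernMass_pos k
  obtain ⟨_, _, u₀, hu₀, _⟩ := hc.exists.imp fun x hx => (⟨trivial, hx⟩ : True ∧ _)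
  have hg := (hS u₀ hu₀).cont
  refine le_of_forall_pos_le_add fun ε hε => ?_
  set δ := ε / 8 with hδ
  have hδ0 : 0 < δ := by positivity
  obtain ⟨R, hR, hball⟩ := Metric.mem_nhds_iff.mp (inter_mem (inter_mem
    ((hg.isOpen_inter_preimage hV (Metric.isOpen_ball (x := g y) (ε := δ))).mem_nhds
      ⟨hy, Metric.mem_ball_self hδ0⟩)
    ((hp.cont.isOpen_inter_preimage hV (Metric.isOpen_ball (x := gp y) (ε := δ))).mem_nhds
      ⟨hy, Metric.mem_ball_self hδ0⟩)) hW)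
  set r := R / 4 with hr
  have hr0 : 0 < r := by positivity
  set t := max t₀ (r ^ 2)⁻¹ with ht
  have ht0 : 0 < t := lt_max_of_lt_right (by positivity)
  have htr : 1 ≤ t * r ^ 2 := by
    calc (1 : ℝ) = (r ^ 2)⁻¹ * r ^ 2 := by rw [inv_mul_cancel₀ (by positivity)]
      _ ≤ t * r ^ 2 := by gcongr; exact le_max_right _ _
  have hsub' : Metric.closedBall y (2 * r) ⊆ Metric.ball y R :=
    Metric.closedBall_subset_ball (by linarith)
  have hsub : Metric.closedBall y (2 * r) ⊆ V := fun z hz => (hball (hsub' hz)).1.1.1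
  have hsubr : Metric.closedBall y r ⊆ Metric.closedBall y (2 * r) :=
    Metric.closedBall_subset_closedBall (by linarith)
  have hqi : IntegrableOn q (Metric.closedBall y (2 * r)) :=
    hq.integrableOn_compact_subset hsub (isCompact_closedBall _ _)
  have hpi : IntegrableOn (fun z => (p z).toReal) (Metric.closedBall y (2 * r)) :=
    hp.locInt.integrableOn_compact_subset hsub (isCompact_closedBall _ _)
  have hcq := continuousAt_kernAvg ht0 hr0 htr hqi (Metric.mem_ball_self hr0)
  have hcp := continuousAt_kernAvg ht0 hr0 htr hpi (Metric.mem_ball_self hr0)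
  have hmδ : 0 < kernMass k * δ := by positivity
  -- the kernel is fixed (by `t`) before the point `x` near `y` is chosen, so that the averages at `x`
  -- are close to those at `y`
  obtain ⟨x, ⟨u, hu, hcu⟩, hxr, hxq, hxp, hxH, hxavg⟩ := (hc.and_eventually
    ((eventually_of_mem (Metric.ball_mem_nhds y hr0) fun x hx => hx).and
    ((hcq.eventually_lt_const (lt_add_of_pos_right _ hmδ)).and
    ((hcp.eventually_const_lt (sub_lt_self _ hmδ)).and
    ((hH.eventually_lt_const (lt_add_of_pos_right _ hδ0)).and havg))))).exists
  rw [Metric.mem_ball] at hxr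
  have hxsub : Metric.closedBall x r ⊆ Metric.closedBall y (2 * r) :=
    Metric.closedBall_subset_closedBall' (by linarith)
  have hxx : x ∈ Metric.closedBall x r := Metric.mem_closedBall_self hr0.le
  have hosc : ∀ z ∈ Metric.closedBall x r, |g z - g x| ≤ 2 * δ := fun z hz => by
    have h1 := (hball (hsub' (hxsub hz))).1.1.2
    have h2 := (hball (hsub' (hxsub hxx))).1.1.2
    simp only [mem_preimage, Metric.mem_ball, Real.dist_eq] at h1 h2
    have := abs_sub_le (g z) (g y) (g x)
    rw [abs_sub_comm (g y)] at this
    linarith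
  have hoscp : ∀ z ∈ Metric.closedBall y r, |gp z - gp y| ≤ δ := fun z hz => by
    have h1 := (hball (hsub' (hsubr hz))).1.2.2
    simp only [mem_preimage, Metric.mem_ball, Real.dist_eq] at h1
    exact h1.le
  have hux : u x ≠ ⊥ := (bot_le.trans_lt hcu).ne'
  have hxt : u x ≠ ⊤ := (hS u hu).psh.ne_top_of_add (hsub (hxsub hxx))
  have h1 := kernMass_mul_sub_le hV hg (hS u hu).psh hr0.le (hxsub.trans hsub) hux ht0 htr hosc
  have h2 := kernMass_mul_sub_le hV hp.cont hp.psh hr0.le (hsubr.trans hsub) hpy ht0 htr hoscp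
  have h3 := hxavg t (le_max_left _ _) u hu
  have h4 : kernAvg t q y ≤ kernMass k * c' := by
    rw [← kernAvg_const ht0 y c']
    refine kernAvg_mono ht0 hr0.le htr (hqi.mono_set hsubr)
      (integrableOn_const (isCompact_closedBall y r).measure_lt_top.ne) ?_
    exact ae_restrict_of_ae_restrict_of_subset (fun z hz => (hball (hsub' (hsubr hz))).2) hc'
  have h5 : c < (u x).toReal := by
    rw [← EReal.coe_toReal hxt hux] at hcu
    exact_mod_cast hcu
  have h6 : kernMass k * c ≤ kernMass k * (u x).toReal := by gcongr
  have h7 : kernMass k * H x ≤ kernMass k * (H y + δ) := by gcongr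
  have h8 : kernMass k * (c + (p y).toReal) ≤ kernMass k * (c' + H y + ε) := by
    have : ε = 8 * δ := by rw [hδ]; ring
    rw [this]
    nlinarith
  exact le_of_mul_le_mul_left h8 hm

section Comparison

variable {k : ℕ} {X : Type*} [TopologicalSpace X] [ChartedSpace (Cn k) X] [PreconnectedSpace X]
  {θ : SmoothForm k X 2}

/-- Comparison of an envelope of `θ`-plurisubharmonic functions with other such functions, through
averages in a chart. -/
lemma regSup_add_le_of_kernAvg_le {S : Set (X → EReal)} (hS : ∀ u ∈ S, IsThetaPsh θ u)
    {p a b : X → EReal} (hp : IsThetaPsh θ p) (ha : IsThetaPsh θ a) (hb : IsThetaPsh θ b)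
    {e : OpenPartialHomeomorph X (Cn k)} (he : e ∈ atlas (Cn k) X) {y : Cn k} (hy : y ∈ e.target)
    {H : Cn k → ℝ} (hH : ContinuousAt H y) {t₀ : ℝ}
    (havg : ∀ᶠ x in 𝓝 y, ∀ t ≥ t₀, ∀ u ∈ S,
      kernAvg t (fun z => (u (e.symm z)).toReal) x + kernAvg t (fun z => (p (e.symm z)).toReal) x
        ≤ kernAvg t (fun z => (a (e.symm z)).toReal + (b (e.symm z)).toReal) x
          + kernMass k * H x) :
    regSup S (e.symm y) + p (e.symm y) ≤ a (e.symm y) + b (e.symm y) + (H y : EReal) := by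
  by_cases hpy : p (e.symm y) = ⊥
  · simp [hpy]
  by_contra! hlt
  obtain ⟨p₀, hp₀⟩ : ∃ p₀ : ℝ, p (e.symm y) = p₀ :=
    ⟨_, (EReal.coe_toReal (hp.ne_top _) hpy).symm⟩
  have h1 : a (e.symm y) + b (e.symm y) + (H y : EReal) - (p₀ : EReal) < regSup S (e.symm y) := by
    rw [hp₀] at hlt
    exact EReal.sub_lt_of_lt_add hlt
  obtain ⟨c, hc1, hc2⟩ := EReal.lt_iff_exists_real_btwn.mp h1
  have h2 : a (e.symm y) + b (e.symm y) < ((c + p₀ - H y : ℝ) : EReal) := by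
    have hat := ha.ne_top (e.symm y)
    have hbt := hb.ne_top (e.symm y)
    by_cases hab : a (e.symm y) + b (e.symm y) = ⊥
    · rw [hab]; exact EReal.bot_lt_coe _
    obtain ⟨s, hs⟩ : ∃ s : ℝ, a (e.symm y) + b (e.symm y) = s :=
      ⟨_, (EReal.coe_toReal (EReal.add_ne_top hat hbt) hab).symm⟩
    rw [hs] at hc1 ⊢
    norm_cast at hc1 ⊢
    linarith
  obtain ⟨c', hc1', hc2'⟩ := EReal.lt_iff_exists_real_btwn.mp h2
  obtain ⟨V, g, hV, hyV, hVe, hg, hgθ, -⟩ := hp.psh e he y hy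
  have hq : LocallyIntegrableOn
      (fun z => (a (e.symm z)).toReal + (b (e.symm z)).toReal) V :=
    ((ha.locallyIntegrableOn he).mono_set hVe).add ((hb.locallyIntegrableOn he).mono_set hVe)
  have hab : UpperSemicontinuousOn (fun z => a (e.symm z) + b (e.symm z)) e.target :=
    (usc_comp_symm ha.usc e).add' (usc_comp_symm hb.usc e) fun x _ =>
      EReal.continuousAt_add (Or.inl (ha.ne_top _)) (Or.inr (hb.ne_top _))
  have hW : {z | a (e.symm z) + b (e.symm z) < c'} ∩ e.target ∈ 𝓝 y := by
    have := hab y hy c' hc1'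
    rw [e.open_target.nhdsWithin_eq hy] at this
    exact inter_mem this (e.open_target.mem_nhds hy)
  obtain ⟨W, hWsub, hWo, hyW⟩ := mem_nhds_iff.mp hW
  have hfinal := add_le_of_kernAvg_le (S := (fun u z => u (e.symm z)) '' S) (c := c) (c' := c')
    (p := fun z => p (e.symm z)) (H := H) (t₀ := t₀) hV hyV
    (by rintro _ ⟨u, hu, rfl⟩; exact (hS u hu).qpshOn he hV hVe hg hgθ)
    (hp.qpshOn he hV hVe hg hgθ) hq hH
    (by
      filter_upwards [havg] with x hx t ht
      rintro _ ⟨u, hu, rfl⟩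
      exact hx t ht u hu) hpy
    (by
      have h3 := frequently_of_lt_regSup hc2
      rw [← e.symm.map_nhds_eq hy, frequently_map] at h3
      refine h3.mono ?_
      rintro x ⟨u, hu, hlt⟩
      exact ⟨_, ⟨u, hu, rfl⟩, hlt⟩) (hWo.mem_nhds hyW)
    (by
      have hWe : W ⊆ e.target := fun z hz => (hWsub hz).2
      filter_upwards [ae_restrict_of_ae_restrict_of_subset hWe (ha.ae_ne_bot he),
        ae_restrict_of_ae_restrict_of_subset hWe (hb.ae_ne_bot he),
        ae_restrict_mem hWo.measurableSet] with z hz1 hz2 hzW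
      have h4 := (hWsub hzW).1
      simp only [mem_ofPred_eq] at h4
      rw [← EReal.coe_toReal (ha.ne_top _) hz1, ← EReal.coe_toReal (hb.ne_top _) hz2] at h4
      norm_cast at h4
      exact h4.le)
  rw [hp₀, EReal.toReal_coe] at hfinal
  have : c' < c + p₀ - H y := by exact_mod_cast hc2'
  linarith

/-- An inequality `u + p ≤ a + b` that holds almost everywhere for all members `u` of a family of
`θ`-plurisubharmonic functions holds everywhere for the upper semicontinuous envelope. -/
lemma regSup_add_le_of_ae {S : Set (X → EReal)} (hS : ∀ u ∈ S, IsThetaPsh θ u)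
    {p a b : X → EReal} (hp : IsThetaPsh θ p) (ha : IsThetaPsh θ a) (hb : IsThetaPsh θ b)
    (hle : ∀ u ∈ S, ∀ e ∈ atlas (Cn k) X, ∀ᵐ z ∂volume.restrict e.target,
      u (e.symm z) + p (e.symm z) ≤ a (e.symm z) + b (e.symm z)) (x : X) :
    regSup S x + p x ≤ a x + b x := by
  set e := chartAt (Cn k) x
  have he : e ∈ atlas (Cn k) X := chart_mem_atlas _ x
  have hxe : x ∈ e.source := mem_chart_source _ x
  have hyt : e x ∈ e.target := e.map_source hxe
  obtain ⟨R, hR, hball⟩ := Metric.isOpen_iff.mp e.open_target (e x) hyt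
  set r := R / 4 with hr
  have hr0 : 0 < r := by positivity
  have h := regSup_add_le_of_kernAvg_le hS hp ha hb he hyt (H := fun _ => 0)
    continuousAt_const (t₀ := (r ^ 2)⁻¹) (by
      filter_upwards [Metric.ball_mem_nhds (e x) hr0] with x' hx' t ht u hu
      rw [Metric.mem_ball] at hx'
      have ht0 : 0 < t := lt_of_lt_of_le (by positivity) ht
      have htr : 1 ≤ t * r ^ 2 := by
        calc (1 : ℝ) = (r ^ 2)⁻¹ * r ^ 2 := by rw [inv_mul_cancel₀ (by positivity)]
          _ ≤ t * r ^ 2 := by gcongr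
      have hsub : Metric.closedBall x' r ⊆ e.target :=
        (Metric.closedBall_subset_ball' (by linarith)).trans hball
      have hint : ∀ {w : X → EReal}, IsThetaPsh θ w →
          IntegrableOn (fun z => (w (e.symm z)).toReal) (Metric.closedBall x' r) := fun hw =>
        (hw.locallyIntegrableOn he).integrableOn_compact_subset hsub (isCompact_closedBall _ _)
      rw [mul_zero, add_zero, ← kernAvg_add ht0 hr0.le htr (hint (hS u hu)) (hint hp)]
      refine kernAvg_mono ht0 hr0.le htr ((hint (hS u hu)).add (hint hp))
        ((hint ha).add (hint hb)) (ae_restrict_of_ae_restrict_of_subset hsub ?_)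
      filter_upwards [hle u hu e he, (hS u hu).ae_ne_bot he, hp.ae_ne_bot he, ha.ae_ne_bot he,
        hb.ae_ne_bot he] with z hz h1 h2 h3 h4
      rw [← EReal.coe_toReal ((hS u hu).ne_top _) h1, ← EReal.coe_toReal (hp.ne_top _) h2,
        ← EReal.coe_toReal (ha.ne_top _) h3, ← EReal.coe_toReal (hb.ne_top _) h4] at hz
      exact_mod_cast hz)
  rw [e.left_inv hxe] at h
  simpa using h

/-- Families of `θ`-plurisubharmonic functions that are bounded almost everywhere by a locally
integrable function are locally bounded above. -/
lemma locally_bddAbove_of_ae_le {S : Set (X → EReal)} (hS : ∀ u ∈ S, IsThetaPsh θ u)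
    {e : OpenPartialHomeomorph X (Cn k)} (he : e ∈ atlas (Cn k) X) {f : Cn k → ℝ}
    (hf : LocallyIntegrableOn f e.target)
    (hle : ∀ u ∈ S, ∀ᵐ z ∂volume.restrict e.target, (u (e.symm z)).toReal ≤ f z)
    {x : X} (hx : x ∈ e.source) : ∃ C : ℝ, ∀ᶠ y in 𝓝 x, ∀ u ∈ S, u y ≤ C := by
  rcases S.eq_empty_or_nonempty with rfl | ⟨u₀, hu₀⟩
  · exact ⟨0, by simp⟩
  obtain ⟨V, g, hV, hyV, hVe, hg, hgθ, -⟩ := (hS u₀ hu₀).psh e he (e x) (e.map_source hx)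
  obtain ⟨C, hC⟩ := exists_eventually_forall_le (S := (fun u z => u (e.symm z)) '' S) hV hyV
    (by rintro _ ⟨u, hu, rfl⟩; exact (hS u hu).qpshOn he hV hVe hg hgθ) (hf.mono_set hVe)
    (by rintro _ ⟨u, hu, rfl⟩; exact ae_restrict_of_ae_restrict_of_subset hVe (hle u hu))
  refine ⟨C, ?_⟩
  rw [← e.left_inv hx, ← e.symm.map_nhds_eq (e.map_source hx), eventually_map]
  filter_upwards [hC] with z hz u hu
  exact hz _ ⟨u, hu, rfl⟩

end Comparison

/-! ### Adding constants -/

lemma PshOn.add_const {k : ℕ} {f : Cn k → EReal} {V : Set (Cn k)} (hf : PshOn f V) (c : ℝ) :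
    PshOn (fun z => (c : EReal) + f z) V := by
  refine ⟨usc_coe_add continuousOn_const hf.usc,
    fun y hy => EReal.add_ne_top (EReal.coe_ne_top _) (hf.ne_top y hy), fun a b hab => ?_⟩
  have husc : UpperSemicontinuous fun t => f (a + circlePt t • b) := by
    rw [← upperSemicontinuousOn_univ_iff]
    have := continuous_circlePt
    exact hf.usc.comp (g := fun t => a + circlePt t • b) (by fun_prop)
      fun t _ => hab _ (norm_circlePt t).le
  obtain ⟨M, hM, hFM⟩ := exists_forall_le_of_usc (isCompact_disc a b)
    (hf.usc.mono (by rintro _ ⟨ζ, hζ, rfl⟩; exact hab ζ (by simpa using hζ)))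
    (by rintro _ ⟨ζ, hζ, rfl⟩; exact hf.ne_top _ (hab ζ (by simpa using hζ)))
  have h := erealIntegral_coe_add (h := fun _ => c) continuous_const husc.measurable hM
    (fun t => hFM _ ⟨circlePt t, by simp [norm_circlePt], rfl⟩)
  rw [circleMean_eq, h]
  refine add_le_add (by simp) (hf.submean a b hab)

lemma IsThetaPsh.add_const {k : ℕ} {X : Type*} [TopologicalSpace X] [ChartedSpace (Cn k) X]
    {θ : SmoothForm k X 2} {u : X → EReal} (hu : IsThetaPsh θ u) (c : ℝ) :
    IsThetaPsh θ (fun x => u x + (c : EReal)) := by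
  refine ⟨?_, fun x => EReal.add_ne_top (hu.ne_top x) (EReal.coe_ne_top _), ?_,
    fun e he y hy => ?_⟩
  · have := usc_coe_add (g := fun _ : X => c) continuousOn_const
      (upperSemicontinuousOn_univ_iff.2 hu.usc)
    rw [upperSemicontinuousOn_univ_iff] at this
    simpa only [add_comm] using this
  · obtain ⟨x, hx⟩ := hu.ne_bot
    exact ⟨x, by simpa using hx⟩
  · obtain ⟨V, g, hV, hyV, hVe, hg, hgθ, hpsh⟩ := hu.psh e he y hy
    refine ⟨V, g, hV, hyV, hVe, hg, hgθ, ?_⟩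
    have := hpsh.add_const c
    convert this using 2 with z
    rw [add_comm (u _), ← add_assoc, ← add_assoc, add_comm (c : EReal)]

lemma IsThetaPsh.exists_le {k : ℕ} {X : Type*} [TopologicalSpace X] [ChartedSpace (Cn k) X]
    [CompactSpace X] {θ : SmoothForm k X 2} {u : X → EReal} (hu : IsThetaPsh θ u) :
    ∃ C : ℝ, 0 ≤ C ∧ ∀ x, u x ≤ C := by
  obtain ⟨M, hM, h⟩ := exists_forall_le_of_usc isCompact_univ
    (upperSemicontinuousOn_univ_iff.2 hu.usc) fun x _ => hu.ne_top x
  exact ⟨M, hM, fun x => h x trivial⟩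

/-! ### The maximum principle -/

/-- A continuous function on a compact connected complex manifold is constant if, at every point of
every chart, its value is a weighted mean of the values nearby. -/
lemma exists_eq_const_of_kernAvg_eq {k : ℕ} {X : Type*} [TopologicalSpace X]
    [ChartedSpace (Cn k) X] [CompactSpace X] [ConnectedSpace X] {G : X → ℝ} (hG : Continuous G)
    (h : ∀ e ∈ atlas (Cn k) X, ∀ y ∈ e.target, ∃ t r : ℝ, 0 < t ∧ 0 < r ∧ 1 ≤ t * r ^ 2 ∧
      Metric.closedBall y r ⊆ e.target ∧
      kernAvg t (fun z => G (e.symm z)) y = kernMass k * G (e.symm y)) :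
    ∃ c, ∀ x, G x = c := by
  obtain ⟨x₀, -, hx₀⟩ := isCompact_univ.exists_isMaxOn univ_nonempty hG.continuousOn
  have hmax : ∀ x, G x ≤ G x₀ := fun x => hx₀ (mem_univ x)
  have hopen : IsOpen {x | G x = G x₀} := by
    rw [isOpen_iff_mem_nhds]
    intro x hx
    set e := chartAt (Cn k) x
    have hxe : x ∈ e.source := mem_chart_source _ x
    have hy : e x ∈ e.target := e.map_source hxe
    obtain ⟨t, r, ht, hr, htr, hsub, havg⟩ := h e (chart_mem_atlas _ x) (e x) hy
    have hcont : ContinuousOn (fun z => G (e.symm z)) e.target :=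
      hG.comp_continuousOn e.continuousOn_symm
    have hint : IntegrableOn (fun z => G (e.symm z)) (Metric.closedBall (e x) r) :=
      (hcont.mono hsub).integrableOn_compact (isCompact_closedBall _ _)
    have hconst : IntegrableOn (fun _ => G x₀) (Metric.closedBall (e x) r) :=
      continuousOn_const.integrableOn_compact (isCompact_closedBall _ _)
    have h1 : kernAvg t (fun z => G x₀ - G (e.symm z)) (e x) = 0 := by
      rw [kernAvg_sub ht hr.le htr hconst hint, havg, kernAvg_const ht, e.left_inv hxe, hx,
        sub_self]
    have h2 : (fun z => kern t (z - e x) * (G x₀ - G (e.symm z))) =ᵐ[volume] 0 := by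
      refine (integral_eq_zero_iff_of_nonneg (fun z => ?_)
        (integrable_kern_mul ht hr.le htr (hconst.sub hint))).1 h1
      exact mul_nonneg (kern_nonneg ht.le _) (sub_nonneg.2 (hmax _))
    have h3 : Set.EqOn (fun z => kern t (z - e x) * (G x₀ - G (e.symm z))) 0 e.target :=
      Measure.eqOn_open_of_ae_eq (ae_restrict_of_ae h2) e.open_target
        (((continuous_kern t).comp (continuous_id.sub continuous_const)).continuousOn.mul
          (continuousOn_const.sub hcont)) continuousOn_const
    have h4 : ∀ᶠ z in 𝓝 (e x), 0 < kern t (z - e x) := by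
      refine (((continuous_kern t).comp (continuous_id.sub continuous_const)).continuousAt
        (x := e x)).eventually (lt_mem_nhds (?_ : 0 < kern t (e x - e x)))
      have : euclSq (0 : Cn k) = 0 := by simp [euclSq]
      rw [sub_self, kern, this, mul_zero]
      exact mul_pos (pow_pos ht _) profile_zero_pos
    change ∀ᶠ x' in 𝓝 x, G x' = G x₀
    rw [← e.left_inv hxe, ← e.symm.map_nhds_eq hy, eventually_map]
    filter_upwards [h4, e.open_target.mem_nhds hy] with z hz hzt
    have := h3 hzt
    simp only [Pi.zero_apply, mul_eq_zero, hz.ne', false_or] at this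
    linarith
  have hclopen : IsClopen {x | G x = G x₀} := ⟨isClosed_eq hG continuous_const, hopen⟩
  refine ⟨G x₀, fun x => ?_⟩
  have := hclopen.eq_univ ⟨x₀, rfl⟩
  exact (this ▸ mem_univ x : x ∈ {x | G x = G x₀})

/-! ### Averages of weakly harmonic functions -/

/-- The Laplacian of a function on `ℂᵏ = ℝ²ᵏ`. -/
noncomputable def lap {k : ℕ} (σ : Cn k → ℝ) (y : Cn k) : ℝ :=
  ∑ j : Fin k, (secondDeriv σ y (Pi.single j 1) (Pi.single j 1) +
    secondDeriv σ y (Complex.I • Pi.single j 1) (Complex.I • Pi.single j 1))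

/-- The real scalar product on `ℂᵏ`. -/
noncomputable def euclInner {k : ℕ} (b w : Cn k) : ℝ :=
  ∑ j, ((b j).re * (w j).re + (b j).im * (w j).im)

lemma hasDerivAt_profile (s : ℝ) : HasDerivAt profile (deriv profile s) s :=
  ((contDiff_profile.differentiable (by simp)) s).hasDerivAt

lemma continuous_deriv_profile : Continuous (deriv profile) :=
  contDiff_profile.continuous_deriv (by simp)

lemma deriv_profile_of_one_le {s : ℝ} (hs : 1 ≤ s) : deriv profile s = 0 := by
  have h : EqOn (deriv profile) 0 (closure (Ioi 1)) := by
    refine EqOn.closure (fun s hs => ?_) continuous_deriv_profile continuous_const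
    have h1 : profile =ᶠ[𝓝 s] fun _ => 0 := by
      filter_upwards [Ioi_mem_nhds hs] with s' hs'
      exact profile_of_one_le (le_of_lt hs')
    rw [h1.deriv_eq]; simp
  rw [closure_Ioi] at h
  exact h hs

lemma fderiv_euclSq_sub {k : ℕ} (x y w : Cn k) :
    HasFDerivAt (fun z => euclSq (z - x)) (fderiv ℝ (fun z => euclSq (z - x)) y) y ∧
      fderiv ℝ (fun z => euclSq (z - x)) y w = 2 * euclInner (y - x) w := by
  have hd : DifferentiableAt ℝ (fun z => euclSq (z - x)) y :=
    ((contDiff_euclSq.comp (contDiff_id.sub contDiff_const)).differentiable (by simp)) y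
  refine ⟨hd.hasFDerivAt, ?_⟩
  have h1 := (hd.hasFDerivAt.comp_hasDerivAt_of_eq (0 : ℝ)
    (((hasDerivAt_id (0 : ℝ)).smul_const w).const_add y) (by simp))
  have h2 : HasDerivAt (fun s : ℝ => euclSq (y + s • w - x)) (2 * euclInner (y - x) w) 0 := by
    have h3 : (fun s : ℝ => euclSq (y + s • w - x))
        = fun s => euclSq (y - x) + s * (2 * euclInner (y - x) w) + s ^ 2 * euclSq w := by
      funext s
      simp only [euclSq, euclInner, Finset.mul_sum, ← Finset.sum_add_distrib]
      refine Finset.sum_congr rfl fun j _ => ?_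
      simp
      ring
    rw [h3]
    have h4 := (((hasDerivAt_id (0 : ℝ)).mul_const (2 * euclInner (y - x) w)).const_add
      (euclSq (y - x))).add (((hasDerivAt_id (0 : ℝ)).pow 2).mul_const (euclSq w))
    exact h4.congr_deriv (by simp)
  simpa using h1.unique h2

lemma secondDeriv_profileInt {k : ℕ} (t : ℝ) (x y w : Cn k) :
    secondDeriv (fun z => profileInt (t * euclSq (z - x))) y w w
      = 4 * t ^ 2 * deriv profile (t * euclSq (y - x)) * euclInner (y - x) w ^ 2
        + 2 * t * profile (t * euclSq (y - x)) * euclSq w := by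
  have h1 : ∀ z, fderiv ℝ (fun z => profileInt (t * euclSq (z - x))) z w
      = profile (t * euclSq (z - x)) * (t * (2 * euclInner (z - x) w)) := fun z => by
    have := (hasDerivAt_profileInt (t * euclSq (z - x))).comp_hasFDerivAt z
      ((fderiv_euclSq_sub x z w).1.const_mul t)
    rw [HasFDerivAt.fderiv (f := fun z => profileInt (t * euclSq (z - x))) this,
      ← (fderiv_euclSq_sub x z w).2]
    simp
  have hlin : ∀ z, HasDerivAt (fun s : ℝ => euclInner (z + s • w - x) w) (euclSq w) 0 := by
    intro z
    have h3 : (fun s : ℝ => euclInner (z + s • w - x) w)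
        = fun s => euclInner (z - x) w + s * euclSq w := by
      funext s
      simp only [euclSq, euclInner, Finset.mul_sum, ← Finset.sum_add_distrib]
      refine Finset.sum_congr rfl fun j _ => ?_
      simp
      ring
    rw [h3]
    simpa using ((hasDerivAt_id (0 : ℝ)).mul_const (euclSq w)).const_add (euclInner (z - x) w)
  have hsq : HasDerivAt (fun s : ℝ => euclSq (y + s • w - x)) (2 * euclInner (y - x) w) 0 := by
    have := ((fderiv_euclSq_sub x y w).1.comp_hasDerivAt_of_eq (0 : ℝ)
      (((hasDerivAt_id (0 : ℝ)).smul_const w).const_add y) (by simp))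
    exact this.congr_deriv (by simp [(fderiv_euclSq_sub x y w).2])
  have hline : HasDerivAt
      (fun s : ℝ => profile (t * euclSq (y + s • w - x)) * (t * (2 * euclInner (y + s • w - x) w)))
      (4 * t ^ 2 * deriv profile (t * euclSq (y - x)) * euclInner (y - x) w ^ 2
        + 2 * t * profile (t * euclSq (y - x)) * euclSq w) 0 := by
    have h5 := (hasDerivAt_profile (t * euclSq (y - x))).comp_of_eq (0 : ℝ) (hsq.const_mul t)
      (by simp)
    have h6 := h5.mul (((hlin y).const_mul 2).const_mul t)
    refine h6.congr_deriv ?_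
    simp
    ring
  have hdiff : DifferentiableAt ℝ
      (fun z => fderiv ℝ (fun z => profileInt (t * euclSq (z - x))) z w) y := by
    have hc : ContDiff ℝ ∞ fun z => profileInt (t * euclSq (z - x)) :=
      contDiff_profileInt.comp (contDiff_const.mul
        (contDiff_euclSq.comp (contDiff_id.sub contDiff_const)))
    have := ((hc.fderiv_right (m := ∞) (by simp)).differentiable (by simp)) y
    fun_prop
  have h7 := hdiff.hasFDerivAt.comp_hasDerivAt_of_eq (0 : ℝ)
    (((hasDerivAt_id (0 : ℝ)).smul_const w).const_add y) (by simp)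
  rw [secondDeriv]
  simp only [h1] at h7 ⊢
  simpa using h7.unique hline

lemma lap_profileInt {k : ℕ} (t : ℝ) (x y : Cn k) :
    lap (fun z => profileInt (t * euclSq (z - x))) y
      = 4 * t * (k * profile (t * euclSq (y - x))
        + t * euclSq (y - x) * deriv profile (t * euclSq (y - x))) := by
  simp only [lap, secondDeriv_profileInt]
  have h1 : ∀ j : Fin k, euclInner (y - x) (Pi.single j 1) = ((y - x) j).re := fun j => by
    rw [euclInner, Finset.sum_eq_single j] <;> simp +contextual
  have h2 : ∀ j : Fin k, euclInner (y - x) (Complex.I • Pi.single j 1) = ((y - x) j).im :=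
    fun j => by
      rw [euclInner, Finset.sum_eq_single j] <;> simp +contextual
  have h3 : ∀ j : Fin k, euclSq (Pi.single j (1 : ℂ)) = 1 := fun j => by
    rw [euclSq, Finset.sum_eq_single j] <;> simp +contextual
  have h4 : ∀ j : Fin k, euclSq (Complex.I • Pi.single j (1 : ℂ)) = 1 := fun j => by
    rw [euclSq_smul, h3]; simp
  simp only [h1, h2, h3, h4]
  have h5 : ∀ j : Fin k, (4 * t ^ 2 * deriv profile (t * euclSq (y - x)) * ((y - x) j).re ^ 2
        + 2 * t * profile (t * euclSq (y - x)) * 1)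
      + (4 * t ^ 2 * deriv profile (t * euclSq (y - x)) * ((y - x) j).im ^ 2
        + 2 * t * profile (t * euclSq (y - x)) * 1)
      = 4 * t ^ 2 * deriv profile (t * euclSq (y - x)) *
        (((y - x) j).re ^ 2 + ((y - x) j).im ^ 2) + 4 * t * profile (t * euclSq (y - x)) :=
    fun j => by ring
  rw [Finset.sum_congr rfl fun j _ => h5 j, Finset.sum_add_distrib, ← Finset.mul_sum]
  change 4 * t ^ 2 * deriv profile (t * euclSq (y - x)) * euclSq (y - x) + _ = _
  simp
  ring

/-- The derivative of the kernels with respect to the parameter. -/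
noncomputable def kernDeriv {k : ℕ} (t : ℝ) (b : Cn k) : ℝ :=
  t ^ k / t * (k * profile (t * euclSq b) + t * euclSq b * deriv profile (t * euclSq b))

lemma hasDerivAt_kern {k : ℕ} {t : ℝ} (ht : t ≠ 0) (b : Cn k) :
    HasDerivAt (fun t => kern t b) (kernDeriv t b) t := by
  have h1 := (hasDerivAt_profile (t * euclSq b)).comp t ((hasDerivAt_id t).mul_const (euclSq b))
  have h2 := (hasDerivAt_pow k t).mul h1
  refine h2.congr_deriv ?_
  have h3 : (k : ℝ) * t ^ (k - 1) = k * (t ^ k / t) := by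
    rcases k with _ | k
    · simp
    · rw [pow_succ, mul_div_assoc, div_self ht]; simp
  rw [h3, kernDeriv]
  simp
  field_simp

/-- The change of the kernels with the parameter is a Laplacian: this is what makes the averages of
a weakly harmonic function independent of the radius. -/
lemma kernDeriv_eq_lap {k : ℕ} {t : ℝ} (ht : t ≠ 0) (x y : Cn k) :
    kernDeriv t (y - x)
      = t ^ k / (4 * t ^ 2) * lap (fun z => profileInt (t * euclSq (z - x))) y := by
  rw [lap_profileInt, kernDeriv]
  field_simp

lemma kernDeriv_eq_zero {k : ℕ} {t r : ℝ} (ht : 0 ≤ t) (hr : 0 ≤ r) (htr : 1 ≤ t * r ^ 2)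
    {b : Cn k} (hb : r ≤ ‖b‖) : kernDeriv t b = 0 := by
  have h := one_le_mul_euclSq ht hr htr hb
  rw [kernDeriv, profile_of_one_le h, deriv_profile_of_one_le h]
  simp

/-- The averages of a weakly harmonic function over balls do not depend on the radius. -/
lemma kernAvg_eq_of_weaklyHarmonic {k : ℕ} {h : Cn k → ℝ} {U : Set (Cn k)}
    (hh : LocallyIntegrableOn h U)
    (hharm : ∀ σ : Cn k → ℝ, ContDiff ℝ ∞ σ → HasCompactSupport σ → tsupport σ ⊆ U →
      ∫ z in U, h z * lap σ z = 0) {x : Cn k} {r : ℝ} (hr : 0 < r)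
    (hsub : Metric.closedBall x r ⊆ U) {s t : ℝ} (hs : 1 < s * r ^ 2) (ht : 1 < t * r ^ 2) :
    kernAvg s h x = kernAvg t h x := by
  have hiff : ∀ {t : ℝ}, 1 < t * r ^ 2 ↔ t ∈ Ioi ((r ^ 2)⁻¹) := fun {t} => by
    rw [mem_Ioi, inv_lt_iff_one_lt_mul₀ (by positivity)]
  have hpos : ∀ {t : ℝ}, t ∈ Ioi ((r ^ 2)⁻¹) → 0 < t := fun ht =>
    lt_trans (by positivity) (mem_Ioi.1 ht)
  set F := (Metric.closedBall x r).indicator h with hF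
  have hFi : Integrable F :=
    (integrable_indicator_iff Metric.isClosed_closedBall.measurableSet).2
      (hh.integrableOn_compact_subset hsub (isCompact_closedBall _ _))
  have havg : ∀ t ∈ Ioi ((r ^ 2)⁻¹), kernAvg t h x = ∫ z, kern t (z - x) * F z := fun t ht =>
    integral_congr_ae (ae_of_all _ fun z =>
      kern_sub_mul_eq_indicator (hpos ht).le hr.le (hiff.2 ht).le subset_rfl h z)
  have hcD : ContinuousOn (fun q : ℝ × Cn k => kernDeriv q.1 q.2) (Ioi 0 ×ˢ univ) := by
    have h1 : Continuous (profile : ℝ → ℝ) := contDiff_profile.continuous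
    have h2 := continuous_deriv_profile
    have h3 : Continuous (euclSq (k := k)) := contDiff_euclSq.continuous
    unfold kernDeriv
    refine ContinuousOn.mul (ContinuousOn.div (by fun_prop) (by fun_prop)
      fun q hq => (hq.1 : 0 < q.1).ne') (by fun_prop)
  have hzero : ∀ t ∈ Ioi ((r ^ 2)⁻¹), ∫ z, kernDeriv t (z - x) * F z = 0 := by
    intro t ht
    have ht0 := hpos ht
    have hoff : ∀ z ∉ Metric.closedBall x r, r ≤ ‖z - x‖ := fun z hz => by
      rw [Metric.mem_closedBall, dist_eq_norm, not_le] at hz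
      exact hz.le
    have hz1 : ∀ z, kernDeriv t (z - x) * F z = kernDeriv t (z - x) * h z := fun z => by
      by_cases hz : z ∈ Metric.closedBall x r
      · rw [hF, indicator_of_mem hz]
      · rw [kernDeriv_eq_zero ht0.le hr.le (hiff.2 ht).le (hoff z hz), zero_mul, zero_mul]
    simp only [hz1]
    rw [← setIntegral_eq_integral_of_forall_compl_eq_zero (s := U)]
    · have hsupp : ∀ z ∉ Metric.closedBall x r, profileInt (t * euclSq (z - x)) = 0 := fun z hz =>
        profileInt_of_one_le (one_le_mul_euclSq ht0.le hr.le (hiff.2 ht).le (hoff z hz))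
      have h1 := hharm (fun z => profileInt (t * euclSq (z - x)))
        (contDiff_profileInt.comp (contDiff_const.mul
          (contDiff_euclSq.comp (contDiff_id.sub contDiff_const))))
        (HasCompactSupport.intro (isCompact_closedBall x r) hsupp)
        ((closure_minimal (Function.support_subset_iff'.2 hsupp)
          Metric.isClosed_closedBall).trans hsub)
      simp only [kernDeriv_eq_lap ht0.ne']
      calc ∫ z in U, t ^ k / (4 * t ^ 2) * lap (fun z => profileInt (t * euclSq (z - x))) z * h z
          = ∫ z in U, t ^ k / (4 * t ^ 2) *
            (h z * lap (fun z => profileInt (t * euclSq (z - x))) z) := by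
              refine integral_congr_ae (ae_of_all _ fun z => ?_)
              simp only; ring
        _ = 0 := by rw [integral_const_mul, h1, mul_zero]
    · intro z hz
      rw [kernDeriv_eq_zero ht0.le hr.le (hiff.2 ht).le (hoff z fun h => hz (hsub h)), zero_mul]
  have hderiv : ∀ t ∈ Ioi ((r ^ 2)⁻¹),
      HasDerivAt (fun t => ∫ z, kern t (z - x) * F z) 0 t := by
    intro t₀ ht₀
    obtain ⟨ε, hε, hball⟩ := Metric.isOpen_iff.1 isOpen_Ioi t₀ ht₀
    have hsub' : Metric.closedBall t₀ (ε / 2) ⊆ Ioi ((r ^ 2)⁻¹) :=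
      (Metric.closedBall_subset_ball (by linarith)).trans hball
    obtain ⟨C, hC⟩ := ((isCompact_closedBall t₀ (ε / 2)).prod
      (isCompact_closedBall (0 : Cn k) r)).exists_bound_of_continuousOn
      (hcD.mono (prod_mono (fun t ht => hpos (hsub' ht)) (subset_univ _)))
    have hcont : ∀ t : ℝ, Continuous fun z => kern t (z - x) := fun t =>
      (continuous_kern t).comp (continuous_id.sub continuous_const)
    have hcontD : Continuous fun z => kernDeriv t₀ (z - x) :=
      hcD.comp_continuous (f := fun z => (t₀, z - x)) (by fun_prop) fun z => ⟨hpos ht₀, trivial⟩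
    have := hasDerivAt_integral_of_dominated_loc_of_deriv_le
      (F := fun t z => kern t (z - x) * F z) (F' := fun t z => kernDeriv t (z - x) * F z)
      (bound := fun z => C * ‖F z‖) (μ := volume)
      (Metric.closedBall_mem_nhds t₀ (half_pos hε))
      (Eventually.of_forall fun t => (hcont t).aestronglyMeasurable.mul hFi.aestronglyMeasurable)
      (integrable_kern_mul_of_integrable (hpos ht₀) hFi x)
      (hcontD.aestronglyMeasurable.mul hFi.aestronglyMeasurable)
      (ae_of_all _ fun z t ht => by
        by_cases hz : z ∈ Metric.closedBall x r
        · rw [norm_mul]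
          refine mul_le_mul_of_nonneg_right (hC (t, z - x) ⟨ht, ?_⟩) (norm_nonneg _)
          simpa [dist_eq_norm] using hz
        · simp [hF, indicator_of_notMem hz])
      (hFi.norm.const_mul C)
      (ae_of_all _ fun z t ht => (hasDerivAt_kern (hpos (hsub' ht)).ne' (z - x)).mul_const (F z))
    rw [← hzero t₀ ht₀]
    exact this.2
  rw [havg s (hiff.1 hs), havg t (hiff.1 ht)]
  exact isOpen_Ioi.is_const_of_deriv_eq_zero isPreconnected_Ioi
    (fun t ht => (hderiv t ht).differentiableAt.differentiableWithinAt)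
    (fun t ht => (hderiv t ht).deriv) (hiff.1 hs) (hiff.1 ht)

/-! ### A constant form that turns `ddᶜ` into the Laplacian -/

/-- The real coordinates of a vector of `ℂ^(d+1)`, except for the `j`-th complex coordinate. -/
noncomputable def otherCoords {d : ℕ} (j : Fin (d + 1)) : Cn (d + 1) →ₗ[ℝ] (Fin (2 * d) → ℝ) :=
  LinearMap.pi fun b =>
    (if (b : ℕ) % 2 = 0 then Complex.reLm else Complex.imLm) ∘ₗ
      LinearMap.proj (j.succAbove ⟨(b : ℕ) / 2, by omega⟩)

lemma otherCoords_apply {d : ℕ} (j : Fin (d + 1)) (v : Cn (d + 1)) (b : Fin (2 * d)) :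
    otherCoords j v b = if (b : ℕ) % 2 = 0 then (v (j.succAbove ⟨(b : ℕ) / 2, by omega⟩)).re
      else (v (j.succAbove ⟨(b : ℕ) / 2, by omega⟩)).im := by
  rw [otherCoords, LinearMap.pi_apply]
  split_ifs <;> rfl

/-- The volume form of the complex hyperplane orthogonal to the `j`-th coordinate direction, pulled
back to `ℂ^(d+1)`. -/
noncomputable def hyperplaneVol {d : ℕ} (j : Fin (d + 1)) : Cn (d + 1) [⋀^Fin (2 * d)]→L[ℝ] ℝ :=
  { Matrix.detRowAlternating.compLinearMap (otherCoords j) with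
    cont := by
      change Continuous fun v : Fin (2 * d) → Cn (d + 1) =>
        Matrix.det (Matrix.of fun a => otherCoords j (v a))
      refine Continuous.matrix_det (continuous_matrix fun a b => ?_)
      have h1 : Continuous fun w : Cn (d + 1) => otherCoords j w b :=
        (continuous_apply b).comp (otherCoords j).continuous_of_finiteDimensional
      exact h1.comp (continuous_apply a) }

lemma hyperplaneVol_apply {d : ℕ} (j : Fin (d + 1)) (v : Fin (2 * d) → Cn (d + 1)) :
    hyperplaneVol j v = Matrix.det (Matrix.of fun a => otherCoords j (v a)) := rfl

lemma hyperplaneVol_eq_zero {d : ℕ} {j : Fin (d + 1)} {v : Fin (2 * d) → Cn (d + 1)}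
    (a : Fin (2 * d)) (h : otherCoords j (v a) = 0) : hyperplaneVol j v = 0 := by
  rw [hyperplaneVol_apply]
  exact Matrix.det_eq_zero_of_row_eq_zero a fun b => congrFun h b

lemma stdBasis_apply {k : ℕ} (l : Fin (2 * k)) :
    stdBasis k l = (if (l : ℕ) % 2 = 0 then (1 : ℂ) else Complex.I) •
      Pi.single ⟨(l : ℕ) / 2, by omega⟩ (1 : ℂ) := rfl

lemma otherCoords_stdBasis_self {d : ℕ} (j : Fin (d + 1)) (l : Fin (2 * (d + 1)))
    (hl : (l : ℕ) / 2 = j) : otherCoords j (stdBasis (d + 1) l) = 0 := by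
  funext b
  have h : (⟨(l : ℕ) / 2, by omega⟩ : Fin (d + 1)) = j := Fin.ext hl
  rw [otherCoords_apply, stdBasis_apply, h]
  simp

lemma hyperplaneVol_stdBasis {d : ℕ} (j : Fin (d + 1)) (v : Fin (2 * d) → Cn (d + 1))
    (hv : ∀ a, v a = (if (a : ℕ) % 2 = 0 then (1 : ℂ) else Complex.I) •
      Pi.single (j.succAbove ⟨(a : ℕ) / 2, by omega⟩) (1 : ℂ)) : hyperplaneVol j v = 1 := by
  rw [hyperplaneVol_apply]
  convert Matrix.det_one (R := ℝ) (n := Fin (2 * d))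
  ext a b
  rw [Matrix.of_apply, hv, otherCoords_apply, Matrix.one_apply]
  by_cases hab : (a : ℕ) / 2 = (b : ℕ) / 2
  · have h1 : (⟨(a : ℕ) / 2, by omega⟩ : Fin d) = ⟨(b : ℕ) / 2, by omega⟩ := Fin.ext hab
    rw [h1]
    by_cases h2 : a = b
    · subst h2
      rw [if_pos rfl]
      split_ifs <;> simp
    · have h3 : (a : ℕ) ≠ b := fun h => h2 (Fin.ext h)
      rw [if_neg h2]
      split_ifs <;> first | omega | simp
  · have h1 : j.succAbove (⟨(b : ℕ) / 2, by omega⟩ : Fin d)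
        ≠ j.succAbove (⟨(a : ℕ) / 2, by omega⟩ : Fin d) := by
      rw [Ne, Fin.succAbove_right_inj, Fin.mk.injEq]
      exact fun h => hab h.symm
    have h2 : a ≠ b := fun h => hab (by rw [h])
    rw [if_neg h2]
    simp [Pi.single_eq_of_ne h1]

/-- The form `∑ⱼ βⱼ`, where `βⱼ` is the volume form of the `j`-th coordinate hyperplane. -/
noncomputable def hyperplaneSum (d : ℕ) : Cn (d + 1) [⋀^Fin (2 * d)]→L[ℝ] ℝ :=
  ∑ j : Fin (d + 1), hyperplaneVol j

/-- Of the terms of `ddᶜ (σ βⱼ)` on the standard basis, only those survive in which both basis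
vectors of the `j`-th complex coordinate have been removed. -/
lemma sum_secondDeriv_hyperplaneVol {d : ℕ} (σ : Cn (d + 1) → ℝ) (y : Cn (d + 1))
    (j : Fin (d + 1)) (v : Fin (2 * d + 2) → Cn (d + 1)) (hv : v = stdBasis (d + 1)) :
    ∑ l : Fin (2 * d + 2), (-1 : ℝ) ^ (l : ℕ) * ∑ i : Fin (2 * d + 1), (-1) ^ (i : ℕ) *
      (secondDeriv σ y (v l) (-Complex.I • v (l.succAbove i)) *
        hyperplaneVol j (i.removeNth (l.removeNth v)))
    = secondDeriv σ y (Pi.single j 1) (Pi.single j 1) +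
      secondDeriv σ y (Complex.I • Pi.single j 1) (Complex.I • Pi.single j 1) := by
  have hj := j.isLt
  set l₀ : Fin (2 * d + 2) := ⟨2 * j, by omega⟩ with hl₀
  set l₁ : Fin (2 * d + 2) := ⟨2 * j + 1, by omega⟩ with hl₁
  set i₀ : Fin (2 * d + 1) := ⟨2 * j, by omega⟩ with hi₀
  have hne : l₀ ≠ l₁ := by simp [hl₀, hl₁]
  have hs0 : l₀.succAbove i₀ = l₁ := by
    rw [Fin.succAbove_of_le_castSucc _ _ (by simp [hl₀, hi₀])]
    ext; simp [hl₁, hi₀]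
  have hs1 : l₁.succAbove i₀ = l₀ := by
    rw [Fin.succAbove_of_castSucc_lt _ _ (by simp [Fin.lt_def, hl₁, hi₀])]
    ext; simp [hl₀, hi₀]
  have hrem : ∀ (l : Fin (2 * d + 2)) (i : Fin (2 * d + 1)) a, i.removeNth (l.removeNth v) a
      = v (l.succAbove (i.succAbove a)) := fun _ _ _ => rfl
  have hzero : ∀ (l : Fin (2 * d + 2)) (i : Fin (2 * d + 1)) (m : Fin (2 * d + 2)),
      (m : ℕ) / 2 = j → m ≠ l → m ≠ l.succAbove i →
      hyperplaneVol j (i.removeNth (l.removeNth v)) = 0 := by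
    intro l i m hm h1 h2
    obtain ⟨i', hi'⟩ := Fin.exists_succAbove_eq h1
    obtain ⟨a, ha⟩ := Fin.exists_succAbove_eq (x := i') (y := i)
      (fun h => h2 (by rw [← hi', h]))
    refine hyperplaneVol_eq_zero a ?_
    rw [hrem, ha, hi', hv]
    exact otherCoords_stdBasis_self j m hm
  have hd0 : (l₀ : ℕ) / 2 = j := by simp [hl₀]
  have hd1 : (l₁ : ℕ) / 2 = j := by simp only [hl₁]; omega
  have hv0 : v l₀ = Pi.single j 1 := by
    rw [hv]
    refine (stdBasis_apply (k := d + 1) l₀).trans ?_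
    rw [if_pos (by simp [hl₀]), one_smul]
    congr 1
    exact Fin.ext hd0
  have hv1 : v l₁ = Complex.I • Pi.single j 1 := by
    rw [hv]
    refine (stdBasis_apply (k := d + 1) l₁).trans ?_
    rw [if_neg (by simp only [hl₁]; omega)]
    congr 2
    exact Fin.ext hd1
  have hone : ∀ l, l = l₀ ∨ l = l₁ → hyperplaneVol j (i₀.removeNth (l.removeNth v)) = 1 := by
    intro l hl
    refine hyperplaneVol_stdBasis j _ fun a => ?_
    have hval : ((l.succAbove (i₀.succAbove a) : Fin (2 * d + 2)) : ℕ)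
        = if (a : ℕ) < 2 * j then (a : ℕ) else a + 2 := by
      rcases hl with rfl | rfl <;>
      · simp only [Fin.succAbove, Fin.lt_def, hl₀, hl₁, hi₀, Fin.val_castSucc]
        split_ifs <;> simp_all <;> omega
    rw [hrem, hv]
    refine (stdBasis_apply (k := d + 1) _).trans ?_
    have hpar : ((l.succAbove (i₀.succAbove a) : Fin (2 * d + 2)) : ℕ) % 2 = (a : ℕ) % 2 := by
      rw [hval]; split_ifs <;> omega
    rw [hpar]
    have hdiv : ((l.succAbove (i₀.succAbove a) : Fin (2 * d + 2)) : ℕ) / 2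
        = (j.succAbove (⟨(a : ℕ) / 2, by omega⟩ : Fin d) : ℕ) := by
      have hj' : ((j.succAbove (⟨(a : ℕ) / 2, by omega⟩ : Fin d) : Fin (d + 1)) : ℕ)
          = if (a : ℕ) / 2 < j then (a : ℕ) / 2 else (a : ℕ) / 2 + 1 := by
        simp only [Fin.succAbove, Fin.lt_def, Fin.val_castSucc]
        split_ifs <;> rfl
      rw [hval, hj']
      split_ifs <;> omega
    congr 2
    exact Fin.ext hdiv
  rw [Fintype.sum_eq_add l₀ l₁ hne]
  · rw [Finset.sum_eq_single i₀, Finset.sum_eq_single i₀, hs0, hs1, hv0, hv1, hone _ (Or.inl rfl),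
      hone _ (Or.inr rfl)]
    · have h1 : secondDeriv σ y (Complex.I • Pi.single j 1) (-Complex.I • Pi.single j 1)
          = -secondDeriv σ y (Complex.I • Pi.single j 1) (Complex.I • Pi.single j 1) := by
        simp [secondDeriv]
      rw [h1, smul_smul]
      simp [hl₀, hl₁, hi₀, pow_succ]
    · intro i _ hi
      rw [hzero l₁ i l₀ hd0 hne fun h => hi ?_, mul_zero, mul_zero]
      exact Fin.succAbove_right_injective (h.symm.trans hs1.symm)
    · simp
    · intro i _ hi
      rw [hzero l₀ i l₁ hd1 hne.symm fun h => hi ?_, mul_zero, mul_zero]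
      exact Fin.succAbove_right_injective (h.symm.trans hs0.symm)
    · simp
  · rintro l ⟨h0, h1⟩
    rw [Finset.sum_eq_zero, mul_zero]
    intro i _
    by_cases h : l.succAbove i = l₀
    · rw [hzero l i l₁ hd1 (Ne.symm h1) (by rw [h]; exact hne.symm), mul_zero, mul_zero]
    · rw [hzero l i l₀ hd0 (Ne.symm h0) (Ne.symm h), mul_zero, mul_zero]

lemma ddcForm_smul_hyperplaneSum {d : ℕ} {σ : Cn (d + 1) → ℝ}
    {α : Cn (d + 1) → Cn (d + 1) [⋀^Fin (2 * d)]→L[ℝ] ℝ} {y : Cn (d + 1)}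
    (hα : α =ᶠ[𝓝 y] fun z => σ z • hyperplaneSum d) (hσ : ContDiffAt ℝ 2 σ y) :
    ddcForm α y (stdBasis (d + 1)) = lap σ y := by
  refine (ddcForm_smul_const_apply hα hσ (stdBasis (d + 1))).trans ?_
  have h1 : ∀ u, hyperplaneSum d u = ∑ j, hyperplaneVol j u := fun u => by
    simp [hyperplaneSum, ContinuousAlternatingMap.sum_apply]
  simp only [h1, Finset.mul_sum]
  rw [lap, ← Finset.sum_congr rfl fun j _ =>
    sum_secondDeriv_hyperplaneVol σ y j (stdBasis (d + 1)) rfl]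
  simp only [Finset.mul_sum]
  conv_rhs => rw [Finset.sum_comm]
  refine Finset.sum_congr rfl fun l _ => ?_
  rw [Finset.sum_comm]

/-! ### Test forms supported in a chart -/

/-- A family of alternating forms on a finite-dimensional space is smooth if its values on all
constant vectors are. -/
lemma contDiffAt_of_apply {E F : Type*} [NormedAddCommGroup E] [NormedSpace ℝ E]
    [NormedAddCommGroup F] [NormedSpace ℝ F] [FiniteDimensional ℝ F] {m : ℕ}
    {f : E → F [⋀^Fin m]→L[ℝ] ℝ} {y : E} (hf : ∀ v, ContDiffAt ℝ ∞ (fun z => f z v) y) :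
    ContDiffAt ℝ ∞ f y := by
  set b := Module.finBasis ℝ F
  set Φ : (F [⋀^Fin m]→L[ℝ] ℝ) →ₗ[ℝ] ((Fin m → Fin (Module.finrank ℝ F)) → ℝ) :=
    { toFun := fun α s => α fun i => b (s i)
      map_add' := fun _ _ => rfl
      map_smul' := fun _ _ => rfl } with hΦ
  have hker : Φ.ker = ⊥ := by
    refine LinearMap.ker_eq_bot.2 fun α α' h => ?_
    refine ContinuousAlternatingMap.toAlternatingMap_injective
      (Module.Basis.ext_alternating b fun s _ => congrFun h s)
  obtain ⟨L, hL⟩ := LinearMap.exists_leftInverse_of_injective Φ hker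
  have h1 : f = fun z => L.toContinuousLinearMap (Φ (f z)) := by
    funext z
    exact (LinearMap.congr_fun hL (f z)).symm
  rw [h1]
  refine (L.toContinuousLinearMap.contDiff.contDiffAt).comp y ?_
  exact contDiffAt_pi.2 fun s => hf _

section TestForms

variable {k : ℕ} {X : Type*} [TopologicalSpace X] [ChartedSpace (Cn k) X]

open Classical in
/-- The form on the manifold that is `σ β`, for a function `σ` and a constant form `β`, in the chart
`e`, and vanishes outside the domain of the chart. -/
noncomputable def chartForm {m : ℕ} (e : OpenPartialHomeomorph X (Cn k)) (σ : Cn k → ℝ)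
    (β : Cn k [⋀^Fin m]→L[ℝ] ℝ) : RawForm k X m := fun x =>
  if x ∈ e.source then
    ContinuousAlternatingMap.compContinuousLinearMap (σ (e x) • β)
      ((mfderiv 𝓘(ℂ, Cn k) 𝓘(ℂ, Cn k) e x).restrictScalars ℝ)
  else 0

lemma chartForm_eq_zero {m : ℕ} {e : OpenPartialHomeomorph X (Cn k)} {σ : Cn k → ℝ}
    (β : Cn k [⋀^Fin m]→L[ℝ] ℝ) {x : X} (hx : x ∉ e.symm '' tsupport σ) :
    chartForm e σ β x = 0 := by
  rw [chartForm]
  split_ifs with h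
  · have h1 : σ (e x) = 0 := by
      by_contra hne
      exact hx ⟨e x, subset_tsupport _ hne, e.left_inv h⟩
    rw [h1, zero_smul]
    rfl
  · rfl

variable [IsManifold 𝓘(ℂ, Cn k) ω X]

lemma mfderiv_chart_comp_symm {e e' : OpenPartialHomeomorph X (Cn k)} (he : e ∈ atlas (Cn k) X)
    (he' : e' ∈ atlas (Cn k) X) {y : Cn k} (hy : y ∈ e'.target) (hye : e'.symm y ∈ e.source) :
    ContDiffAt ℝ ∞ (fun z => e (e'.symm z)) y ∧
      ∀ v : Cn k, mfderiv 𝓘(ℂ, Cn k) 𝓘(ℂ, Cn k) e (e'.symm y)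
        (mfderiv 𝓘(ℂ, Cn k) 𝓘(ℂ, Cn k) e'.symm y v) = fderiv ℝ (fun z => e (e'.symm z)) y v := by
  have h1 : ContMDiffAt 𝓘(ℂ, Cn k) 𝓘(ℂ, Cn k) ω e (e'.symm y) :=
    contMDiffAt_of_mem_maximalAtlas (IsManifold.subset_maximalAtlas he) hye
  have h2 : ContMDiffAt 𝓘(ℂ, Cn k) 𝓘(ℂ, Cn k) ω e'.symm y :=
    contMDiffAt_symm_of_mem_maximalAtlas (IsManifold.subset_maximalAtlas he') hy
  have h3 : ContDiffAt ℂ ω (fun z => e (e'.symm z)) y := contMDiffAt_iff_contDiffAt.1 (h1.comp y h2)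
  refine ⟨(h3.restrict_scalars ℝ).of_le le_top, fun v => ?_⟩
  have h4 := mfderiv_comp y (h1.mdifferentiableAt (by simp)) (h2.mdifferentiableAt (by simp))
  rw [(h3.differentiableAt (by simp)).fderiv_restrictScalars ℝ]
  have h5 : fderiv ℂ (fun z => e (e'.symm z)) y = _ := mfderiv_eq_fderiv.symm.trans h4
  rw [h5]
  rfl

lemma rawInChart_chartForm_apply {m : ℕ} {e e' : OpenPartialHomeomorph X (Cn k)}
    (he : e ∈ atlas (Cn k) X) (he' : e' ∈ atlas (Cn k) X) (σ : Cn k → ℝ)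
    (β : Cn k [⋀^Fin m]→L[ℝ] ℝ) {y : Cn k} (hy : y ∈ e'.target) (hye : e'.symm y ∈ e.source)
    (v : Fin m → Cn k) :
    rawInChart (chartForm e σ β) e' y v = σ (e (e'.symm y)) *
      β (fun i => fderiv ℝ (fun z => e (e'.symm z)) y (v i)) := by
  rw [rawInChart, chartForm, if_pos hye]
  change σ (e (e'.symm y)) * β (fun i => mfderiv 𝓘(ℂ, Cn k) 𝓘(ℂ, Cn k) e (e'.symm y)
        (mfderiv 𝓘(ℂ, Cn k) 𝓘(ℂ, Cn k) e'.symm y (v i))) = _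
  simp only [(mfderiv_chart_comp_symm he he' hy hye).2]

lemma rawInChart_chartForm_self {m : ℕ} {e : OpenPartialHomeomorph X (Cn k)}
    (he : e ∈ atlas (Cn k) X) (σ : Cn k → ℝ)
    (β : Cn k [⋀^Fin m]→L[ℝ] ℝ) {y : Cn k} (hy : y ∈ e.target) :
    rawInChart (chartForm e σ β) e y = σ y • β := by
  ext v
  rw [rawInChart_chartForm_apply he he σ β hy (e.map_target hy), e.right_inv hy]
  have h1 : (fun z => e (e.symm z)) =ᶠ[𝓝 y] id := by
    filter_upwards [e.open_target.mem_nhds hy] with z hz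
    exact e.right_inv hz
  rw [h1.fderiv_eq, fderiv_id]
  rfl

lemma chartForm_mem_smoothForm [T2Space X] {m : ℕ} {e : OpenPartialHomeomorph X (Cn k)}
    (he : e ∈ atlas (Cn k) X) {σ : Cn k → ℝ} (hσ : ContDiff ℝ ∞ σ) (hc : HasCompactSupport σ)
    (hsub : tsupport σ ⊆ e.target) (β : Cn k [⋀^Fin m]→L[ℝ] ℝ) :
    chartForm e σ β ∈ SmoothForm k X m := by
  intro e' he' y hy
  refine ContDiffAt.contDiffWithinAt ?_
  by_cases hye : e'.symm y ∈ e.source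
  · refine contDiffAt_of_apply fun v => ?_
    obtain ⟨hτ, -⟩ := mfderiv_chart_comp_symm he he' hy hye
    have hev : (fun z => rawInChart (chartForm e σ β) e' z v) =ᶠ[𝓝 y]
        fun z => σ (e (e'.symm z)) * β (fun i => fderiv ℝ (fun z => e (e'.symm z)) z (v i)) := by
      filter_upwards [e'.open_target.mem_nhds hy, (e'.continuousAt_symm hy).preimage_mem_nhds
        (e.open_source.mem_nhds hye)] with z hz hze
      exact rawInChart_chartForm_apply he he' σ β hz hze v
    refine ContDiffAt.congr_of_eventuallyEq ?_ hev
    refine (hσ.contDiffAt.comp y hτ).mul ?_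
    have h1 : ContDiffAt ℝ ∞ (fun z i => fderiv ℝ (fun z => e (e'.symm z)) z (v i)) y :=
      contDiffAt_pi.2 fun i => (hτ.fderiv_right (m := ∞) (by simp)).clm_apply contDiffAt_const
    exact (β.toContinuousMultilinearMap.contDiff.contDiffAt).comp y h1
  · have hK : IsCompact (e.symm '' tsupport σ) :=
      hc.isCompact.image_of_continuousOn (e.continuousOn_symm.mono hsub)
    have hyK : e'.symm y ∈ (e.symm '' tsupport σ)ᶜ := by
      rintro ⟨z, hz, hzy⟩
      exact hye (hzy ▸ e.map_target (hsub hz))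
    refine (contDiffAt_const (c := (0 : Cn k [⋀^Fin m]→L[ℝ] ℝ))).congr_of_eventuallyEq ?_
    filter_upwards [(e'.continuousAt_symm hy).preimage_mem_nhds
      (hK.isClosed.isOpen_compl.mem_nhds hyK)] with z hz
    rw [rawInChart, chartForm_eq_zero β hz]
    rfl

end TestForms

/-! ### Differences of representations are weakly harmonic -/

lemma secondDeriv_eq_zero {k : ℕ} {σ : Cn k → ℝ} {y : Cn k} (hy : y ∉ tsupport σ) (u w : Cn k) :
    secondDeriv σ y u w = 0 := by
  have h1 : σ =ᶠ[𝓝 y] fun _ => 0 := notMem_tsupport_iff_eventuallyEq.1 hy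
  have h2 : (fun z => fderiv ℝ σ z w) =ᶠ[𝓝 y] fun _ => 0 := by
    filter_upwards [h1.eventuallyEq_nhds] with z hz
    rw [hz.fderiv_eq]; simp
  rw [secondDeriv, h2.fderiv_eq]; simp

lemma lap_eq_zero {k : ℕ} {σ : Cn k → ℝ} {y : Cn k} (hy : y ∉ tsupport σ) : lap σ y = 0 := by
  simp [lap, secondDeriv_eq_zero hy]

lemma continuous_lap {k : ℕ} {σ : Cn k → ℝ} (hσ : ContDiff ℝ ∞ σ) : Continuous (lap σ) := by
  have h : ∀ u w, Continuous fun y => secondDeriv σ y u w := fun u w => by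
    have h1 : ContDiff ℝ ∞ fun z => fderiv ℝ σ z w :=
      (hσ.fderiv_right (m := ∞) (by simp)).clm_apply contDiff_const
    exact (h1.continuous_fderiv (by simp)).clm_apply continuous_const
  exact continuous_finsetSum _ fun j _ => (h _ _).add (h _ _)

/-- The equation `T = Ω + ddᶜ (u⁺ - u⁻)` of currents determines the Laplacian of `u⁺ - u⁻` in each
chart. -/
lemma EqAddDdc.setIntegral_mul_lap {d : ℕ} {X : Type*} [TopologicalSpace X] [T2Space X]
    [ChartedSpace (Cn (d + 1)) X] [IsManifold 𝓘(ℂ, Cn (d + 1)) ω X] {T : Current11 d X}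
    {Ω : SmoothForm (d + 1) X 2} {up um vp vm : X → EReal} (hu : EqAddDdc T Ω up um)
    (hv : EqAddDdc T Ω vp vm) {e : OpenPartialHomeomorph X (Cn (d + 1))}
    (he : e ∈ atlas (Cn (d + 1)) X)
    (hiu : LocallyIntegrableOn (fun y => (up (e.symm y)).toReal - (um (e.symm y)).toReal) e.target)
    (hiv : LocallyIntegrableOn (fun y => (vp (e.symm y)).toReal - (vm (e.symm y)).toReal) e.target)
    {σ : Cn (d + 1) → ℝ} (hσ : ContDiff ℝ ∞ σ) (hc : HasCompactSupport σ)
    (hsub : tsupport σ ⊆ e.target) :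
    ∫ y in e.target, (((up (e.symm y)).toReal - (um (e.symm y)).toReal) -
      ((vp (e.symm y)).toReal - (vm (e.symm y)).toReal)) * lap σ y = 0 := by
  set ψ : SmoothForm (d + 1) X (2 * d) :=
    ⟨chartForm e σ (hyperplaneSum d), chartForm_mem_smoothForm he hσ hc hsub _⟩ with hψ
  have hsupp : SupportedIn ψ e (tsupport σ) := fun x hx => chartForm_eq_zero _ hx
  have hψe : ∀ y ∈ e.target, inChart ψ e y = σ y • hyperplaneSum d := fun y hy =>
    rawInChart_chartForm_self he σ _ hy
  have hddc : ∀ y ∈ e.target, ddcForm (inChart ψ e) y (stdBasis (d + 1)) = lap σ y := by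
    intro y hy
    refine ddcForm_smul_hyperplaneSum ?_ (hσ.contDiffAt.of_le ENat.LEInfty.out)
    filter_upwards [e.open_target.mem_nhds hy] with z hz
    exact hψe z hz
  set A : Cn (d + 1) → ℝ := fun y =>
    wedgeTwo (inChart Ω e y) (σ y • hyperplaneSum d) (stdBasis (d + 1)) with hA
  have hAint : IntegrableOn A e.target := by
    have hcont : ContinuousOn A e.target := by
      have h1 : ∀ w, ContinuousOn (fun y => inChart Ω e y w) e.target := fun w =>
        (ContinuousAlternatingMap.apply ℝ (Cn (d + 1)) ℝ w).continuous.comp_continuousOn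
          ((Ω.2 e he).continuousOn)
      refine continuousOn_const.mul (continuousOn_finsetSum _ fun τ _ => ?_)
      exact (continuousOn_const.mul (h1 _)).mul
        ((hσ.continuous.mul continuous_const).continuousOn)
    refine IntegrableOn.of_forall_sdiff_eq_zero
      ((hcont.mono hsub).integrableOn_compact hc.isCompact) e.open_target.measurableSet ?_
    rintro y ⟨-, hy⟩
    simp [hA, wedgeTwo, image_eq_zero_of_notMem_tsupport hy]
  have hmul : ∀ f : Cn (d + 1) → ℝ, LocallyIntegrableOn f e.target →
      IntegrableOn (fun y => f y * lap σ y) e.target := by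
    intro f hf
    refine IntegrableOn.of_forall_sdiff_eq_zero
      ((hf.integrableOn_compact_subset hsub hc.isCompact).mul_continuousOn
        (continuous_lap hσ).continuousOn hc.isCompact) e.open_target.measurableSet ?_
    rintro y ⟨-, hy⟩
    simp [lap_eq_zero hy]
  have hval : ∀ {p q : X → EReal}, EqAddDdc T Ω p q → LocallyIntegrableOn
      (fun y => (p (e.symm y)).toReal - (q (e.symm y)).toReal) e.target →
      T.toLin ψ = (∫ y in e.target, A y) + ∫ y in e.target,
        ((p (e.symm y)).toReal - (q (e.symm y)).toReal) * lap σ y := by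
    intro p q hpq hi
    rw [hpq e he _ hsub hc.isCompact ψ hsupp, ← integral_add hAint (hmul _ hi)]
    refine setIntegral_congr_fun e.open_target.measurableSet fun y hy => ?_
    simp only [hψe y hy, hddc y hy, hA]
  have h1 := (hval hu hiu).symm.trans (hval hv hiv)
  calc _ = ∫ y in e.target, (((up (e.symm y)).toReal - (um (e.symm y)).toReal) * lap σ y -
        ((vp (e.symm y)).toReal - (vm (e.symm y)).toReal) * lap σ y) :=
        integral_congr_ae (ae_of_all _ fun y => sub_mul _ _ _)
    _ = 0 := by
      rw [integral_sub (hmul _ hiu) (hmul _ hiv)]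
      linarith

/-! ### Two representations of a current differ by a constant -/

section Uniqueness

variable {d : ℕ} {X : Type*} [TopologicalSpace X] [ChartedSpace (Cn (d + 1)) X]
  {θ : SmoothForm (d + 1) X 2} {a b p q : X → EReal}

lemma dense_setOf_ne_bot [PreconnectedSpace X] (ha : IsThetaPsh θ a) (hb : IsThetaPsh θ b)
    (hp : IsThetaPsh θ p) (hq : IsThetaPsh θ q) :
    Dense {x | a x ≠ ⊥ ∧ b x ≠ ⊥ ∧ p x ≠ ⊥ ∧ q x ≠ ⊥} := by
  rw [dense_iff_inter_open]
  rintro U hU ⟨x, hxU⟩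
  set e := chartAt (Cn (d + 1)) x
  have he : e ∈ atlas (Cn (d + 1)) X := chart_mem_atlas _ x
  have hxe : x ∈ e.source := mem_chart_source _ x
  have hae : ∀ᵐ z ∂volume.restrict e.target, a (e.symm z) ≠ ⊥ ∧ b (e.symm z) ≠ ⊥ ∧
      p (e.symm z) ≠ ⊥ ∧ q (e.symm z) ≠ ⊥ := by
    filter_upwards [ha.ae_ne_bot he, hb.ae_ne_bot he, hp.ae_ne_bot he, hq.ae_ne_bot he]
      with z h1 h2 h3 h4
    exact ⟨h1, h2, h3, h4⟩
  rw [ae_restrict_iff' e.open_target.measurableSet] at hae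
  obtain ⟨z, ⟨hz1, hz2⟩, hz3⟩ := (Measure.dense_of_ae hae).inter_open_nonempty
    (e.target ∩ e.symm ⁻¹' U) (e.isOpen_inter_preimage_symm hU)
    ⟨e x, e.map_source hxe, by rw [mem_preimage, e.left_inv hxe]; exact hxU⟩
  exact ⟨e.symm z, hz2, hz3 hz1⟩

variable [T2Space X] [PreconnectedSpace X] [IsManifold 𝓘(ℂ, Cn (d + 1)) ω X]
  {T : Current11 d X} {Ω : SmoothForm (d + 1) X 2}

/-- Two representations `(a, b)` and `(p, q)` of the same current differ locally by a continuous
function, which has the mean value property: this is Weyl's lemma for `(a - b) - (p - q)`. -/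
lemma exists_continuousAt_add_eq (ha : IsThetaPsh θ a) (hb : IsThetaPsh θ b)
    (hp : IsThetaPsh θ p) (hq : IsThetaPsh θ q) (hab : EqAddDdc T Ω a b) (hpq : EqAddDdc T Ω p q)
    {e : OpenPartialHomeomorph X (Cn (d + 1))} (he : e ∈ atlas (Cn (d + 1)) X) {y : Cn (d + 1)}
    (hy : y ∈ e.target) :
    ∃ (t r : ℝ) (H : Cn (d + 1) → ℝ), 0 < t ∧ 0 < r ∧ 1 ≤ t * r ^ 2 ∧
      Metric.closedBall y r ⊆ e.target ∧
      kernAvg t (fun z => ((a (e.symm z)).toReal - (b (e.symm z)).toReal) -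
        ((p (e.symm z)).toReal - (q (e.symm z)).toReal)) y = kernMass (d + 1) * H y ∧
      ∀ x ∈ Metric.ball y r, ContinuousAt H x ∧
        a (e.symm x) + q (e.symm x) = p (e.symm x) + b (e.symm x) + (H x : EReal) := by
  obtain ⟨R, hR, hball⟩ := Metric.isOpen_iff.mp e.open_target y hy
  set r := R / 4 with hr
  have hr0 : 0 < r := by positivity
  -- kernels with parameter at least `t₁` are supported in the open ball of radius `r`
  set t₁ := 2 / r ^ 2 with ht₁
  have ht₁0 : 0 < t₁ := by positivity
  have hbig : ∀ {t : ℝ}, t₁ ≤ t → 1 < t * r ^ 2 := fun {t} ht => by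
    calc (1 : ℝ) < 2 := one_lt_two
      _ = t₁ * r ^ 2 := by rw [ht₁, div_mul_cancel₀ _ (by positivity)]
      _ ≤ t * r ^ 2 := by gcongr
  set h : Cn (d + 1) → ℝ := fun z => ((a (e.symm z)).toReal - (b (e.symm z)).toReal) -
        ((p (e.symm z)).toReal - (q (e.symm z)).toReal) with hh
  have hLab : LocallyIntegrableOn
      (fun z => (a (e.symm z)).toReal - (b (e.symm z)).toReal) e.target :=
    (ha.locallyIntegrableOn he).sub (hb.locallyIntegrableOn he)
  have hLpq : LocallyIntegrableOn
      (fun z => (p (e.symm z)).toReal - (q (e.symm z)).toReal) e.target :=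
    (hp.locallyIntegrableOn he).sub (hq.locallyIntegrableOn he)
  have hL : LocallyIntegrableOn h e.target := hLab.sub hLpq
  have hmass := kernMass_pos (d + 1)
  set H : Cn (d + 1) → ℝ := fun x => kernAvg t₁ h x / kernMass (d + 1) with hH
  have hsub : ∀ x ∈ Metric.ball y r, Metric.closedBall x r ⊆ e.target := fun x hx => by
    rw [Metric.mem_ball] at hx
    exact (Metric.closedBall_subset_ball' (by linarith)).trans hball
  have hmean : ∀ x ∈ Metric.ball y r, ∀ t ≥ t₁, kernAvg t h x = kernMass (d + 1) * H x := by
    intro x hx t ht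
    rw [hH, mul_div_cancel₀ _ hmass.ne']
    exact kernAvg_eq_of_weaklyHarmonic hL
      (fun σ hσ hc hs => hab.setIntegral_mul_lap hpq he hLab hLpq hσ hc hs) hr0 (hsub x hx)
      (hbig ht) (hbig le_rfl)
  have hcont : ∀ x ∈ Metric.ball y r, ContinuousAt H x := fun x hx =>
    (continuousAt_kernAvg ht₁0 hr0 (hbig le_rfl).le (hL.integrableOn_compact_subset
      ((Metric.closedBall_subset_ball (by linarith)).trans hball) (isCompact_closedBall _ _))
      hx).div_const _
  have hint : ∀ {w : X → EReal}, IsThetaPsh θ w → ∀ x ∈ Metric.ball y r,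
      IntegrableOn (fun z => (w (e.symm z)).toReal) (Metric.closedBall x r) := fun hw x hx =>
    (hw.locallyIntegrableOn he).integrableOn_compact_subset (hsub x hx) (isCompact_closedBall _ _)
  have hsplit : ∀ x ∈ Metric.ball y r, ∀ t ≥ t₁,
      kernAvg t (fun z => (a (e.symm z)).toReal) x + kernAvg t (fun z => (q (e.symm z)).toReal) x
        = kernAvg t (fun z => (p (e.symm z)).toReal) x +
          kernAvg t (fun z => (b (e.symm z)).toReal) x + kernMass (d + 1) * H x := by
    intro x hx t ht
    have ht0 : 0 < t := ht₁0.trans_le ht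
    rw [← hmean x hx t ht, hh,
      kernAvg_sub (f := fun z => (a (e.symm z)).toReal - (b (e.symm z)).toReal)
        (g := fun z => (p (e.symm z)).toReal - (q (e.symm z)).toReal) ht0 hr0.le (hbig ht).le
        ((hint ha x hx).sub (hint hb x hx)) ((hint hp x hx).sub (hint hq x hx)),
      kernAvg_sub ht0 hr0.le (hbig ht).le (hint ha x hx) (hint hb x hx),
      kernAvg_sub ht0 hr0.le (hbig ht).le (hint hp x hx) (hint hq x hx)]
    ring
  refine ⟨t₁, r, H, ht₁0, hr0, (hbig le_rfl).le, hsub y (Metric.mem_ball_self hr0),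
    hmean y (Metric.mem_ball_self hr0) t₁ le_rfl, fun x hx => ⟨hcont x hx, ?_⟩⟩
  have hxt : x ∈ e.target := hsub x hx (Metric.mem_closedBall_self hr0.le)
  have hnhds := Metric.isOpen_ball.mem_nhds hx
  refine le_antisymm ?_ ?_
  · have h1 := regSup_add_le_of_kernAvg_le (S := {a}) (by rintro u rfl; exact ha) hq hp hb he hxt
      (hcont x hx) (t₀ := t₁) (by
        filter_upwards [hnhds] with x' hx' t ht
        rintro u rfl
        rw [kernAvg_add (ht₁0.trans_le ht) hr0.le (hbig ht).le (hint hp x' hx') (hint hb x' hx')]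
        exact (hsplit x' hx' t ht).le)
    exact (add_le_add (le_regSup (mem_singleton a) _) le_rfl).trans h1
  · have h1 := regSup_add_le_of_kernAvg_le (S := {p}) (by rintro u rfl; exact hp) hb ha hq he hxt
      (H := fun x => -H x) (hcont x hx).neg (t₀ := t₁) (by
        filter_upwards [hnhds] with x' hx' t ht
        rintro u rfl
        rw [kernAvg_add (ht₁0.trans_le ht) hr0.le (hbig ht).le (hint ha x' hx') (hint hq x' hx')]
        linarith [hsplit x' hx' t ht])
    have h2 := add_le_add ((add_le_add (le_regSup (mem_singleton p) _) le_rfl).trans h1)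
      (le_refl (H x : EReal))
    refine h2.trans ?_
    rw [add_assoc (a _ + q _), ← EReal.coe_add, neg_add_cancel, EReal.coe_zero, add_zero]

end Uniqueness

/-- Two representations of the same current as `Ω + ddᶜ (a - b)` differ by a constant. -/
lemma exists_const_add_eq {d : ℕ} {X : Type*} [TopologicalSpace X] [ChartedSpace (Cn (d + 1)) X]
    [T2Space X] [CompactSpace X] [ConnectedSpace X] [IsManifold 𝓘(ℂ, Cn (d + 1)) ω X]
    {θ : SmoothForm (d + 1) X 2} {a b p q : X → EReal} {T : Current11 d X}
    {Ω : SmoothForm (d + 1) X 2} (ha : IsThetaPsh θ a) (hb : IsThetaPsh θ b)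
    (hp : IsThetaPsh θ p) (hq : IsThetaPsh θ q) (hab : EqAddDdc T Ω a b)
    (hpq : EqAddDdc T Ω p q) : ∃ c : ℝ, ∀ x, a x + q x = p x + b x + (c : EReal) := by
  set D : Set X := {x | a x ≠ ⊥ ∧ b x ≠ ⊥ ∧ p x ≠ ⊥ ∧ q x ≠ ⊥} with hD
  have hdense : Dense D := dense_setOf_ne_bot ha hb hp hq
  set h : X → ℝ := fun x => ((a x).toReal - (b x).toReal) - ((p x).toReal - (q x).toReal) with hh
  -- on `D`, the local continuous functions agree with the difference of the potentials
  have hHh : ∀ x ∈ D, ∀ s : ℝ, a x + q x = p x + b x + (s : EReal) → s = h x := by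
    rintro x ⟨h1, h2, h3, h4⟩ s hs
    rw [← EReal.coe_toReal (ha.ne_top x) h1, ← EReal.coe_toReal (hb.ne_top x) h2,
      ← EReal.coe_toReal (hp.ne_top x) h3, ← EReal.coe_toReal (hq.ne_top x) h4] at hs
    norm_cast at hs
    simp only [hh]
    linarith
  have hlim : ∀ (e : OpenPartialHomeomorph X (Cn (d + 1))) (H : Cn (d + 1) → ℝ) (y : Cn (d + 1)),
      y ∈ e.target → ContinuousAt H y → (∀ᶠ x in 𝓝 y,
        a (e.symm x) + q (e.symm x) = p (e.symm x) + b (e.symm x) + (H x : EReal)) →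
      Tendsto h (𝓝[D] (e.symm y)) (𝓝 (H y)) := by
    intro e H y hy hHc hev
    have h1 : Tendsto (fun x => H (e x)) (𝓝 (e.symm y)) (𝓝 (H y)) := by
      have h2 : ContinuousAt H (e (e.symm y)) := by rw [e.right_inv hy]; exact hHc
      have h3 := h2.tendsto.comp (e.continuousAt (e.map_target hy))
      rw [e.right_inv hy] at h3
      exact h3
    refine (h1.mono_left nhdsWithin_le_nhds).congr' ?_
    have h4 : ∀ᶠ x in 𝓝 (e.symm y), a x + q x = p x + b x + (H (e x) : EReal) := by
      rw [← e.symm.map_nhds_eq hy, eventually_map]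
      filter_upwards [hev, e.open_target.mem_nhds hy] with z hz hzt
      rw [e.right_inv hzt]
      exact hz
    filter_upwards [nhdsWithin_le_nhds h4, self_mem_nhdsWithin] with x hx hxD
    exact hHh x hxD _ hx
  set G : X → ℝ := extendFrom D h with hG
  have hGH : ∀ {e : OpenPartialHomeomorph X (Cn (d + 1))} {H : Cn (d + 1) → ℝ} {y : Cn (d + 1)}
      {r : ℝ}, Metric.closedBall y r ⊆ e.target → (∀ x ∈ Metric.ball y r, ContinuousAt H x ∧
        a (e.symm x) + q (e.symm x) = p (e.symm x) + b (e.symm x) + (H x : EReal)) →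
      ∀ x ∈ Metric.ball y r, G (e.symm x) = H x := by
    intro e H y r hsub hloc x hx
    refine extendFrom_eq (hdense _) (hlim e H x (hsub (Metric.ball_subset_closedBall hx))
      (hloc x hx).1 ?_)
    filter_upwards [Metric.isOpen_ball.mem_nhds hx] with z hz using (hloc z hz).2
  have hGc : Continuous G := by
    refine continuous_extendFrom hdense fun x => ?_
    have hxe : x ∈ (chartAt (Cn (d + 1)) x).source := mem_chart_source _ x
    obtain ⟨t, r, H, ht, hr, -, hsub, -, hloc⟩ := exists_continuousAt_add_eq ha hb hp hq hab hpq
      (chart_mem_atlas _ x) (mem_chart_target (Cn (d + 1)) x)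
    refine ⟨H (chartAt (Cn (d + 1)) x x), ?_⟩
    have := hlim _ H _ (mem_chart_target (Cn (d + 1)) x) (hloc _ (Metric.mem_ball_self hr)).1 (by
      filter_upwards [Metric.ball_mem_nhds _ hr] with z hz using (hloc z hz).2)
    rwa [(chartAt (Cn (d + 1)) x).left_inv hxe] at this
  have hGeq : ∀ x, a x + q x = p x + b x + (G x : EReal) := by
    intro x
    have hxe : x ∈ (chartAt (Cn (d + 1)) x).source := mem_chart_source _ x
    obtain ⟨t, r, H, ht, hr, -, hsub, -, hloc⟩ := exists_continuousAt_add_eq ha hb hp hq hab hpq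
      (chart_mem_atlas _ x) (mem_chart_target (Cn (d + 1)) x)
    have h1 := (hloc _ (Metric.mem_ball_self hr)).2
    rw [← hGH hsub hloc _ (Metric.mem_ball_self hr)] at h1
    rwa [(chartAt (Cn (d + 1)) x).left_inv hxe] at h1
  obtain ⟨c, hc⟩ := exists_eq_const_of_kernAvg_eq hGc fun e he y hy => by
    obtain ⟨t, r, H, ht, hr, htr, hsub, havg, hloc⟩ :=
      exists_continuousAt_add_eq ha hb hp hq hab hpq he hy
    refine ⟨t, r, ht, hr, htr, hsub, ?_⟩
    rw [hGH hsub hloc y (Metric.mem_ball_self hr), ← havg]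
    have hae : ∀ᵐ z ∂volume.restrict (Metric.closedBall y r), G (e.symm z) = h (e.symm z) := by
      refine ae_restrict_of_ae_restrict_of_subset hsub ?_
      filter_upwards [ha.ae_ne_bot he, hb.ae_ne_bot he, hp.ae_ne_bot he, hq.ae_ne_bot he]
        with z h1 h2 h3 h4
      exact hHh _ ⟨h1, h2, h3, h4⟩ _ (hGeq _)
    rw [ae_restrict_iff' Metric.isClosed_closedBall.measurableSet] at hae
    refine integral_congr_ae ?_
    filter_upwards [hae] with z hz
    by_cases hzb : z ∈ Metric.closedBall y r
    · rw [hz hzb]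
    · have h0 : kern t (z - y) = 0 := by
        refine kern_eq_zero ht.le hr.le htr ?_
        rw [Metric.mem_closedBall, dist_eq_norm, not_le] at hzb
        exact hzb.le
      rw [h0, zero_mul, zero_mul]
  exact ⟨c, fun x => by rw [hGeq x, hc x]⟩

/-! ### The envelope of the admissible functions -/

lemma add_coe_eq_iff {x y : EReal} {r s : ℝ} :
    x + (s : EReal) = y + (r : EReal) ↔ x = y + ((r : EReal) - (s : EReal)) := by
  rw [← EReal.coe_sub]
  constructor
  · intro h
    calc x = x + (s : EReal) + ((-s : ℝ) : EReal) := by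
          rw [add_assoc, ← EReal.coe_add, add_neg_cancel, EReal.coe_zero, add_zero]
      _ = y + ((r - s : ℝ) : EReal) := by
          rw [h, add_assoc, ← EReal.coe_add, sub_eq_add_neg]
  · rintro rfl
    rw [add_assoc, ← EReal.coe_add, sub_add_cancel]

lemma le_add_coe_of_add_neg_le {x y : EReal} {c : ℝ} (h : x + ((-c : ℝ) : EReal) ≤ y) :
    x ≤ y + (c : EReal) := by
  refine le_trans (le_of_eq ?_) (add_le_add h (le_refl (c : EReal)))
  rw [add_assoc, ← EReal.coe_add, neg_add_cancel, EReal.coe_zero, add_zero]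

section Envelope

variable {d : ℕ} {X : Type*} [TopologicalSpace X] [ChartedSpace (Cn (d + 1)) X]
  {κ : SmoothForm (d + 1) X 2} {n : ℕ} {v w : (X → EReal) × (X → EReal)}

/-- The extensions to `X` of the functions `u + v⁺ - v⁻`, for `u` in `Admissible κ n v`. -/
def Extensions (κ : SmoothForm (d + 1) X 2) (n : ℕ) (v : (X → EReal) × (X → EReal)) :
    Set (X → EReal) :=
  {w | IsThetaPsh ((n : ℝ) • κ) w ∧ ∃ u : X → EReal, IsThetaPsh ((n : ℝ) • κ) u ∧
    (∀ x, u x ≤ 0) ∧ ∀ x, v.1 x ≠ ⊥ → v.2 x ≠ ⊥ → w x = u x + (v.1 x - v.2 x)}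

/-- The relation `w = u + v⁺ - v⁻` where `v⁺` and `v⁻` are finite, written without subtraction. -/
lemma eq_add_sub_iff {a b p q : EReal} (hp : p ≠ ⊥) (hp' : p ≠ ⊤) (hq : q ≠ ⊥) (hq' : q ≠ ⊤) :
    a = b + (p - q) ↔ a + q = b + p := by
  lift p to ℝ using ⟨hp', hp⟩
  lift q to ℝ using ⟨hq', hq⟩
  exact add_coe_eq_iff.symm

/-- If the difference `w⁺ - w⁻` is `v⁺ - v⁻ + c`, then `w⁻` is admissible for `v` after a constant has
been subtracted, and `w⁺` is the corresponding extension after another constant. -/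
lemma exists_sub_const_mem [CompactSpace X] (hv1 : ∀ x, v.1 x ≠ ⊤) (hv2 : ∀ x, v.2 x ≠ ⊤)
    (hw1 : IsThetaPsh ((n : ℝ) • κ) w.1) (hw2 : IsThetaPsh ((n : ℝ) • κ) w.2) {c : ℝ}
    (hc : ∀ x, w.1 x + v.2 x = v.1 x + w.2 x + (c : EReal)) :
    ∃ C : ℝ, (fun x => w.2 x + ((-C : ℝ) : EReal)) ∈ Admissible κ n v ∧
      (fun x => w.1 x + ((-(C + c) : ℝ) : EReal)) ∈ Extensions κ n v := by
  obtain ⟨C, -, hC⟩ := hw2.exists_le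
  have hle : ∀ x, w.2 x + ((-C : ℝ) : EReal) ≤ 0 := fun x => by
    refine (add_le_add (hC x) le_rfl).trans (le_of_eq ?_)
    rw [← EReal.coe_add, add_neg_cancel, EReal.coe_zero]
  have heq : ∀ x, v.1 x ≠ ⊥ → v.2 x ≠ ⊥ → w.1 x + ((-(C + c) : ℝ) : EReal)
      = w.2 x + ((-C : ℝ) : EReal) + (v.1 x - v.2 x) := fun x h1 h2 => by
    rw [eq_add_sub_iff h1 (hv1 x) h2 (hv2 x), add_right_comm, hc x, add_assoc (v.1 x + w.2 x),
      ← EReal.coe_add, add_comm (v.1 x), add_right_comm]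
    congr 3
    ring
  exact ⟨C, ⟨hw2.add_const _, hle, _, hw1.add_const _, heq⟩,
    ⟨hw1.add_const _, _, hw2.add_const _, hle, heq⟩⟩

variable [PreconnectedSpace X]

/-- The members `u + v⁺ - v⁻` of `Extensions κ n v` are bounded almost everywhere by the locally
integrable function `v⁺ - v⁻`, hence locally bounded above. -/
lemma isThetaPsh_regSup_extensions (hv1 : IsThetaPsh ((n : ℝ) • κ) v.1)
    (hv2 : IsThetaPsh ((n : ℝ) • κ) v.2) (hne : (Extensions κ n v).Nonempty) :
    IsThetaPsh ((n : ℝ) • κ) (regSup (Extensions κ n v)) := by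
  refine isThetaPsh_regSup (fun u hu => hu.1) hne fun x => ?_
  have he : chartAt (Cn (d + 1)) x ∈ atlas (Cn (d + 1)) X := chart_mem_atlas _ x
  refine locally_bddAbove_of_ae_le (fun u hu => hu.1) he
    ((hv1.locallyIntegrableOn he).sub (hv2.locallyIntegrableOn he)) ?_ (mem_chart_source _ x)
  rintro w ⟨hw, u, hu, hu0, heq⟩
  filter_upwards [hw.ae_ne_bot he, hv1.ae_ne_bot he, hv2.ae_ne_bot he, hu.ae_ne_bot he]
    with z h1 h2 h3 h4
  have h5 := heq _ h2 h3
  have h6 := hu0 ((chartAt (Cn (d + 1)) x).symm z)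
  rw [← EReal.coe_toReal (hw.ne_top _) h1, ← EReal.coe_toReal (hv1.ne_top _) h2,
    ← EReal.coe_toReal (hv2.ne_top _) h3, ← EReal.coe_toReal (hu.ne_top _) h4] at h5
  rw [← EReal.coe_toReal (hu.ne_top _) h4] at h6
  norm_cast at h5 h6
  simp only [Pi.sub_apply]
  linarith

/-- The envelopes of the admissible functions and of their extensions differ by `v⁺ - v⁻`. -/
lemma regSup_extensions_add_eq (hv1 : IsThetaPsh ((n : ℝ) • κ) v.1)
    (hv2 : IsThetaPsh ((n : ℝ) • κ) v.2)
    (hm : IsThetaPsh ((n : ℝ) • κ) (regSup (Admissible κ n v)))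
    (hp : IsThetaPsh ((n : ℝ) • κ) (regSup (Extensions κ n v))) (x : X) :
    regSup (Extensions κ n v) x + v.2 x = regSup (Admissible κ n v) x + v.1 x := by
  refine le_antisymm ?_ ?_
  · refine regSup_add_le_of_ae (fun u hu => hu.1) hv2 hm hv1 ?_ x
    rintro w ⟨hw, u, hu, hu0, heq⟩ e he
    filter_upwards [hv1.ae_ne_bot he, hv2.ae_ne_bot he] with z h1 h2
    rw [(eq_add_sub_iff h1 (hv1.ne_top _) h2 (hv2.ne_top _)).1 (heq _ h1 h2)]
    exact add_le_add (le_regSup (S := Admissible κ n v) ⟨hu, hu0, w, hw, heq⟩ _) le_rfl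
  · refine regSup_add_le_of_ae (fun u hu => hu.1) hv1 hp hv2 ?_ x
    rintro u ⟨hu, hu0, w, hw, heq⟩ e he
    filter_upwards [hv1.ae_ne_bot he, hv2.ae_ne_bot he] with z h1 h2
    rw [← (eq_add_sub_iff h1 (hv1.ne_top _) h2 (hv2.ne_top _)).1 (heq _ h1 h2)]
    exact add_le_add (le_regSup (S := Extensions κ n v) ⟨hw, u, hu, hu0, heq⟩ _) le_rfl

/-- Whether a pair represents a current depends only on the difference of its components. -/
lemma EqAddDdc.of_eq_add_sub {T : Current11 d X} {Ω : SmoothForm (d + 1) X 2}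
    {θ : SmoothForm (d + 1) X 2} {up um vp vm : X → EReal} (h : EqAddDdc T Ω vp vm)
    (hvp : IsThetaPsh θ vp) (hvm : IsThetaPsh θ vm) (hup : IsThetaPsh θ up) (hum : IsThetaPsh θ um)
    (heq : ∀ x, vp x ≠ ⊥ → vm x ≠ ⊥ → up x = um x + (vp x - vm x)) : EqAddDdc T Ω up um := by
  intro e he K hK hKc ψ hψ
  rw [h e he K hK hKc ψ hψ]
  refine integral_congr_ae ?_
  filter_upwards [hvp.ae_ne_bot he, hvm.ae_ne_bot he, hup.ae_ne_bot he, hum.ae_ne_bot he]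
    with z h1 h2 h3 h4
  have h5 := heq _ h1 h2
  rw [← EReal.coe_toReal (hvp.ne_top _) h1, ← EReal.coe_toReal (hvm.ne_top _) h2,
    ← EReal.coe_toReal (hup.ne_top _) h3, ← EReal.coe_toReal (hum.ne_top _) h4] at h5
  norm_cast at h5
  rw [h5]
  ring

end Envelope

/-- The pair of envelopes attached to a representation is a representation, and it is at most as
singular as any other. -/
lemma exists_minimal_representation {d : ℕ} {X : Type*} [TopologicalSpace X] [T2Space X]
    [CompactSpace X] [ConnectedSpace X] [ChartedSpace (Cn (d + 1)) X]
    [IsManifold 𝓘(ℂ, Cn (d + 1)) ω X] {κ : SmoothForm (d + 1) X 2} {n : ℕ}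
    {v : (X → EReal) × (X → EReal)} {T : Current11 d X} {Ω : SmoothForm (d + 1) X 2}
    (hv : v ∈ Representations κ n T Ω) :
    ∃ up : X → EReal, (up, regSup (Admissible κ n v)) ∈ Representations κ n T Ω ∧
      (∀ x, v.1 x ≠ ⊥ → v.2 x ≠ ⊥ →
        up x = regSup (Admissible κ n v) x + (v.1 x - v.2 x)) ∧
      ∀ w ∈ Representations κ n T Ω, PairLessSingular (up, regSup (Admissible κ n v)) w := by
  obtain ⟨hv1, hv2, hvT⟩ := hv
  -- the family is not empty: it contains `v⁻` minus a constant
  obtain ⟨C, hCA, hCW⟩ := exists_sub_const_mem (c := 0) (κ := κ) (n := n) hv1.ne_top hv2.ne_top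
    hv1 hv2 (fun x => by rw [EReal.coe_zero, add_zero])
  have hm : IsThetaPsh ((n : ℝ) • κ) (regSup (Admissible κ n v)) :=
    isThetaPsh_regSup (fun u hu => hu.1) ⟨_, hCA⟩ fun x =>
      ⟨0, Eventually.of_forall fun y u hu => by simpa using hu.2.1 y⟩
  have hp := isThetaPsh_regSup_extensions hv1 hv2 ⟨_, hCW⟩
  have heq : ∀ x, v.1 x ≠ ⊥ → v.2 x ≠ ⊥ →
      regSup (Extensions κ n v) x = regSup (Admissible κ n v) x + (v.1 x - v.2 x) :=
    fun x h1 h2 => (eq_add_sub_iff h1 (hv1.ne_top x) h2 (hv2.ne_top x)).2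
      (regSup_extensions_add_eq hv1 hv2 hm hp x)
  refine ⟨regSup (Extensions κ n v), ⟨hp, hm, hvT.of_eq_add_sub hv1 hv2 hp hm heq⟩, heq, ?_⟩
  rintro w ⟨hw1, hw2, hwT⟩
  obtain ⟨c, hc⟩ := exists_const_add_eq hw1 hw2 hv1 hv2 hwT hvT
  obtain ⟨C', hA, hW⟩ := exists_sub_const_mem hv1.ne_top hv2.ne_top hw1 hw2 hc
  exact ⟨⟨C' + c, fun x => le_add_coe_of_add_neg_le (le_regSup hW x)⟩,
    ⟨C', fun x => le_add_coe_of_add_neg_le (le_regSup hA x)⟩⟩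

end QuasiPsh

theorem mainTheorem7 (d : ℕ) (X : Type*) [TopologicalSpace X] [T2Space X] [CompactSpace X]
    [ConnectedSpace X] [ChartedSpace (Cn (d + 1)) X]
    [IsManifold 𝓘(ℂ, Cn (d + 1)) ω X]
    (κ : SmoothForm (d + 1) X 2) (hκ : IsKahler κ)
    (T : Current11 d X) (hT : T.IsDiffPosClosed)
    (Ω : SmoothForm (d + 1) X 2) (hΩ : IsPP Ω) (hΩ' : IsClosedForm Ω)
    (n : ℕ) (hne : (Representations κ n T Ω).Nonempty) :
    (∃ u ∈ Representations κ n T Ω, ∀ v ∈ Representations κ n T Ω, PairLessSingular u v) ∧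
    (∀ v ∈ Representations κ n T Ω, ∃ up : X → EReal,
      (up, regSup (Admissible κ n v)) ∈ Representations κ n T Ω ∧
      (∀ x, v.1 x ≠ ⊥ → v.2 x ≠ ⊥ →
        up x = regSup (Admissible κ n v) x + (v.1 x - v.2 x)) ∧
      ∀ w ∈ Representations κ n T Ω, PairLessSingular (up, regSup (Admissible κ n v)) w) := by
  refine ⟨?_, fun v hv => exists_minimal_representation hv⟩
  obtain ⟨v, hv⟩ := hne
  obtain ⟨up, hup, -, hmin⟩ := exists_minimal_representation hv
  exact ⟨_, hup, hmin⟩
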